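/- Let $L\ge 1$ and $N=2^L$. An admissible wave packet tree $T$ is a binary tree with root $W^L_0$ in which every non-leaf node $W^j_m$ satisfies $j\ge 2$ and has exactly the two children $W^{j-1}_{2m}$, $W^{j-1}_{2m+1}$; let $\Lambda_T$ be its set of leaves. $T$ is monotonic if the levels $j$ of its leaves do not decrease from left to right. $T$ is represented by the numbers $m_j^*$, $1\le j\le L$: $m_j^*$ is the index $m$ of the leftmost leaf on level $j$; if level $j$ has no leaf, it is one more than the index of the rightmost node on level $j$; if level $j$ has no node, it is $0$. Let $Q_M=M^{-1/2}\big(e^{2\pi i xk/M}\big)_{0\le k,x<M}$, let $d(i)=i/2$ for even $i$ and $d(i)=-(i+1)/2$ for odd $i$, and for $f\in\mathbb C^N$ and an integer $-N/2\le k<N/2$ let $\hat f[k]$ be the entry of $Q_N^\dagger f$ with index $k \bmod N$. The Shannon wavelets are $\hat\varphi^j_{m,n}(\xi)=e^{-2\pi i n2^{-j}\xi}\,2^{-j/2}\,\mathbf 1\{2^{1-j}\xi\in[-m-1,-m)\cup[m,m+1)\}$. For $W^j_m\in\Lambda_T$, $0\le n<2^j$ and $0\le i<N$ put $C^S_{m2^j+n,\,i}=\overline{\hat\varphi^j_{m,n}(d(i))}$.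 The quantum Shannon wavelet transform of dimension $2^L$ generated by $T$ is $$\sum_{k}f[k]\,|k\rangle\;\mapsto\;\sum_{W^j_m\in\Lambda_T}\ \sum_{n=0}^{2^j-1}\Big(\sum_{i=0}^{N-1}C^S_{m2^j+n,\,i}\,\hat f[d(i)]\Big)|m2^j+n\rangle .$$ **Theorem.** There are an absolute constant $K$ and one fixed classical program such that the following holds for every $L\ge 1$ and every monotonic admissible wave packet tree $T$ with root $W^L_0$. 1. The index blocks $\{m2^j,\dots,(m+1)2^j-1\}$ of the leaves $W^j_m$ partition $\{0,\dots,N-1\}$, and $C^S=\bigoplus_{W^j_m\in\Lambda_T}Q_{2^j}\tilde D_{j,m}$ is block-diagonal, where $\tilde D_{j,m}|c\rangle=|\tilde d(c,j,m)\rangle$ is the retaining decoding, $\tilde d(c,j,m)=d(m2^j+c)\bmod 2^j$. Equivalently, $C^S$ is the product over the levels $1\le j\le L$ of the Fourier transforms $Q_{2^j}$, times the product over the levels of the retaining decodings $\tilde D_{j,m}$, each acting on the $j$ least significant qubits and controlled on the index belonging to a leaf on level $j$. 2. The transform is implemented exactly by a circuit of at most $KL^2$ elementary gates, each acting on one or two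 qubits (Hadamard, $X$, $Z$, phase shifts $\mathrm{diag}(1,e^{\pm 2\pi i/2^k})$, their singly controlled versions, and SWAP), on the $L$ data qubits and some ancilla qubits that start in and return to $|0\rangle$. The circuit is the concatenation of five parts: the map $f\mapsto\sum_q\hat f[d(q)]\,|q\rangle$; the computation into ancilla qubits of the bits $h_1(q),\dots,h_L(q)$, where $h_j(q)=1$ if and only if the leaf whose index block contains $q$ is on a level $\ge j$; the controlled retaining decodings; the controlled quantum Fourier transforms; and the uncomputation of the bits $h_j(q)$. 3. Given $L$ and the binary digits of the numbers $m_j^*$, the program prints the list of gates of this circuit in at most $KL^2$ steps. Here a program is a structured (while) program of a random access machine on natural numbers. Each of the following counts as one step: setting a memory cell to a constant, copying a cell, increasing or decreasing a cell by one, loading or storing through an address held in memory, reading one input digit, comparing two cells, and printing one gate. -/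

import Mathlib

open scoped Matrix

namespace ShannonPacket

/-! ### Wave packet trees -/

/-- Binary trees in which every non-leaf node has exactly two children. The node labels `W^j_m`
are not stored: the root is `W^L_0` and the children of `W^j_m` are `W^(j-1)_(2m)` and
`W^(j-1)_(2m+1)`, so the labels are determined by the shape. -/
inductive PacketTree : Type
  | leaf : PacketTree
  | node : PacketTree → PacketTree → PacketTree

namespace PacketTree

/-- Labels `(j, m)` of the leaves, from left to right, of the tree whose root is `W^j_m`. -/
def leavesFrom : PacketTree → ℕ → ℕ → List (ℕ × ℕ)
  | leaf, j, m => [(j, m)]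
  | node l r, j, m => l.leavesFrom (j - 1) (2 * m) ++ r.leavesFrom (j - 1) (2 * m + 1)

/-- Labels `(j, m)` of all nodes of the tree whose root is `W^j_m`. -/
def nodesFrom : PacketTree → ℕ → ℕ → List (ℕ × ℕ)
  | leaf, j, m => [(j, m)]
  | node l r, j, m =>
      (j, m) :: (l.nodesFrom (j - 1) (2 * m) ++ r.nodesFrom (j - 1) (2 * m + 1))

/-- Leaves `Λ_T` of the tree with root `W^L_0`, from left to right. -/
def leaves (T : PacketTree) (L : ℕ) : List (ℕ × ℕ) := T.leavesFrom L 0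

/-- Nodes of the tree with root `W^L_0`. -/
def nodes (T : PacketTree) (L : ℕ) : List (ℕ × ℕ) := T.nodesFrom L 0

/-- Admissibility of the tree with root on level `L`: every non-leaf node is on a level `≥ 2`. -/
def Admissible : PacketTree → ℕ → Prop
  | leaf, _ => True
  | node l r, j => 2 ≤ j ∧ l.Admissible (j - 1) ∧ r.Admissible (j - 1)

/-- The levels of the leaves do not decrease from left to right. -/
def Monotonic (T : PacketTree) (L : ℕ) : Prop :=
  (T.leaves L).Pairwise fun v w => v.1 ≤ w.1

/-- The index `m_j^*`: the index of the leftmost leaf on level `j`; if level `j` has no leaf, one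
more than the index of the rightmost node on level `j`; if level `j` has no node, `0` (which is
the least strict upper bound of the empty set). -/
noncomputable def leftmost (T : PacketTree) (L j : ℕ) : ℕ :=
  if ∃ w ∈ T.leaves L, w.1 = j then sInf {m | (j, m) ∈ T.leaves L}
  else sInf {m | ∀ m', (j, m') ∈ T.nodes L → m' < m}

/-- The helper decoding predicate `h_j(p)`: the leaf `W^i_m` whose index block
`{m 2^i, …, (m+1) 2^i - 1}` contains `p` is on a level `i ≥ j`. -/
def helper (T : PacketTree) (L j p : ℕ) : Prop :=
  ∃ w ∈ T.leaves L, j ≤ w.1 ∧ p / 2 ^ w.1 = w.2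

instance (T : PacketTree) (L j p : ℕ) : Decidable (T.helper L j p) := by
  unfold helper; infer_instance

end PacketTree

/-! ### The transform -/

/-- Matrix of the quantum Fourier transform of size `N`. -/
noncomputable def qft (N : ℕ) : Matrix (Fin N) (Fin N) ℂ :=
  Matrix.of fun k x =>
    ((√(N : ℝ))⁻¹ : ℝ) * Complex.exp (2 * Real.pi * Complex.I * (x : ℕ) * (k : ℕ) / N)

/-- Frequency decoding `d`. -/
def decode (i : ℕ) : ℤ := if Even i then (i : ℤ) / 2 else -(((i : ℤ) + 1) / 2)

/-- Retaining decoding `d̃(c, j, m) = d(m 2^j + c) mod 2^j`. -/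
def retDecode (c j m : ℕ) : ℕ := (decode (m * 2 ^ j + c) % 2 ^ j).toNat

/-- The window of the Shannon wavelet `W^0_m` in the frequency domain. -/
noncomputable def shannonBase (m : ℕ) : ℝ → ℝ :=
  Set.indicator
    {ξ | 2 * ξ ∈ Set.Ico (-(m : ℝ) - 1) (-(m : ℝ)) ∪ Set.Ico (m : ℝ) ((m : ℝ) + 1)} 1

/-- The Shannon wavelet with scale `j`, frequency `m` and shift `n`, in the frequency domain. -/
noncomputable def shannonHat (j m n : ℕ) (ξ : ℝ) : ℂ :=
  Complex.exp (-(2 * Real.pi * Complex.I * n / 2 ^ j * ξ)) *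
    (((√(2 ^ j : ℝ))⁻¹ * shannonBase m (ξ / 2 ^ j) : ℝ) : ℂ)

/-- The matrix `C^S`: row `m 2^j + n`, for a leaf `W^j_m` and `0 ≤ n < 2^j`, consists of the
conjugated values of the wavelet `(j, m, n)` at the decoded frequencies. -/
noncomputable def shannonMatrix (T : PacketTree) (L : ℕ) :
    Matrix (Fin (2 ^ L)) (Fin (2 ^ L)) ℂ :=
  Matrix.of fun p i => ((T.leaves L).map fun w =>
    if w.2 * 2 ^ w.1 ≤ (p : ℕ) ∧ (p : ℕ) < (w.2 + 1) * 2 ^ w.1 then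
      star (shannonHat w.1 w.2 ((p : ℕ) - w.2 * 2 ^ w.1) (decode i : ℝ))
    else 0).sum

/-- The remainder of `p` modulo `2^j`. -/
def low (j : ℕ) (p : ℕ) : Fin (2 ^ j) := ⟨p % 2 ^ j, Nat.mod_lt _ (by positivity)⟩

/-- The remainder of the integer `k` modulo `2^j`. -/
def lowInt (j : ℕ) (k : ℤ) : Fin (2 ^ j) := low j (k % 2 ^ j).toNat

/-- `f̂[k]`: the entry of `Q_L^† f` with index `k` if `0 ≤ k < N`, and `k + N` if `-N ≤ k < 0`,
where `N = 2^L`. -/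
noncomputable def fhat (L : ℕ) (f : Fin (2 ^ L) → ℂ) (k : ℤ) : ℂ :=
  ((qft (2 ^ L))ᴴ *ᵥ f) (lowInt L k)

/-- Fourier transform followed by frequency encoding, `f ↦ ∑ q, f̂[d(q)] |q⟩`. -/
noncomputable def encodedFourier (L : ℕ) (f : Fin (2 ^ L) → ℂ) : Fin (2 ^ L) → ℂ :=
  fun i => fhat L f (decode i)

/-- The quantum Shannon wavelet transform of size `2^L` generated by `T`. -/
noncomputable def shannonTransform (T : PacketTree) (L : ℕ) (f : Fin (2 ^ L) → ℂ) :
    Fin (2 ^ L) → ℂ :=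
  shannonMatrix T L *ᵥ encodedFourier L f

/-- The operator `|c⟩ ↦ |d̃(c, j, m)⟩` on `j` qubits. -/
def retDecodeMatrix (j m : ℕ) : Matrix (Fin (2 ^ j)) (Fin (2 ^ j)) ℂ :=
  Matrix.of fun r c => if (r : ℕ) = retDecode c j m then 1 else 0

/-- Direct sum over the leaves `W^j_m` of the blocks `B j m`; the block of `W^j_m` sits at the
indices `m 2^j, …, (m+1) 2^j - 1`. -/
def blockSum (T : PacketTree) (L : ℕ) (B : (j m : ℕ) → Matrix (Fin (2 ^ j)) (Fin (2 ^ j)) ℂ) :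
    Matrix (Fin (2 ^ L)) (Fin (2 ^ L)) ℂ :=
  Matrix.of fun p q => ((T.leaves L).map fun w =>
    if (p : ℕ) / 2 ^ w.1 = w.2 ∧ (q : ℕ) / 2 ^ w.1 = w.2 then B w.1 w.2 (low w.1 p) (low w.1 q)
    else 0).sum

/-- The operator on `L` qubits which, on the basis states `|m 2^j + c⟩` that belong to a leaf
`W^j_m` on the given level `j`, acts as `U m` on the `j` least significant qubits, and which is
the identity on all other basis states. -/
def levelControlled (T : PacketTree) (L j : ℕ) (U : ℕ → Matrix (Fin (2 ^ j)) (Fin (2 ^ j)) ℂ) :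
    Matrix (Fin (2 ^ L)) (Fin (2 ^ L)) ℂ :=
  Matrix.of fun p q =>
    if (j, (q : ℕ) / 2 ^ j) ∈ T.leaves L then
      if (p : ℕ) / 2 ^ j = (q : ℕ) / 2 ^ j then U ((q : ℕ) / 2 ^ j) (low j p) (low j q) else 0
    else if p = q then 1 else 0

/-- Product over the levels `1 ≤ j ≤ L` of the controlled quantum Fourier transforms. -/
noncomputable def controlledQFTs (T : PacketTree) (L : ℕ) :
    Matrix (Fin (2 ^ L)) (Fin (2 ^ L)) ℂ :=
  ((List.range' 1 L).map fun j => levelControlled T L j fun _ => qft (2 ^ j)).prod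

/-- Product over the levels `1 ≤ j ≤ L` of the controlled retaining decodings. -/
def controlledDecodings (T : PacketTree) (L : ℕ) : Matrix (Fin (2 ^ L)) (Fin (2 ^ L)) ℂ :=
  ((List.range' 1 L).map fun j => levelControlled T L j fun m => retDecodeMatrix j m).prod

/-! ### Quantum circuits -/

/-- Single-qubit gates: Hadamard, Pauli `X` and `Z`, the phase shift `P_k` and its inverse. -/
inductive Gate1 : Type
  | H : Gate1
  | X : Gate1
  | Z : Gate1
  | P : ℕ → Gate1
  | Pinv : ℕ → Gate1

/-- The unitary matrix of a single-qubit gate. -/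
noncomputable def Gate1.matrix : Gate1 → Matrix (Fin 2) (Fin 2) ℂ
  | H => (((√2)⁻¹ : ℝ) : ℂ) • !![1, 1; 1, -1]
  | X => !![0, 1; 1, 0]
  | Z => !![1, 0; 0, -1]
  | P k => !![1, 0; 0, Complex.exp (2 * Real.pi * Complex.I / 2 ^ k)]
  | Pinv k => !![1, 0; 0, Complex.exp (-(2 * Real.pi * Complex.I / 2 ^ k))]

/-- Rewrites the parameter of a phase shift. -/
def Gate1.map (e : ℕ → ℕ) : Gate1 → Gate1
  | H => H
  | X => X
  | Z => Z
  | P k => P (e k)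
  | Pinv k => Pinv (e k)

/-- Elementary gates on qubits labelled by `ι`, each of them acting on one or two qubits: `single u
q` is `u` on qubit `q`, `ctrl u c t` is `u` on the target `t` controlled on qubit `c` being
`|1⟩`, and `swap a b` exchanges two qubits. -/
inductive Gate (ι : Type) : Type
  | single : Gate1 → ι → Gate ι
  | ctrl : Gate1 → ι → ι → Gate ι
  | swap : ι → ι → Gate ι

/-- Relabels the qubits by `f` and rewrites the parameters of the phase shifts by `e`. -/
def Gate.map {ι κ : Type} (f : ι → κ) (e : ℕ → ℕ) : Gate ι → Gate κ
  | single u q => single (u.map e) (f q)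
  | ctrl u c t => ctrl (u.map e) (f c) (f t)
  | swap a b => swap (f a) (f b)

/-- A two-qubit gate has to act on two different qubits. -/
def Gate.WellFormed {ι : Type} : Gate ι → Prop
  | single _ _ => True
  | ctrl _ c t => c ≠ t
  | swap a b => a ≠ b

/-- The matrix `u` applied to qubit `q` of a state, a state being given by its amplitudes in the
computational basis. -/
def applyAt {ι : Type} [DecidableEq ι] (u : Matrix (Fin 2) (Fin 2) ℂ) (q : ι)
    (ψ : (ι → Fin 2) → ℂ) : (ι → Fin 2) → ℂ :=
  fun x => ∑ b : Fin 2, u (x q) b * ψ (Function.update x q b)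

/-- Action of a gate on a state. -/
noncomputable def Gate.apply {ι : Type} [DecidableEq ι] (g : Gate ι) (ψ : (ι → Fin 2) → ℂ) :
    (ι → Fin 2) → ℂ :=
  match g with
  | single u q => applyAt u.matrix q ψ
  | ctrl u c t => fun x => if x c = 1 then applyAt u.matrix t ψ x else ψ x
  | swap a b => fun x => ψ (x ∘ Equiv.swap a b)

/-- Action of a circuit, a list of gates applied from the head on. -/
noncomputable def runCircuit {ι : Type} [DecidableEq ι] (c : List (Gate ι))
    (ψ : (ι → Fin 2) → ℂ) : (ι → Fin 2) → ℂ :=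
  c.foldl (fun φ g => g.apply φ) ψ

/-- The number in `{0, …, 2^L - 1}` written in the first `L` qubits, qubit `i` having weight
`2^i`. -/
def dataPart {L a : ℕ} (x : Fin (L + a) → Fin 2) : Fin (2 ^ L) :=
  finFunctionFinEquiv fun i => x (Fin.castAdd a i)

/-- The contents of the last `a` qubits. -/
def ancillaPart {L a : ℕ} (x : Fin (L + a) → Fin 2) : Fin a → Fin 2 :=
  fun i => x (Fin.natAdd L i)

/-- The state `∑ q, ψ q |q⟩ |s q⟩` on `L` data qubits and `a` ancilla qubits. -/
def withAncilla {L a : ℕ} (s : Fin (2 ^ L) → Fin a → Fin 2) (ψ : Fin (2 ^ L) → ℂ) :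
    (Fin (L + a) → Fin 2) → ℂ :=
  fun x => if ancillaPart x = s (dataPart x) then ψ (dataPart x) else 0

/-- All ancilla qubits are in the state `|0⟩`. -/
def zeroAncilla (L a : ℕ) : Fin (2 ^ L) → Fin a → Fin 2 := fun _ _ => 0

/-- Ancilla qubits `0, …, L - 1` hold the bits `h_1(q), …, h_L(q)`, the others are `|0⟩`. -/
def helperAncilla (T : PacketTree) (L a : ℕ) : Fin (2 ^ L) → Fin a → Fin 2 :=
  fun q i => if (i : ℕ) < L ∧ T.helper L ((i : ℕ) + 1) q then 1 else 0

/-- The circuit `c` maps `∑ q, ψ q |q⟩ |s q⟩` to `∑ q, (F ψ) q |q⟩ |s' q⟩`, exactly and for every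
`ψ`. -/
def Realizes {L a : ℕ} (c : List (Gate (Fin (L + a)))) (s s' : Fin (2 ^ L) → Fin a → Fin 2)
    (F : (Fin (2 ^ L) → ℂ) → (Fin (2 ^ L) → ℂ)) : Prop :=
  ∀ ψ, runCircuit c (withAncilla s ψ) = withAncilla s' (F ψ)

/-! ### Classical computations: a successor random access machine with a step count -/

/-- Configuration: a memory of natural numbers, and the list of gates printed so far. -/
structure Conf : Type where
  mem : ℕ → ℕ
  out : List (Gate ℕ)

/-- Structured programs. Numbers in instructions are memory addresses, except for the constant
`v` of `const`. As a stored number grows by at most one per step, numbers in a computation of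
polynomially many steps have logarithmically many bits. -/
inductive Prog : Type
  /-- `mem[d] := v` -/
  | const (d v : ℕ) : Prog
  /-- `mem[d] := mem[s]` -/
  | copy (d s : ℕ) : Prog
  /-- `mem[d] := mem[d] + 1` -/
  | incr (d : ℕ) : Prog
  /-- `mem[d] := mem[d] - 1`, where `0 - 1 = 0` -/
  | decr (d : ℕ) : Prog
  /-- `mem[d] := mem[mem[s]]` -/
  | load (d s : ℕ) : Prog
  /-- `mem[mem[d]] := mem[s]` -/
  | store (d s : ℕ) : Prog
  /-- `mem[d]` becomes the bit of the input table in row `mem[r]` and column `mem[c]` -/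
  | read (d r c : ℕ) : Prog
  /-- print the gate `g`, its qubits and its phase parameter being taken from the memory cells
  that stand in their places -/
  | print (g : Gate ℕ) : Prog
  /-- first `p`, then `q` -/
  | seq (p q : Prog) : Prog
  /-- if `mem[x] < mem[y]` then `p` else `q` -/
  | branch (x y : ℕ) (p q : Prog) : Prog
  /-- while `mem[x] < mem[y]` do `p` -/
  | loop (x y : ℕ) (p : Prog) : Prog

/-- `Exec inp p σ τ t`: started in the configuration `σ` with the input table `inp`, the program
`p` stops in the configuration `τ` after `t` steps. Every instruction, every printed gate and
every evaluation of a test counts as one step. -/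
inductive Exec (inp : ℕ → ℕ → Bool) : Prog → Conf → Conf → ℕ → Prop
  | const (d v : ℕ) (σ : Conf) :
      Exec inp (.const d v) σ ⟨Function.update σ.mem d v, σ.out⟩ 1
  | copy (d s : ℕ) (σ : Conf) :
      Exec inp (.copy d s) σ ⟨Function.update σ.mem d (σ.mem s), σ.out⟩ 1
  | incr (d : ℕ) (σ : Conf) :
      Exec inp (.incr d) σ ⟨Function.update σ.mem d (σ.mem d + 1), σ.out⟩ 1
  | decr (d : ℕ) (σ : Conf) :
      Exec inp (.decr d) σ ⟨Function.update σ.mem d (σ.mem d - 1), σ.out⟩ 1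
  | load (d s : ℕ) (σ : Conf) :
      Exec inp (.load d s) σ ⟨Function.update σ.mem d (σ.mem (σ.mem s)), σ.out⟩ 1
  | store (d s : ℕ) (σ : Conf) :
      Exec inp (.store d s) σ ⟨Function.update σ.mem (σ.mem d) (σ.mem s), σ.out⟩ 1
  | read (d r c : ℕ) (σ : Conf) :
      Exec inp (.read d r c) σ
        ⟨Function.update σ.mem d (inp (σ.mem r) (σ.mem c)).toNat, σ.out⟩ 1
  | print (g : Gate ℕ) (σ : Conf) :
      Exec inp (.print g) σ ⟨σ.mem, σ.out ++ [g.map σ.mem σ.mem]⟩ 1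
  | seq {p q : Prog} {σ τ υ : Conf} {s t : ℕ} :
      Exec inp p σ τ s → Exec inp q τ υ t → Exec inp (.seq p q) σ υ (s + t)
  | branch_true {x y : ℕ} {p q : Prog} {σ τ : Conf} {t : ℕ} :
      σ.mem x < σ.mem y → Exec inp p σ τ t → Exec inp (.branch x y p q) σ τ (t + 1)
  | branch_false {x y : ℕ} {p q : Prog} {σ τ : Conf} {t : ℕ} :
      ¬ σ.mem x < σ.mem y → Exec inp q σ τ t → Exec inp (.branch x y p q) σ τ (t + 1)
  | loop_true {x y : ℕ} {p : Prog} {σ τ υ : Conf} {s t : ℕ} :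
      σ.mem x < σ.mem y → Exec inp p σ τ s → Exec inp (.loop x y p) τ υ t →
        Exec inp (.loop x y p) σ υ (s + t + 1)
  | loop_false {x y : ℕ} {p : Prog} {σ : Conf} :
      ¬ σ.mem x < σ.mem y → Exec inp (.loop x y p) σ σ 1

/-- Initial configuration: `mem[0] = L`, all other cells are `0`, nothing is printed. -/
def initConf (L : ℕ) : Conf := ⟨fun i => if i = 0 then L else 0, []⟩

/-- The input table: row `j` holds the binary digits of `m_j^*`, column `i` the digit of weight
`2^i`. -/
noncomputable def treeInput (T : PacketTree) (L : ℕ) : ℕ → ℕ → Bool :=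
  fun j i => (T.leftmost L j).testBit i

end ShannonPacket

open ShannonPacket

namespace ShannonPacket

/-! The frequency ordering `d` sends the index block of a leaf `W^j_m` exactly onto the two
frequency windows of that wavelet, so a row of the Shannon matrix is supported on one block. There
its entry is an exponential in `d(i)` that depends only on `d(i)` modulo `2^j`, which makes each
block a Fourier matrix times a permutation (`shannonBase_decode`, `star_shannonHat`). Every index
lies in the block of exactly one leaf, so the product over the levels collapses to this direct sum
(`prod_levelControlled`).

In a monotonic tree the leaf level is a nondecreasing function of the index. Hence `h_j(q)` is a
threshold test, namely whether `m_j^*` is at most the number formed by the bits of `q` from position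
`j` on (`leftmost_le_iff`). A ripple comparison with the classical digits of `m_j^*` costs `O(L)`
gates for each `j`.

The Fourier transform of `j` qubits consists of the stages `j - 1, …, 0` followed by a bit reversal,
and stage `t` is the same for all `j > t`. One run of `L` stages, stage `t` being controlled on
`h_{t+1}`, therefore performs the transforms of all levels at once in `O(L^2)` gates
(`stages_restrict`). Only bit reversals and retaining decodings are done level by level, controlled
on `h_j + h_{j+1}` modulo 2; each costs `O(j)` gates, because on bits the retaining decoding is a
one-place shift with a conditional complement (`retDecode_val`). None of these operations moves a
basis state out of its leaf, so the helper bits stay valid (`controlled_op`). The initial transform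
`f ↦ f̂` reuses the same circuits for the one-leaf tree, all of whose helper bits are 1. The helper
bits are added modulo 2 to their qubits, so the same circuit uncomputes them.

Circuits are analysed on functions of infinite bit strings, with qubits labelled by natural numbers,
and are then transferred to finitely many qubits (`realizes_of_nat`). The program is verified with
triples `Prints` that record output, step bound and register contents. Since printing costs a step,
the step bound also bounds the number of gates (`Exec.length_le`). -/

theorem div_two_pow_div {a b : ℕ} (p : ℕ) (h : a ≤ b) : p / 2 ^ a / 2 ^ (b - a) = p / 2 ^ b := by
  rw [Nat.div_div_eq_div_mul, ← pow_add, Nat.add_sub_cancel' h]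

theorem div_two_pow_congr {a b p q : ℕ} (h : a ≤ b) (e : p / 2 ^ a = q / 2 ^ a) :
    p / 2 ^ b = q / 2 ^ b := by
  rw [← div_two_pow_div p h, ← div_two_pow_div q h, e]

/-! ### Leaf levels and index blocks of a wave packet tree. -/

namespace PacketTree

/-- Level of the leaf whose index block contains `p`, in the subtree with root on level `j`. -/
def levelFrom : PacketTree → ℕ → ℕ → ℕ
  | leaf, j, _ => j
  | node l r, j, p =>
      if p / 2 ^ (j - 1) % 2 = 0 then l.levelFrom (j - 1) p else r.levelFrom (j - 1) p

/-- Level of the leaf whose index block contains `p`. -/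
def level (T : PacketTree) (L p : ℕ) : ℕ := T.levelFrom L p

/-- Bit `j - 1` of `p` decides in which half of its block `p` lies; `levelFrom` descends the tree by
this test. -/
theorem half_block {j m p : ℕ} (hj : 2 ≤ j) (hp : p / 2 ^ j = m) :
    (p / 2 ^ (j - 1) % 2 = 0 ∧ p / 2 ^ (j - 1) = 2 * m) ∨
      (p / 2 ^ (j - 1) % 2 ≠ 0 ∧ p / 2 ^ (j - 1) = 2 * m + 1) := by
  have := div_two_pow_div p (show j - 1 ≤ j by omega)
  rw [show j - (j - 1) = 1 by omega] at this
  omega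

/-- The last clause says that `W^j_m` is the ancestor of the leaf on level `j`. Leaves stay on
levels `≥ 1` because only nodes on levels `≥ 2` are split. -/
theorem leavesFrom_bounds : ∀ (T : PacketTree) (j m : ℕ), 1 ≤ j → T.Admissible j →
    ∀ w ∈ T.leavesFrom j m, 1 ≤ w.1 ∧ w.1 ≤ j ∧ w.2 / 2 ^ (j - w.1) = m
  | leaf, j, m, hj, _, w, hw => by
      simp only [leavesFrom, List.mem_singleton] at hw
      subst hw
      simp [hj]
  | node l r, j, m, hj, ⟨h2, hl, hr⟩, w, hw => by
      have key : ∀ m', w.1 ≤ j - 1 → w.2 / 2 ^ (j - 1 - w.1) = m' → w.2 / 2 ^ (j - w.1) = m' / 2 :=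
          by
        intro m' h1 h
        rw [← h, Nat.div_div_eq_div_mul, ← pow_succ]
        congr 2; omega
      simp only [leavesFrom, List.mem_append] at hw
      rcases hw with hw | hw
      · obtain ⟨a, b, c⟩ := leavesFrom_bounds l (j - 1) _ (by omega) hl w hw
        exact ⟨a, by omega, by rw [key _ b c]; omega⟩
      · obtain ⟨a, b, c⟩ := leavesFrom_bounds r (j - 1) _ (by omega) hr w hw
        exact ⟨a, by omega, by rw [key _ b c]; omega⟩

theorem block_of_leaf {T : PacketTree} {j m p : ℕ} (hj : 1 ≤ j) (hT : T.Admissible j)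
    {w : ℕ × ℕ} (hw : w ∈ T.leavesFrom j m) (hp : p / 2 ^ w.1 = w.2) : p / 2 ^ j = m := by
  obtain ⟨_, h2, h3⟩ := leavesFrom_bounds T j m hj hT w hw
  rw [← div_two_pow_div p h2, hp, h3]

theorem levelFrom_mem : ∀ (T : PacketTree) (j m p : ℕ), T.Admissible j → p / 2 ^ j = m →
    (T.levelFrom j p, p / 2 ^ T.levelFrom j p) ∈ T.leavesFrom j m
  | leaf, j, m, p, _, hp => by simp [leavesFrom, levelFrom, hp]
  | node l r, j, m, p, ⟨h2, hl, hr⟩, hp => by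
      rcases half_block h2 hp with ⟨h, e⟩ | ⟨h, e⟩
      · simp only [levelFrom, leavesFrom, h, if_true, List.mem_append]
        exact Or.inl (levelFrom_mem l (j - 1) _ p hl e)
      · simp only [levelFrom, leavesFrom, h, if_false, List.mem_append]
        exact Or.inr (levelFrom_mem r (j - 1) _ p hr e)

theorem levelFrom_unique : ∀ (T : PacketTree) (j m p : ℕ), 1 ≤ j → T.Admissible j →
    ∀ w ∈ T.leavesFrom j m, p / 2 ^ w.1 = w.2 → w.1 = T.levelFrom j p
  | leaf, j, m, p, _, _, w, hw, hp => by
      simp only [leavesFrom, List.mem_singleton] at hw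
      subst hw; rfl
  | node l r, j, m, p, hj, ⟨h2, hl, hr⟩, w, hw, hp => by
      simp only [leavesFrom, List.mem_append] at hw
      rcases hw with hw | hw
      · have e := block_of_leaf (by omega) hl hw hp
        simp only [levelFrom, e]
        simpa using levelFrom_unique l (j - 1) _ p (by omega) hl w hw hp
      · have e := block_of_leaf (by omega) hr hw hp
        simp only [levelFrom, e]
        simpa [Nat.add_mod] using levelFrom_unique r (j - 1) _ p (by omega) hr w hw hp

/-- The order of the list of leaves is the order of their index blocks, so monotonicity along the
list becomes monotonicity of the level as a function of the index. -/
theorem leaf_le_of_monotone : ∀ (T : PacketTree) (j m : ℕ), 1 ≤ j → T.Admissible j →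
    (T.leavesFrom j m).Pairwise (fun v w => v.1 ≤ w.1) → ∀ v ∈ T.leavesFrom j m,
    ∀ w ∈ T.leavesFrom j m, ∀ p q, p / 2 ^ v.1 = v.2 → q / 2 ^ w.1 = w.2 → p ≤ q → v.1 ≤ w.1
  | leaf, j, m, _, _, _, v, hv, w, hw, p, q, _, _, _ => by
      simp only [leavesFrom, List.mem_singleton] at hv hw
      rw [hv, hw]
  | node l r, j, m, hj, ⟨h2, hl, hr⟩, hm, v, hv, w, hw, p, q, hp, hq, hpq => by
      simp only [leavesFrom, List.mem_append] at hv hw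
      simp only [leavesFrom, List.pairwise_append] at hm
      rcases hv with hv | hv <;> rcases hw with hw | hw
      · exact leaf_le_of_monotone l _ _ (by omega) hl hm.1 v hv w hw p q hp hq hpq
      · exact hm.2.2 v hv w hw
      -- Here `p` lies in the right half and `q` in the left half, contrary to `p ≤ q`.
      · have e := block_of_leaf (by omega) hr hv hp
        have e' := block_of_leaf (by omega) hl hw hq
        have := Nat.div_le_div_right (c := 2 ^ (j - 1)) hpq
        omega
      · exact leaf_le_of_monotone r _ _ (by omega) hr hm.2.1 v hv w hw p q hp hq hpq

theorem nodesFrom_bounds : ∀ (T : PacketTree) (j m : ℕ), 1 ≤ j → T.Admissible j →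
    ∀ w ∈ T.nodesFrom j m, w.1 ≤ j ∧ w.2 / 2 ^ (j - w.1) = m
  | leaf, j, m, hj, _, w, hw => by
      simp only [nodesFrom, List.mem_singleton] at hw
      subst hw
      simp
  | node l r, j, m, hj, ⟨h2, hl, hr⟩, w, hw => by
      have key : ∀ m', w.1 ≤ j - 1 → w.2 / 2 ^ (j - 1 - w.1) = m' → w.2 / 2 ^ (j - w.1) = m' / 2 :=
          by
        intro m' h1 h
        rw [← h, Nat.div_div_eq_div_mul, ← pow_succ]
        congr 2; omega
      simp only [nodesFrom, List.mem_cons, List.mem_append] at hw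
      rcases hw with rfl | hw | hw
      · simp
      · obtain ⟨b, c⟩ := nodesFrom_bounds l (j - 1) _ (by omega) hl w hw
        exact ⟨by omega, by rw [key _ b c]; omega⟩
      · obtain ⟨b, c⟩ := nodesFrom_bounds r (j - 1) _ (by omega) hr w hw
        exact ⟨by omega, by rw [key _ b c]; omega⟩

theorem levelFrom_le : ∀ (T : PacketTree) (j p : ℕ), T.levelFrom j p ≤ j
  | leaf, j, p => le_rfl
  | node l r, j, p => by
      have h1 := levelFrom_le l (j - 1) p
      have h2 := levelFrom_le r (j - 1) p
      simp only [levelFrom]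
      split <;> omega

/-- The nodes whose blocks contain `p` form the path from the root to the leaf of `p`, one on each
level between the two. -/
theorem mem_nodesFrom_iff : ∀ (T : PacketTree) (j m i p : ℕ), 1 ≤ j → T.Admissible j → i ≤ j →
    p / 2 ^ j = m → ((i, p / 2 ^ i) ∈ T.nodesFrom j m ↔ T.levelFrom j p ≤ i)
  | leaf, j, m, i, p, _, _, hi, hp => by
      simp only [nodesFrom, List.mem_singleton, levelFrom, Prod.mk.injEq]
      constructor
      · rintro ⟨h, -⟩; exact h.ge
      · intro h
        have : i = j := by omega
        subst this; exact ⟨rfl, hp⟩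
  | node l r, j, m, i, p, hj, ⟨h2, hl, hr⟩, hi, hp => by
      rcases Nat.lt_or_ge i j with hij | hij
      · have aux : ∀ (S : PacketTree) (m' : ℕ), S.Admissible (j - 1) →
            (i, p / 2 ^ i) ∈ S.nodesFrom (j - 1) m' → p / 2 ^ (j - 1) = m' := by
          intro S m' hS h
          obtain ⟨h3, h4⟩ := nodesFrom_bounds S (j - 1) m' (by omega) hS _ h
          rwa [div_two_pow_div p h3] at h4
        have hne : ¬ (i = j ∧ p / 2 ^ i = m) := by omega
        simp only [nodesFrom, List.mem_cons, List.mem_append, Prod.mk.injEq, hne, false_or,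
            levelFrom]
        rcases half_block h2 hp with ⟨h, e⟩ | ⟨h, e⟩
        · rw [if_pos h, ← mem_nodesFrom_iff l (j - 1) _ i p (by omega) hl (by omega) e]
          constructor
          · rintro (h' | h')
            · exact h'
            · have := aux r _ hr h'; omega
          · exact Or.inl
        · rw [if_neg h, ← mem_nodesFrom_iff r (j - 1) _ i p (by omega) hr (by omega) e]
          constructor
          · rintro (h' | h')
            · have := aux l _ hl h'; omega
            · exact h'
          · exact Or.inr
      · have : i = j := by omega
        subst this
        simp only [nodesFrom, List.mem_cons, hp, true_or, true_iff]
        exact levelFrom_le _ _ _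

theorem level_unique {T : PacketTree} {L : ℕ} (hL : 1 ≤ L) (hT : T.Admissible L)
    {p : ℕ} {w : ℕ × ℕ} (hw : w ∈ T.leaves L) (hp : p / 2 ^ w.1 = w.2) :
    w.1 = T.level L p :=
  levelFrom_unique T L 0 p hL hT w hw hp

theorem level_mem {T : PacketTree} {L : ℕ} (hT : T.Admissible L)
    {p : ℕ} (hp : p < 2 ^ L) : (T.level L p, p / 2 ^ T.level L p) ∈ T.leaves L :=
  levelFrom_mem T L 0 p hT (Nat.div_eq_of_lt hp)

theorem level_pos {T : PacketTree} {L : ℕ} (hL : 1 ≤ L) (hT : T.Admissible L)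
    {p : ℕ} (hp : p < 2 ^ L) : 1 ≤ T.level L p :=
  (leavesFrom_bounds T L 0 hL hT _ (level_mem hT hp)).1

theorem level_le (T : PacketTree) (L p : ℕ) : T.level L p ≤ L := levelFrom_le _ _ _

/-- A block of size `2^j` around `p` with `j ≤ T.level L p` is contained in the block of the leaf of
`p`. -/
theorem level_congr {T : PacketTree} {L : ℕ} (hL : 1 ≤ L) (hT : T.Admissible L)
    {p q j : ℕ} (hp : p < 2 ^ L) (hj : j ≤ T.level L p)
    (h : p / 2 ^ j = q / 2 ^ j) : T.level L q = T.level L p :=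
  (level_unique hL hT (level_mem hT hp) (div_two_pow_congr hj h).symm).symm

theorem mem_leaves_iff {T : PacketTree} {L : ℕ} (hL : 1 ≤ L) (hT : T.Admissible L)
    {p j : ℕ} (hp : p < 2 ^ L) :
    (j, p / 2 ^ j) ∈ T.leaves L ↔ T.level L p = j := by
  constructor
  · intro h; exact (level_unique hL hT h rfl).symm
  · rintro rfl; exact level_mem hT hp

theorem helper_iff {T : PacketTree} {L : ℕ} (hL : 1 ≤ L) (hT : T.Admissible L)
    {p j : ℕ} (hp : p < 2 ^ L) : T.helper L j p ↔ j ≤ T.level L p := by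
  constructor
  · rintro ⟨w, hw, hj, h⟩
    rwa [← level_unique hL hT hw h]
  · intro h
    exact ⟨_, level_mem hT hp, h, rfl⟩

theorem level_mono {T : PacketTree} {L : ℕ} (hL : 1 ≤ L) (hT : T.Admissible L)
    (hm : T.Monotonic L) {p q : ℕ} (hq : q < 2 ^ L) (h : p ≤ q) :
    T.level L p ≤ T.level L q :=
  leaf_le_of_monotone T L 0 hL hT hm _ (level_mem hT (h.trans_lt hq)) _ (level_mem hT hq)
    p q rfl rfl h

theorem lt_of_leaf {T : PacketTree} {L : ℕ} (hL : 1 ≤ L) (hT : T.Admissible L)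
    {j m : ℕ} (h : (j, m) ∈ T.nodes L ∨ (j, m) ∈ T.leaves L) :
    j ≤ L ∧ m * 2 ^ j < 2 ^ L := by
  have : j ≤ L ∧ m / 2 ^ (L - j) = 0 := by
    rcases h with h | h
    · exact nodesFrom_bounds T L 0 hL hT _ h
    · exact (leavesFrom_bounds T L 0 hL hT _ h).2
  refine ⟨this.1, ?_⟩
  have h2 : m < 2 ^ (L - j) := by
    rcases Nat.div_eq_zero_iff.1 this.2 with h | h
    · exact absurd h (by positivity)
    · exact h
  calc m * 2 ^ j < 2 ^ (L - j) * 2 ^ j := by gcongr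
    _ = 2 ^ L := by rw [← pow_add, Nat.sub_add_cancel this.1]

/-- This is the only use made of the numbers `m_j^*`: the three cases of their definition are
arranged so that all helper predicates become comparisons. -/
theorem leftmost_le_iff {T : PacketTree} {L : ℕ} (hL : 1 ≤ L) (hT : T.Admissible L)
    (hm : T.Monotonic L) {q j : ℕ} (hq : q < 2 ^ L) (hj : j ≤ L) :
    T.leftmost L j ≤ q / 2 ^ j ↔ j ≤ T.level L q := by
  unfold leftmost
  have hpos : 0 < 2 ^ j := by positivity
  split_ifs with h
  · obtain ⟨⟨j', m⟩, hw, hj'⟩ := h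
    simp only at hj'
    subst hj'
    have hne : {m | (j', m) ∈ T.leaves L}.Nonempty := ⟨m, hw⟩
    have hin := Nat.sInf_mem hne
    set m0 := sInf {m | (j', m) ∈ T.leaves L} with hm0
    have hlt := (lt_of_leaf hL hT (Or.inr hin)).2
    have hlev : T.level L (m0 * 2 ^ j') = j' :=
      (level_unique hL hT hin (Nat.mul_div_cancel _ hpos)).symm
    constructor
    · intro h
      rw [Nat.le_div_iff_mul_le hpos] at h
      have := level_mono hL hT hm hq h
      rwa [hlev] at this
    · intro h
      -- Otherwise `q` comes before the block of `m0`, so its level is at most `j'` by monotonicity,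
      -- hence equal to `j'`; its leaf would lie to the left of the leftmost one.
      by_contra hc
      push Not at hc
      have h1 : q ≤ m0 * 2 ^ j' := by
        rw [Nat.div_lt_iff_lt_mul hpos] at hc; exact hc.le
      have h2 := level_mono hL hT hm hlt h1
      have h3 : (j', q / 2 ^ j') ∈ T.leaves L := (mem_leaves_iff hL hT hq).2 (by omega)
      exact absurd (Nat.sInf_le (s := {m | (j', m) ∈ T.leaves L}) h3) (by simp only [← hm0]; omega)
  -- Nodes on level `j` are the blocks of indices of level at most `j`, here strictly less, and by
  -- monotonicity these come first. If there is no node, every number is a strict upper bound and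
  -- the infimum is `0`.
  · have hne : {m | ∀ m', (j, m') ∈ T.nodes L → m' < m}.Nonempty :=
      ⟨2 ^ L, fun m' h' => lt_of_le_of_lt (Nat.le_mul_of_pos_right _ hpos)
        (lt_of_leaf hL hT (Or.inl h')).2⟩
    have hin := Nat.sInf_mem hne
    constructor
    · intro hc
      by_contra hlt
      push Not at hlt
      have h3 := (mem_nodesFrom_iff T L 0 j q hL hT hj (Nat.div_eq_of_lt hq)).2 hlt.le
      have := hin _ h3
      omega
    · intro hlev
      have hne' : T.level L q ≠ j := fun e => h ⟨_, (mem_leaves_iff hL hT hq).2 e, rfl⟩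
      refine Nat.sInf_le fun m' h' => ?_
      have hb := (lt_of_leaf hL hT (Or.inl h')).2
      have e : m' * 2 ^ j / 2 ^ j = m' := Nat.mul_div_cancel _ hpos
      have h1 := (mem_nodesFrom_iff T L 0 j (m' * 2 ^ j) hL hT hj (Nat.div_eq_of_lt hb)).1
        (by rw [e]; exact h')
      have h2 : m' * 2 ^ j < q := by
        by_contra hc
        have := level_mono hL hT hm hb (not_lt.1 hc)
        simp only [level] at *; omega
      have h4 : m' ≤ q / 2 ^ j := by rw [Nat.le_div_iff_mul_le hpos]; exact h2.le
      refine lt_of_le_of_ne h4 fun e' => ?_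
      have h5 := (mem_nodesFrom_iff T L 0 j q hL hT hj (Nat.div_eq_of_lt hq)).1 (by rw [← e']; exact h')
      simp only [level] at *; omega

/-- Equality occurs when no index has level `≥ j`. The digit at position `L - j` then lies beyond
the bits to be compared, and the comparison circuit treats it separately. -/
theorem leftmost_le {T : PacketTree} {L : ℕ} (hL : 1 ≤ L) (hT : T.Admissible L)
    {j : ℕ} (hj : j ≤ L) : T.leftmost L j ≤ 2 ^ (L - j) := by
  have aux : ∀ m, m * 2 ^ j < 2 ^ L → m < 2 ^ (L - j) := by
    intro m h
    have : 2 ^ L = 2 ^ (L - j) * 2 ^ j := by rw [← pow_add, Nat.sub_add_cancel hj]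
    rw [this] at h
    exact lt_of_mul_lt_mul_right h (by positivity)
  unfold leftmost
  split_ifs with h
  · obtain ⟨⟨j', m⟩, hw, hj'⟩ := h
    simp only at hj'
    subst hj'
    exact (Nat.sInf_le (s := {m | (j', m) ∈ T.leaves L}) hw).trans
      (aux _ (lt_of_leaf hL hT (Or.inr hw)).2).le
  · exact Nat.sInf_le fun m' h' => aux _ (lt_of_leaf hL hT (Or.inl h')).2

theorem existsUnique_leaf {T : PacketTree} {L : ℕ} (hL : 1 ≤ L) (hT : T.Admissible L)
    {p : ℕ} (hp : p < 2 ^ L) :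
    ∃! w : ℕ × ℕ, w ∈ T.leaves L ∧ p / 2 ^ w.1 = w.2 := by
  refine ⟨_, ⟨level_mem hT hp, rfl⟩, ?_⟩
  rintro ⟨j, m⟩ ⟨h1, h2⟩
  have := level_unique hL hT h1 h2
  simp only at this h2
  subst this; subst h2; rfl

end PacketTree

/-! ### Block decomposition of the transform -/

theorem block_lt {L j p c : ℕ} (hj : j ≤ L) (hp : p < 2 ^ L) (hc : c < 2 ^ j) :
    p / 2 ^ j * 2 ^ j + c < 2 ^ L := by
  have h2 : 2 ^ L = 2 ^ (L - j) * 2 ^ j := by rw [← pow_add, Nat.sub_add_cancel hj]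
  have h1 : p / 2 ^ j + 1 ≤ 2 ^ (L - j) := by
    rw [Nat.succ_le_iff, Nat.div_lt_iff_lt_mul (by positivity), ← h2]; exact hp
  calc p / 2 ^ j * 2 ^ j + c < (p / 2 ^ j + 1) * 2 ^ j := by rw [add_mul, one_mul]; omega
    _ ≤ 2 ^ (L - j) * 2 ^ j := by gcongr
    _ = 2 ^ L := h2.symm

/-- The index with the remainder `c` in the block of size `2^j` that contains `p`. -/
def blockIdx (L j : ℕ) (p : Fin (2 ^ L)) (c : Fin (2 ^ j)) : Fin (2 ^ L) :=
  ⟨((p : ℕ) / 2 ^ j * 2 ^ j + c) % 2 ^ L, Nat.mod_lt _ (by positivity)⟩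

/-- For `j ≤ L` the block does not leave the index range, so the reduction modulo `2^L`, which only
makes `blockIdx` total, has no effect. -/
theorem blockIdx_val {L j : ℕ} (hj : j ≤ L) (p : Fin (2 ^ L)) (c : Fin (2 ^ j)) :
    (blockIdx L j p c : ℕ) = (p : ℕ) / 2 ^ j * 2 ^ j + c :=
  Nat.mod_eq_of_lt (block_lt hj p.2 c.2)

theorem blockIdx_div {L j : ℕ} (hj : j ≤ L) (p : Fin (2 ^ L)) (c : Fin (2 ^ j)) :
    (blockIdx L j p c : ℕ) / 2 ^ j = (p : ℕ) / 2 ^ j := by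
  rw [blockIdx_val hj, Nat.add_comm, Nat.add_mul_div_right _ _ (by positivity),
    Nat.div_eq_of_lt c.2, zero_add]

theorem low_blockIdx {L j : ℕ} (hj : j ≤ L) (p : Fin (2 ^ L)) (c : Fin (2 ^ j)) :
    low j (blockIdx L j p c) = c := by
  apply Fin.ext
  rw [low, blockIdx_val hj]
  simp [Nat.add_mod, Nat.mod_eq_of_lt c.2]

theorem blockIdx_blockIdx {L j : ℕ} (hj : j ≤ L) (p : Fin (2 ^ L)) (c d : Fin (2 ^ j)) :
    blockIdx L j (blockIdx L j p c) d = blockIdx L j p d := by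
  apply Fin.ext
  rw [blockIdx_val hj, blockIdx_div hj, blockIdx_val hj]

theorem sum_block {L j : ℕ} (hj : j ≤ L) (p : Fin (2 ^ L)) (f : Fin (2 ^ L) → ℂ) :
    (∑ q : Fin (2 ^ L), if (q : ℕ) / 2 ^ j = (p : ℕ) / 2 ^ j then f q else 0) =
      ∑ c : Fin (2 ^ j), f (blockIdx L j p c) := by
  rw [← Finset.sum_filter]
  symm
  refine Finset.sum_bij (fun c _ => blockIdx L j p c) ?_ ?_ ?_ (fun _ _ => rfl)
  · intro c _
    simp [blockIdx_div hj]
  · intro c _ d _ h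
    rw [← low_blockIdx hj p c, h, low_blockIdx hj]
  · intro q hq
    simp only [Finset.mem_filter, Finset.mem_univ, true_and] at hq
    refine ⟨low j q, Finset.mem_univ _, Fin.ext ?_⟩
    rw [blockIdx_val hj, ← hq, low, mul_comm]
    exact Nat.div_add_mod _ _

/-- Action of the blocks `U m` on level `j`. -/
def blockApply {L : ℕ} (j : ℕ) (U : ℕ → Matrix (Fin (2 ^ j)) (Fin (2 ^ j)) ℂ)
    (ψ : Fin (2 ^ L) → ℂ) (p : Fin (2 ^ L)) : ℂ :=
  ∑ c : Fin (2 ^ j), U ((p : ℕ) / 2 ^ j) (low j p) c * ψ (blockIdx L j p c)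

theorem blockApply_eq_sum {L j : ℕ} (hj : j ≤ L) (U : ℕ → Matrix (Fin (2 ^ j)) (Fin (2 ^ j)) ℂ)
    (ψ : Fin (2 ^ L) → ℂ) (p : Fin (2 ^ L)) :
    blockApply j U ψ p = ∑ q : Fin (2 ^ L), if (q : ℕ) / 2 ^ j = (p : ℕ) / 2 ^ j then
      U ((p : ℕ) / 2 ^ j) (low j p) (low j q) * ψ q else 0 := by
  rw [sum_block hj p (fun q => U ((p : ℕ) / 2 ^ j) (low j p) (low j q) * ψ q)]
  simp only [low_blockIdx hj]
  rfl

theorem matrix_eq_of_mulVec {n : Type} [Fintype n] [DecidableEq n] {A B : Matrix n n ℂ}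
    (h : ∀ v, A *ᵥ v = B *ᵥ v) : A = B := by
  ext i j
  have := congrFun (h (Pi.single j 1)) i
  simpa using this

section Tree
variable {T : PacketTree} {L : ℕ}

/-- The matrix tests the column index, the formula tests the row index. The two tests agree, as all
indices in a block of size `2^j` around an index of level `j` have level `j`. -/
theorem levelControlled_mulVec (hL : 1 ≤ L) (hT : T.Admissible L) {j : ℕ} (hj : j ≤ L)
    (U : ℕ → Matrix (Fin (2 ^ j)) (Fin (2 ^ j)) ℂ) (ψ : Fin (2 ^ L) → ℂ) (p : Fin (2 ^ L)) :
    (levelControlled T L j U *ᵥ ψ) p =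
      if T.level L p = j then blockApply j U ψ p else ψ p := by
  have hq : ∀ q : Fin (2 ^ L), (j, (q : ℕ) / 2 ^ j) ∈ T.leaves L ↔ T.level L q = j :=
    fun q => PacketTree.mem_leaves_iff hL hT q.2
  simp only [Matrix.mulVec, dotProduct, levelControlled, Matrix.of_apply, hq]
  split_ifs with h
  · rw [blockApply_eq_sum hj]
    refine Finset.sum_congr rfl fun q _ => ?_
    by_cases e : (q : ℕ) / 2 ^ j = (p : ℕ) / 2 ^ j
    · have hl : T.level L q = j := by
        rw [PacketTree.level_congr hL hT p.2 h.ge e.symm, h]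
      rw [if_pos e, if_pos hl, if_pos e.symm, e]
    · rw [if_neg e]
      split_ifs with h1 h2 h3
      · exact absurd h2.symm e
      · simp
      · exact absurd (by rw [h3]) e
      · simp
  · rw [Finset.sum_eq_single p]
    · simp [h]
    · intro q _ hne
      split_ifs with h1 h2 h3
      · exact absurd (by rw [PacketTree.level_congr hL hT q.2 h1.ge h2.symm, h1]) h
      · simp
      · exact absurd h3.symm hne
      · simp
    · simp

theorem list_sum_map_eq_single {α : Type} (l : List α) (hl : l.Nodup) (f : α → ℂ) (a : α)
    (ha : a ∈ l) (h : ∀ b ∈ l, b ≠ a → f b = 0) : (l.map f).sum = f a := by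
  classical
  rw [← List.sum_toFinset f hl]
  exact Finset.sum_eq_single a (fun b hb hne => h b (List.mem_toFinset.1 hb) hne)
    (fun h => absurd (List.mem_toFinset.2 ha) h)

theorem leavesFrom_nodup : ∀ (T : PacketTree) (j m : ℕ), 1 ≤ j → T.Admissible j →
    (T.leavesFrom j m).Nodup
  | .leaf, j, m, _, _ => by simp [PacketTree.leavesFrom]
  | .node l r, j, m, hj, ⟨h2, hl, hr⟩ => by
      rw [PacketTree.leavesFrom, List.nodup_append]
      refine ⟨leavesFrom_nodup l _ _ (by omega) hl, leavesFrom_nodup r _ _ (by omega) hr, ?_⟩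
      rintro w hw w' hw' rfl
      have h1 := (PacketTree.leavesFrom_bounds l _ _ (by omega) hl w hw).2.2
      have h2 := (PacketTree.leavesFrom_bounds r _ _ (by omega) hr w hw').2.2
      omega

theorem leaves_nodup (hL : 1 ≤ L) (hT : T.Admissible L) : (T.leaves L).Nodup :=
  leavesFrom_nodup T L 0 hL hT

theorem blockSum_mulVec (hL : 1 ≤ L) (hT : T.Admissible L)
    (B : (j m : ℕ) → Matrix (Fin (2 ^ j)) (Fin (2 ^ j)) ℂ) (ψ : Fin (2 ^ L) → ℂ)
    (p : Fin (2 ^ L)) :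
    (blockSum T L B *ᵥ ψ) p = blockApply (T.level L p) (B (T.level L p)) ψ p := by
  rw [blockApply_eq_sum (PacketTree.level_le T L p)]
  simp only [Matrix.mulVec, dotProduct, blockSum, Matrix.of_apply]
  refine Finset.sum_congr rfl fun q _ => ?_
  rw [list_sum_map_eq_single _ (leaves_nodup hL hT) _ _
    (PacketTree.level_mem hT p.2)]
  · simp only [true_and]
    split_ifs <;> simp
  · rintro ⟨j, m⟩ hw hne
    rw [if_neg]
    rintro ⟨h1, -⟩
    have := PacketTree.level_unique hL hT hw h1
    simp only at this h1
    subst this; subst h1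
    exact hne rfl

theorem blockApply_mul {j : ℕ} (hj : j ≤ L) (A B : ℕ → Matrix (Fin (2 ^ j)) (Fin (2 ^ j)) ℂ)
    (ψ : Fin (2 ^ L) → ℂ) (p : Fin (2 ^ L)) :
    blockApply j (fun m => A m * B m) ψ p = blockApply j A (blockApply j B ψ) p := by
  simp only [blockApply, low_blockIdx hj, blockIdx_div hj, blockIdx_blockIdx hj,
    Matrix.mul_apply, Finset.sum_mul, Finset.mul_sum]
  rw [Finset.sum_comm]
  simp only [mul_assoc]

theorem blockApply_congr {j : ℕ} (U : ℕ → Matrix (Fin (2 ^ j)) (Fin (2 ^ j)) ℂ)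
    {ψ φ : Fin (2 ^ L) → ℂ} {p : Fin (2 ^ L)}
    (h : ∀ c, ψ (blockIdx L j p c) = φ (blockIdx L j p c)) :
    blockApply j U ψ p = blockApply j U φ p := by
  simp only [blockApply, h]

theorem blockSum_mul (hL : 1 ≤ L) (hT : T.Admissible L)
    (A B : (j m : ℕ) → Matrix (Fin (2 ^ j)) (Fin (2 ^ j)) ℂ) :
    blockSum T L A * blockSum T L B = blockSum T L fun j m => A j m * B j m := by
  refine matrix_eq_of_mulVec fun ψ => funext fun p => ?_
  have hle := PacketTree.level_le T L p
  rw [← Matrix.mulVec_mulVec, blockSum_mulVec hL hT, blockSum_mulVec hL hT, blockApply_mul hle]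
  refine blockApply_congr _ fun c => ?_
  rw [blockSum_mulVec hL hT,
    PacketTree.level_congr hL hT p.2 le_rfl (blockIdx_div hle p c).symm]

/-- Operators for different levels act on disjoint unions of blocks, so at most one factor is
nontrivial at `p`. -/
theorem prod_levelControlled_mulVec (hL : 1 ≤ L) (hT : T.Admissible L)
    (B : (j m : ℕ) → Matrix (Fin (2 ^ j)) (Fin (2 ^ j)) ℂ) (J : ℕ) (hJ : J ≤ L)
    (ψ : Fin (2 ^ L) → ℂ) (p : Fin (2 ^ L)) :
    (((List.range' 1 J).map fun j => levelControlled T L j (B j)).prod *ᵥ ψ) p =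
      if T.level L p ≤ J then blockApply (T.level L p) (B (T.level L p)) ψ p else ψ p := by
  induction J generalizing ψ with
  | zero =>
      -- No index is on level `0`, so the empty product agrees with the second branch.
      have := PacketTree.level_pos hL hT p.2
      rw [if_neg (by omega)]
      simp
  | succ J ih =>
      rw [List.range'_concat, List.map_append, List.prod_append, ← Matrix.mulVec_mulVec,
        ih (by omega)]
      simp only [List.map_cons, List.map_nil, List.prod_singleton, one_mul]
      have hle := PacketTree.level_le T L p
      split_ifs with h1 h2 h2
      · refine blockApply_congr _ fun c => ?_
        rw [levelControlled_mulVec hL hT (by omega), if_neg]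
        rw [PacketTree.level_congr hL hT p.2 le_rfl (blockIdx_div hle p c).symm]
        omega
      · omega
      · have e : T.level L p = 1 + J := by omega
        rw [levelControlled_mulVec hL hT (by omega), if_pos e, e]
      · rw [levelControlled_mulVec hL hT (by omega), if_neg (by omega)]

theorem prod_levelControlled (hL : 1 ≤ L) (hT : T.Admissible L)
    (B : (j m : ℕ) → Matrix (Fin (2 ^ j)) (Fin (2 ^ j)) ℂ) :
    ((List.range' 1 L).map fun j => levelControlled T L j (B j)).prod = blockSum T L B := by
  refine matrix_eq_of_mulVec fun ψ => funext fun p => ?_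
  rw [prod_levelControlled_mulVec hL hT B L le_rfl, blockSum_mulVec hL hT,
    if_pos (PacketTree.level_le T L p)]

theorem controlledQFTs_eq (hL : 1 ≤ L) (hT : T.Admissible L) :
    controlledQFTs T L = blockSum T L fun j _ => qft (2 ^ j) :=
  prod_levelControlled hL hT fun j _ => qft (2 ^ j)

theorem controlledDecodings_eq (hL : 1 ≤ L) (hT : T.Admissible L) :
    controlledDecodings T L = blockSum T L fun j m => retDecodeMatrix j m :=
  prod_levelControlled hL hT fun j m => retDecodeMatrix j m

end Tree

/-! ### Entries of the Shannon matrix. -/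

theorem retDecode_cast (c j m : ℕ) :
    ∃ k : ℤ, (decode (m * 2 ^ j + c) : ℤ) = retDecode c j m + 2 ^ j * k := by
  refine ⟨decode (m * 2 ^ j + c) / 2 ^ j, ?_⟩
  rw [retDecode, Int.toNat_of_nonneg (Int.emod_nonneg _ (by positivity))]
  exact (Int.emod_add_mul_ediv _ _).symm

theorem retDecode_lt (c j m : ℕ) : retDecode c j m < 2 ^ j := by
  have := Int.emod_lt_of_pos (decode (m * 2 ^ j + c)) (show (0 : ℤ) < 2 ^ j by positivity)
  have h0 := Int.emod_nonneg (decode (m * 2 ^ j + c)) (show (2 : ℤ) ^ j ≠ 0 by positivity)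
  unfold retDecode
  zify
  rw [Int.toNat_of_nonneg h0]; exact this

/-- Even indices decode to the nonnegative window and odd indices to the negative one, each window
being half as long as the block. -/
theorem shannonBase_decode (j m i : ℕ) (hj : 1 ≤ j) :
    shannonBase m ((decode i : ℝ) / 2 ^ j) = if i / 2 ^ j = m then 1 else 0 := by
  have hpos : (0 : ℝ) < 2 ^ j := by positivity
  have hdiv : i / 2 ^ j = m ↔ m * 2 ^ j ≤ i ∧ i < (m + 1) * 2 ^ j := by
    rw [Nat.div_eq_iff (by positivity), Nat.le_sub_one_iff_lt (by positivity), add_mul, one_mul]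
  -- Half the block size is an integer because `j ≥ 1`, so the window boundaries `m e` are integers.
  obtain ⟨e, he⟩ : ∃ e, 2 ^ j = 2 * e := ⟨2 ^ (j - 1), by rw [← pow_succ']; congr 1; omega⟩
  have he' : (2 : ℝ) ^ j = 2 * e := by exact_mod_cast he
  simp only [shannonBase, Set.indicator_apply, Set.mem_ofPred_eq, Set.mem_union, Set.mem_Ico,
    Pi.one_apply, hdiv]
  congr 1
  rw [mul_div_assoc', le_div_iff₀ hpos, div_lt_iff₀ hpos, le_div_iff₀ hpos, div_lt_iff₀ hpos]
  rcases Nat.even_or_odd' i with ⟨k, rfl | rfl⟩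
  · have : (decode (2 * k) : ℝ) = k := by simp [decode]
    rw [this, he', he]
    have hm : (0 : ℝ) ≤ m * (2 * e) := by positivity
    have h0 : (0 : ℝ) ≤ k := by positivity
    rw [eq_iff_iff]
    constructor
    · rintro (⟨h1, h2⟩ | ⟨h1, h2⟩)
      · nlinarith
      · exact ⟨by exact_mod_cast (by linarith : (m : ℝ) * (2 * e) ≤ 2 * k),
          by exact_mod_cast (by linarith : (2 : ℝ) * k < (m + 1) * (2 * e))⟩
    · rintro ⟨h1, h2⟩
      exact Or.inr ⟨by exact_mod_cast h1, by exact_mod_cast h2⟩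
  -- The negative window is closed on the left and open on the right, which gives `m e < k + 1 ≤ (m
  -- + 1) e`. For integers this is the same as `2 m e ≤ 2 k + 1 < 2 (m + 1) e`.
  · have : (decode (2 * k + 1) : ℝ) = -(k + 1) := by
      simp [decode]
      have : ((2 : ℤ) * k + 1 + 1) / 2 = k + 1 := by omega
      rw [this]; push_cast; ring
    rw [this, he', he]
    have hm : (0 : ℝ) ≤ m * (2 * e) := by positivity
    have h0 : (0 : ℝ) ≤ k := by positivity
    rw [eq_iff_iff]
    constructor
    · rintro (⟨h1, h2⟩ | ⟨h1, h2⟩)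
      · have a1 : k + 1 ≤ (m + 1) * e := by
          have : (k : ℝ) + 1 ≤ (m + 1) * e := by linarith
          exact_mod_cast this
        have a2 : m * e < k + 1 := by
          have : (m : ℝ) * e < k + 1 := by linarith
          exact_mod_cast this
        constructor <;> nlinarith
      · nlinarith
    · rintro ⟨h1, h2⟩
      have a1 : k + 1 ≤ (m + 1) * e := by
        have : 2 * k + 1 < 2 * ((m + 1) * e) := by linarith
        omega
      have a2 : m * e < k + 1 := by
        have : 2 * (m * e) ≤ 2 * k + 1 := by linarith
        omega
      have b1 : (k : ℝ) + 1 ≤ (m + 1) * e := by exact_mod_cast a1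
      have b2 : (m : ℝ) * e < k + 1 := by exact_mod_cast a2
      left; constructor <;> linarith

theorem exp_eq_of_int {a b : ℂ} (k : ℤ) (h : a = b + k) :
    Complex.exp (2 * Real.pi * Complex.I * a) = Complex.exp (2 * Real.pi * Complex.I * b) := by
  rw [h, Complex.exp_eq_exp_iff_exists_int]
  exact ⟨k, by ring⟩

/-- Replacing `d(i)` by its remainder modulo `2^j` changes the argument `n d(i) / 2^j` by an
integer, so the exponential is an entry of the Fourier matrix; the permutation matrix selects its
column. -/
theorem star_shannonHat (j m n i : ℕ) (hj : 1 ≤ j) (hn : n < 2 ^ j) :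
    star (shannonHat j m n (decode i : ℝ)) =
      if i / 2 ^ j = m then (qft (2 ^ j) * retDecodeMatrix j m) ⟨n, hn⟩ (low j i) else 0 := by
  unfold shannonHat
  rw [shannonBase_decode j m i hj]
  split_ifs with h
  · have hi : m * 2 ^ j + (low j i : ℕ) = i := by
      rw [← h, low, mul_comm]; exact Nat.div_add_mod _ _
    obtain ⟨k, hk⟩ := retDecode_cast (low j i) j m
    rw [hi] at hk
    have hk' : (decode i : ℂ) = retDecode (low j i) j m + 2 ^ j * k := by exact_mod_cast hk
    rw [Matrix.mul_apply, Finset.sum_eq_single ⟨retDecode (low j i) j m, retDecode_lt _ _ _⟩]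
    · simp only [retDecodeMatrix, qft, Matrix.of_apply, if_true, mul_one]
      rw [star_mul', mul_comm]
      congr 1
      · simp
      · rw [Complex.star_def, ← Complex.exp_conj]
        simp only [map_neg, map_mul, map_div₀, map_pow, Complex.conj_I, Complex.conj_ofReal,
          Complex.conj_natCast, map_ofNat, Complex.ofReal_intCast, map_intCast]
        have := exp_eq_of_int (a := n / 2 ^ j * decode i)
          (b := n * retDecode (low j i) j m / 2 ^ j) (n * k)
          (by rw [hk']; push_cast; field_simp)
        convert this using 2
        · ring
        · push_cast; ring
    · intro b _ hb
      simp only [retDecodeMatrix, Matrix.of_apply]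
      rw [if_neg, mul_zero]
      intro h; exact hb (Fin.ext h)
    · simp
  · simp

theorem shannonMatrix_eq {T : PacketTree} {L : ℕ} (hL : 1 ≤ L) (hT : T.Admissible L) :
    shannonMatrix T L = blockSum T L fun j m => qft (2 ^ j) * retDecodeMatrix j m := by
  ext p i
  simp only [shannonMatrix, blockSum, Matrix.of_apply]
  congr 1
  refine List.map_congr_left fun w hw => ?_
  have hw1 := (PacketTree.leavesFrom_bounds T L 0 hL hT w hw).1
  have hpos : 0 < 2 ^ w.1 := by positivity
  have hiff : (w.2 * 2 ^ w.1 ≤ (p : ℕ) ∧ (p : ℕ) < (w.2 + 1) * 2 ^ w.1) ↔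
      (p : ℕ) / 2 ^ w.1 = w.2 := by
    rw [Nat.div_eq_iff hpos, Nat.le_sub_one_iff_lt (by positivity), add_mul, one_mul]
  simp only [hiff]
  by_cases h : (p : ℕ) / 2 ^ w.1 = w.2
  · have hn : (p : ℕ) - w.2 * 2 ^ w.1 = (p : ℕ) % 2 ^ w.1 := by
      rw [← h, Nat.mod_eq_sub, mul_comm]
    rw [if_pos h, hn, star_shannonHat _ _ _ _ hw1 (Nat.mod_lt _ hpos)]
    simp only [h, true_and]
    rfl
  · simp [h]

theorem shannonMatrix_eq_mul {T : PacketTree} {L : ℕ} (hL : 1 ≤ L) (hT : T.Admissible L) :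
    shannonMatrix T L = controlledQFTs T L * controlledDecodings T L := by
  rw [shannonMatrix_eq hL hT, controlledQFTs_eq hL hT, controlledDecodings_eq hL hT,
    blockSum_mul hL hT]

/-! ### Circuits on qubits labelled by natural numbers -/

theorem runCircuit_cons {ι : Type} [DecidableEq ι] (g : Gate ι) (c : List (Gate ι))
    (Ψ : (ι → Fin 2) → ℂ) : runCircuit (g :: c) Ψ = runCircuit c (g.apply Ψ) := rfl

theorem runCircuit_nil {ι : Type} [DecidableEq ι] (Ψ : (ι → Fin 2) → ℂ) :
    runCircuit [] Ψ = Ψ := rfl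

theorem runCircuit_append {ι : Type} [DecidableEq ι] (c d : List (Gate ι))
    (Ψ : (ι → Fin 2) → ℂ) : runCircuit (c ++ d) Ψ = runCircuit d (runCircuit c Ψ) :=
  List.foldl_append

theorem fin_two_cases (x : Fin 2) : x = 0 ∨ x = 1 := by
  revert x; decide

/-- Phase shift `P_k` or its inverse. -/
def phaseGate : Bool → ℕ → Gate1
  | true, k => .P k
  | false, k => .Pinv k

/-- `exp (2 π i θ)` or its inverse. -/
noncomputable def expi (s : Bool) (θ : ℂ) : ℂ :=
  Complex.exp (2 * Real.pi * Complex.I * (if s then θ else -θ))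

theorem expi_add (s : Bool) (a b : ℂ) : expi s (a + b) = expi s a * expi s b := by
  unfold expi
  rw [← Complex.exp_add]
  congr 1
  split_ifs <;> ring

theorem expi_natCast (s : Bool) (n : ℕ) : expi s n = 1 := by
  unfold expi
  have := exp_eq_of_int (a := if s then (n : ℂ) else -n) (b := 0) (if s then n else -n)
    (by cases s <;> simp)
  rw [this]; simp

theorem expi_zero (s : Bool) : expi s 0 = 1 := by simpa using expi_natCast s 0

theorem expi_half (s : Bool) : expi s (1 / 2) = -1 := by
  unfold expi
  cases s
  · have : 2 * (Real.pi : ℂ) * Complex.I * (if false = true then 1 / 2 else -(1 / 2)) =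
        -(Real.pi * Complex.I) := by simp; ring
    rw [this, Complex.exp_neg, Complex.exp_pi_mul_I]; norm_num
  · have : 2 * (Real.pi : ℂ) * Complex.I * (if true = true then 1 / 2 else -(1 / 2)) =
        Real.pi * Complex.I := by simp; ring
    rw [this, Complex.exp_pi_mul_I]

theorem expi_mul_not (s : Bool) (a : ℂ) : expi s a * expi (!s) a = 1 := by
  unfold expi
  rw [← Complex.exp_add]
  cases s <;> simp

theorem expi_double (s : Bool) (k : ℕ) :
    expi s (1 / 2 ^ (k + 1)) * expi s (1 / 2 ^ (k + 1)) = expi s (1 / 2 ^ k) := by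
  rw [← expi_add]
  congr 1
  rw [pow_succ]; field_simp; norm_num

theorem phaseGate_matrix (s : Bool) (k : ℕ) :
    (phaseGate s k).matrix = !![1, 0; 0, expi s (1 / 2 ^ k)] := by
  cases s
  · simp only [phaseGate, Gate1.matrix, expi]
    congr 5
    simp; ring_nf
  · simp only [phaseGate, Gate1.matrix, expi]
    congr 5
    simp; ring_nf

/-- Controlled negation of qubit `b`. -/
def cx (a b : ℕ) : Gate ℕ := .ctrl .X a b

/-- Phase shift with the parameter `k - 1` on three qubits. -/
def ccphase (s : Bool) (k a b t : ℕ) : List (Gate ℕ) :=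
  [.ctrl (phaseGate s k) b t, cx a b, .ctrl (phaseGate (!s) k) b t, cx a b,
    .ctrl (phaseGate s k) a t]

/-- Negation of qubit `t` with the two controls `a` and `b`, if `k = 2`. -/
def ccx (k a b t : ℕ) : List (Gate ℕ) :=
  .single .H t :: (ccphase true k a b t ++ [.single .H t])

/-- Controlled exchange of the qubits `a` and `b`, if `k = 2`. -/
def cswap (k e a b : ℕ) : List (Gate ℕ) := cx b a :: (ccx k e a b ++ [cx b a])

theorem update_eq_of_eq {y : ℕ → Fin 2} {b : ℕ} {v : Fin 2} (h : y b = v) :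
    Function.update y b v = y := by rw [← h, Function.update_eq_self]

theorem x_apply (b : ℕ) (Ψ : (ℕ → Fin 2) → ℂ) :
    (Gate.single .X b).apply Ψ = fun y => Ψ (Function.update y b (y b + 1)) := by
  funext y
  simp only [Gate.apply, applyAt, Gate1.matrix, Fin.sum_univ_two]
  rcases fin_two_cases (y b) with h | h <;> simp [h]

theorem cx_apply (a b : ℕ) (Ψ : (ℕ → Fin 2) → ℂ) :
    (cx a b).apply Ψ = fun y => Ψ (Function.update y b (y b + y a)) := by
  funext y
  simp only [cx, Gate.apply, applyAt, Gate1.matrix, Fin.sum_univ_two]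
  rcases fin_two_cases (y a) with h | h <;> rcases fin_two_cases (y b) with h' | h' <;>
    simp [h, h', update_eq_of_eq h']

theorem cphase_apply (s : Bool) (k a b : ℕ) (Ψ : (ℕ → Fin 2) → ℂ) :
    (Gate.ctrl (phaseGate s k) a b).apply Ψ =
      fun y => (if y a = 1 ∧ y b = 1 then expi s (1 / 2 ^ k) else 1) * Ψ y := by
  funext y
  simp only [Gate.apply, applyAt, phaseGate_matrix, Fin.sum_univ_two]
  rcases fin_two_cases (y a) with h | h
  · simp [h]
  · rcases fin_two_cases (y b) with h' | h'
    · have : Function.update y b 0 = y := by rw [← h', Function.update_eq_self]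
      simp [h, h', this]
    · have : Function.update y b 1 = y := by rw [← h', Function.update_eq_self]
      simp [h, h', this]

/-- With phase angle `θ` the five gates contribute `θ (b - (a ⊕ b) + a) = 2 θ a b` to the target.
The angle doubles, so the parameter drops from `k + 1` to `k`. -/
theorem ccphase_run (s : Bool) {k a b t : ℕ} (hab : a ≠ b) (hbt : b ≠ t)
    (Ψ : (ℕ → Fin 2) → ℂ) :
    runCircuit (ccphase s (k + 1) a b t) Ψ =
      fun y => (if y a = 1 ∧ y b = 1 ∧ y t = 1 then expi s (1 / 2 ^ k) else 1) * Ψ y := by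
  funext y
  simp only [ccphase, runCircuit_cons, runCircuit_nil, cx_apply, cphase_apply]
  have h2 := expi_mul_not s (1 / 2 ^ (k + 1))
  have h3 := expi_double s k
  simp only [one_div] at h2 h3
  have hc : Function.update (Function.update y b (y b + y a)) b (y b + y a + y a) = y := by
    have : y b + y a + y a = y b := by
      rcases fin_two_cases (y a) with h | h <;> rcases fin_two_cases (y b) with h' | h' <;>
        simp [h, h']
    rw [this]; simp
  simp only [Function.update_self, Function.update_of_ne hab, Function.update_of_ne hbt.symm, hc]
  rcases fin_two_cases (y a) with h | h <;> rcases fin_two_cases (y b) with h' | h' <;>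
    rcases fin_two_cases (y t) with h'' | h'' <;> simp [h, h', h'']
  · linear_combination Ψ y * h2
  · linear_combination Ψ y * h2
  · linear_combination Ψ y * h3

theorem h_apply (t : ℕ) (Ψ : (ℕ → Fin 2) → ℂ) (y : ℕ → Fin 2) :
    (Gate.single .H t).apply Ψ y = (((√2)⁻¹ : ℝ) : ℂ) * ((Ψ (Function.update y t 0)) +
      (if y t = 1 then -1 else 1) * Ψ (Function.update y t 1)) := by
  simp only [Gate.apply, applyAt, Gate1.matrix, Fin.sum_univ_two]
  rcases fin_two_cases (y t) with h | h <;> simp [h] <;> ring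

theorem inv_sqrt_two_mul_self : (√2 : ℂ)⁻¹ * (√2 : ℂ)⁻¹ = 1 / 2 := by
  rw [← mul_inv, ← Complex.ofReal_mul, Real.mul_self_sqrt (by norm_num)]
  norm_num

/-- For parameter `2` the phase on three qubits is `-1`, a doubly controlled `Z`, which the Hadamard
gates conjugate into a doubly controlled `X`. -/
theorem ccx_run {a b t : ℕ} (hab : a ≠ b) (hat : a ≠ t) (hbt : b ≠ t)
    (Ψ : (ℕ → Fin 2) → ℂ) :
    runCircuit (ccx 2 a b t) Ψ = fun y => Ψ (Function.update y t (y t + y a * y b)) := by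
  funext y
  have h2 := inv_sqrt_two_mul_self
  simp only [ccx, runCircuit_cons, runCircuit_append, runCircuit_nil,
    ccphase_run true hab hbt (k := 1), h_apply]
  simp only [Function.update_self, Function.update_of_ne hat, Function.update_of_ne hbt,
    Function.update_idem, pow_one, expi_half]
  rcases fin_two_cases (y t) with h | h <;> rcases fin_two_cases (y a) with h' | h' <;>
    rcases fin_two_cases (y b) with h'' | h'' <;> simp [h, h', h'', update_eq_of_eq h]
  all_goals first
    | linear_combination 2 * Ψ y * h2
    | linear_combination 2 * Ψ (Function.update y t 1) * h2
    | linear_combination 2 * Ψ (Function.update y t 0) * h2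

/-- The circuit `c` permutes the basis states, `f` being the inverse permutation. -/
def Pulls (c : List (Gate ℕ)) (f : (ℕ → Fin 2) → (ℕ → Fin 2)) : Prop :=
  ∀ Ψ, runCircuit c Ψ = fun y => Ψ (f y)

/-- Inverse permutations compose in reverse order: the one of the circuit that runs last is applied
to `y` first. -/
theorem Pulls.append {c d : List (Gate ℕ)} {f g : (ℕ → Fin 2) → (ℕ → Fin 2)}
    (hc : Pulls c f) (hd : Pulls d g) : Pulls (c ++ d) (fun y => f (g y)) := by
  intro Ψ
  rw [runCircuit_append, hc, hd]

theorem Pulls.nil : Pulls [] id := fun _ => rfl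

theorem Pulls.congr {c : List (Gate ℕ)} {f g : (ℕ → Fin 2) → (ℕ → Fin 2)}
    (hc : Pulls c f) (h : ∀ y, f y = g y) : Pulls c g := by
  rwa [← funext h]

theorem pulls_cx (a b : ℕ) : Pulls [cx a b] fun y => Function.update y b (y b + y a) := by
  intro Ψ
  rw [runCircuit_cons, cx_apply, runCircuit_nil]

theorem pulls_x (b : ℕ) :
    Pulls [.single .X b] fun y => Function.update y b (y b + 1) := by
  intro Ψ
  rw [runCircuit_cons, x_apply, runCircuit_nil]

theorem pulls_ccx {a b t : ℕ} (hab : a ≠ b) (hat : a ≠ t) (hbt : b ≠ t) :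
    Pulls (ccx 2 a b t) fun y => Function.update y t (y t + y a * y b) :=
  ccx_run hab hat hbt

/-- A swap is three controlled negations. Only the middle one needs the extra control, since the
outer two cancel without it. -/
theorem pulls_cswap {e a b : ℕ} (hab : a ≠ b) (hea : e ≠ a) (heb : e ≠ b) :
    Pulls (cswap 2 e a b) fun y => if y e = 1 then y ∘ Equiv.swap a b else y := by
  refine (((pulls_cx b a).append ((pulls_ccx hea heb hab).append (pulls_cx b a)))).congr
    fun y => ?_
  funext i
  simp only [Function.update_apply, hab, hea, hab.symm, if_true, if_false]
  by_cases hi : i = a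
  · subst hi
    rcases fin_two_cases (y e) with h | h <;> rcases fin_two_cases (y i) with h' | h' <;>
      rcases fin_two_cases (y b) with h'' | h'' <;> simp [h, h', h'']
  · by_cases hi' : i = b
    · subst hi'
      rcases fin_two_cases (y e) with h | h <;> rcases fin_two_cases (y i) with h' | h' <;>
        rcases fin_two_cases (y a) with h'' | h'' <;> simp [h, h', h'', hab.symm]
    · simp only [hi, hi', if_false]
      split_ifs
      · simp [Equiv.swap_apply_of_ne_of_ne hi hi']
      · rfl

/-- Reversal of the order of the `n` lowest qubits, controlled on qubit `e`. -/
def crev (k e n : ℕ) : List (Gate ℕ) :=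
  (List.range (n / 2)).flatMap fun i => cswap k e i (n - 1 - i)

/-- Reversal of the `n` lowest bits. -/
def revBits (n : ℕ) (y : ℕ → Fin 2) : ℕ → Fin 2 := fun i => if i < n then y (n - 1 - i) else y i

theorem flatMap_range_succ {α : Type} (f : ℕ → List α) (n : ℕ) :
    (List.range (n + 1)).flatMap f = (List.range n).flatMap f ++ f n := by
  simp [List.range_succ, List.flatMap_append]

theorem pulls_crev {e n : ℕ} (he : n ≤ e) :
    Pulls (crev 2 e n) fun y => if y e = 1 then revBits n y else y := by
  -- After `r` exchanges the positions below `r` have changed places with their mirror images. For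
  -- odd `n` the middle position is its own mirror image.
  have key : ∀ r, r ≤ n / 2 → Pulls ((List.range r).flatMap fun i => cswap 2 e i (n - 1 - i))
      fun y => if y e = 1 then
        fun i => if i < n ∧ (i < r ∨ n - 1 - i < r) then y (n - 1 - i) else y i else y := by
    intro r
    induction r with
    | zero => intro _; exact Pulls.nil.congr fun y => by simp
    | succ r ih =>
        intro hr
        rw [flatMap_range_succ]
        refine ((ih (by omega)).append
          (pulls_cswap (by omega) (by omega) (by omega))).congr fun y => ?_
        by_cases h : y e = 1
        · have h1 : (y ∘ Equiv.swap r (n - 1 - r)) e = 1 := by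
            simp [Equiv.swap_apply_of_ne_of_ne (show e ≠ r by omega)
              (show e ≠ n - 1 - r by omega), h]
          simp only [h, if_true, h1]
          funext i
          simp only [Function.comp, Equiv.swap_apply_def]
          by_cases hi : i < n
          · by_cases h2 : i = r
            · subst h2
              simp [show ¬ (n - 1 - i < i) by omega, hi]
            · by_cases h3 : i = n - 1 - r
              · have h4 : n - 1 - i = r := by omega
                rw [h4, if_neg (show ¬ (i < n ∧ (i < r ∨ r < r)) by omega), if_neg h2, if_pos h3,
                  if_pos (by omega)]
              · have h5 : n - 1 - i ≠ r := by omega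
                have h6 : n - 1 - i ≠ n - 1 - r := by omega
                have h7 : (i < r + 1 ∨ n - 1 - i < r + 1) ↔ (i < r ∨ n - 1 - i < r) := by omega
                simp only [h2, h3, h5, h6, h7, if_false]
          · simp [hi, show i ≠ r by omega, show i ≠ n - 1 - r by omega]
        · simp [h]
  refine (key (n / 2) le_rfl).congr fun y => ?_
  by_cases h : y e = 1
  · simp only [h, if_true]
    funext i
    unfold revBits
    by_cases hi : i < n
    · by_cases h2 : i < n / 2 ∨ n - 1 - i < n / 2
      · simp [hi, h2]
      · simp only [hi, h2, and_false, if_false, if_true]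
        congr 1; omega
    · simp [hi]
  · simp [h]

/-- Negation of the `n` lowest qubits, controlled on the qubits `e` and `c`. -/
def fan (k e c n : ℕ) : List (Gate ℕ) := (List.range n).flatMap fun i => ccx k e c i

theorem pulls_fan {e c n : ℕ} (he : n ≤ e) (hc : n ≤ c) (hec : e ≠ c) :
    Pulls (fan 2 e c n) fun y i => if i < n then y i + y e * y c else y i := by
  unfold fan
  induction n with
  | zero => exact Pulls.nil.congr fun y => by simp
  | succ n ih =>
      rw [flatMap_range_succ]
      refine ((ih (by omega) (by omega)).append
        (pulls_ccx hec (by omega) (by omega))).congr fun y => ?_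
      funext i
      simp only [Function.update_apply, show e ≠ n by omega, show c ≠ n by omega, if_false]
      by_cases h : i = n
      · subst h; simp
      · simp [h, show i < n + 1 ↔ i < n by omega]

/-! ### Numbers and bits -/

/-- The number written in the `n` lowest bits. -/
def val : ℕ → (ℕ → Fin 2) → ℕ
  | 0, _ => 0
  | n + 1, y => val n y + y n * 2 ^ n

/-- The number written in the `n` lowest bits in reversed order. -/
def rval : ℕ → (ℕ → Fin 2) → ℕ
  | 0, _ => 0
  | n + 1, y => 2 * rval n y + y n

theorem val_eq_sum (n : ℕ) (y : ℕ → Fin 2) :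
    val n y = ∑ i ∈ Finset.range n, (y i : ℕ) * 2 ^ i := by
  induction n with
  | zero => rfl
  | succ n ih => rw [val, ih, Finset.sum_range_succ]

theorem rval_eq_sum (n : ℕ) (y : ℕ → Fin 2) :
    rval n y = ∑ i ∈ Finset.range n, (y i : ℕ) * 2 ^ (n - 1 - i) := by
  induction n with
  | zero => rfl
  | succ n ih =>
      rw [rval, ih, Finset.sum_range_succ, Finset.mul_sum]
      congr 1
      · refine Finset.sum_congr rfl fun i hi => ?_
        rw [Finset.mem_range] at hi
        rw [show n + 1 - 1 - i = n - 1 - i + 1 by omega, pow_succ]; ring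
      · simp

theorem rval_revBits (n : ℕ) (y : ℕ → Fin 2) : rval n (revBits n y) = val n y := by
  rw [rval_eq_sum, val_eq_sum, ← Finset.sum_range_reflect]
  refine Finset.sum_congr rfl fun i hi => ?_
  rw [Finset.mem_range] at hi
  rw [revBits, if_pos (by omega), show n - 1 - (n - 1 - i) = i by omega]

theorem val_lt (n : ℕ) (y : ℕ → Fin 2) : val n y < 2 ^ n := by
  induction n with
  | zero => simp [val]
  | succ n ih =>
      rw [val, pow_succ]
      have := (y n).2
      nlinarith

theorem val_congr {n : ℕ} {y z : ℕ → Fin 2} (h : ∀ i < n, y i = z i) : val n y = val n z := by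
  simp only [val_eq_sum]
  exact Finset.sum_congr rfl fun i hi => by rw [h i (Finset.mem_range.1 hi)]

theorem val_add (n k : ℕ) (y : ℕ → Fin 2) :
    val (n + k) y = val n y + 2 ^ n * val k (fun i => y (n + i)) := by
  induction k with
  | zero => simp [val]
  | succ k ih => rw [← add_assoc, val, ih, val, pow_add]; ring

theorem val_div {j n : ℕ} (h : j ≤ n) (y : ℕ → Fin 2) :
    val n y / 2 ^ j = val (n - j) fun i => y (j + i) := by
  obtain ⟨k, rfl⟩ := Nat.exists_eq_add_of_le h
  rw [val_add, Nat.add_mul_div_left _ _ (by positivity), Nat.div_eq_of_lt (val_lt _ _),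
    zero_add, Nat.add_sub_cancel_left]

theorem val_mod {j n : ℕ} (h : j ≤ n) (y : ℕ → Fin 2) : val n y % 2 ^ j = val j y := by
  obtain ⟨k, rfl⟩ := Nat.exists_eq_add_of_le h
  rw [val_add, Nat.add_mul_mod_self_left, Nat.mod_eq_of_lt (val_lt _ _)]

theorem val_div_congr {j n : ℕ} (h : j ≤ n) {y z : ℕ → Fin 2}
    (e : ∀ i, j ≤ i → i < n → y i = z i) : val n y / 2 ^ j = val n z / 2 ^ j := by
  rw [val_div h, val_div h]
  exact val_congr fun i hi => e _ (by omega) (by omega)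

/-- The `j` lowest bits of `y` replaced by those of `x`. -/
def setLow (j x : ℕ) (y : ℕ → Fin 2) : ℕ → Fin 2 :=
  fun i => if i < j then (if x.testBit i then 1 else 0) else y i

theorem setLow_succ_of_lt {j x : ℕ} (hx : x < 2 ^ j) (y : ℕ → Fin 2) :
    setLow (j + 1) x y = Function.update (setLow j x y) j 0 := by
  funext i
  by_cases h : i = j
  · subst h
    simp [setLow, Nat.testBit_lt_two_pow hx]
  · simp [setLow, h, show i < j + 1 ↔ i < j by omega]

theorem setLow_succ_add {j x : ℕ} (hx : x < 2 ^ j) (y : ℕ → Fin 2) :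
    setLow (j + 1) (2 ^ j + x) y = Function.update (setLow j x y) j 1 := by
  funext i
  by_cases h : i = j
  · subst h
    simp [setLow, Nat.testBit_two_pow_add_eq, Nat.testBit_lt_two_pow hx]
  · by_cases h' : i < j
    · simp [setLow, h, h', show i < j + 1 by omega, Nat.testBit_two_pow_add_gt h']
    · simp [setLow, h, h', show ¬ i < j + 1 by omega]

theorem val_setLow {j x : ℕ} (hx : x < 2 ^ j) (y : ℕ → Fin 2) : val j (setLow j x y) = x := by
  induction j generalizing x with
  | zero => simp [val]; omega
  | succ j ih =>
      have key : ∀ (x' : ℕ) (b : Fin 2), x' < 2 ^ j →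
          val (j + 1) (Function.update (setLow j x' y) j b) = x' + b * 2 ^ j := by
        intro x' b h
        rw [val, Function.update_self]
        congr 1
        rw [← ih h]
        refine val_congr fun i hi => ?_
        rw [Function.update_of_ne (by omega), ih h]
      rw [pow_succ] at hx
      rcases Nat.lt_or_ge x (2 ^ j) with h | h
      · rw [setLow_succ_of_lt h, key x 0 h]; simp
      · obtain ⟨x', rfl⟩ := Nat.exists_eq_add_of_le h
        rw [setLow_succ_add (by omega), key x' 1 (by omega)]; simp [add_comm]

/-! ### Fourier transform -/

/-- Stage `t` of the Fourier transform, controlled on qubit `L + t`. -/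
def stage (s : Bool) (L t : ℕ) : List (Gate ℕ) :=
  .ctrl .H (L + t) t :: (List.range t).flatMap fun i => ccphase s (3 + i) (L + t) (t - 1 - i) t

theorem ch_apply (c t : ℕ) (Ψ : (ℕ → Fin 2) → ℂ) :
    (Gate.ctrl .H c t).apply Ψ = fun y => if y c = 1 then (√2 : ℂ)⁻¹ *
      (Ψ (Function.update y t 0) + (if y t = 1 then -1 else 1) * Ψ (Function.update y t 1))
      else Ψ y := by
  funext y
  have := h_apply t Ψ y
  rw [Complex.ofReal_inv] at this
  rw [← this]
  rfl

theorem phases_run (s : Bool) {h t n : ℕ} (hn : n ≤ t) (hh : t < h) (Ψ : (ℕ → Fin 2) → ℂ) :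
    runCircuit ((List.range n).flatMap fun i => ccphase s (3 + i) h (t - 1 - i) t) Ψ =
      fun y => (if y h = 1 ∧ y t = 1 then
        expi s (∑ i ∈ Finset.range n, ((y (t - 1 - i) : ℕ) : ℂ) / 2 ^ (2 + i)) else 1) * Ψ y := by
  induction n with
  | zero =>
      funext y
      simp [expi_zero, runCircuit_nil]
  | succ n ih =>
      funext y
      rw [flatMap_range_succ, runCircuit_append, ih (by omega), show 3 + n = (2 + n) + 1 by omega,
        ccphase_run s (by omega) (by omega)]
      simp only [Finset.sum_range_succ]
      rw [← mul_assoc]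
      congr 1
      by_cases h1 : y h = 1 ∧ y t = 1
      · rcases fin_two_cases (y (t - 1 - n)) with h2 | h2
        · simp [h1, h2]
        · simp [h1, h2, expi_add, mul_comm]
      · have : ¬ (y h = 1 ∧ y (t - 1 - n) = 1 ∧ y t = 1) := fun h2 => h1 ⟨h2.1, h2.2.2⟩
        simp [h1, this]

theorem sum_phases (t : ℕ) (y : ℕ → Fin 2) :
    ∑ i ∈ Finset.range t, ((y (t - 1 - i) : ℕ) : ℂ) / 2 ^ (2 + i) =
      (val t y : ℂ) / 2 ^ (t + 1) := by
  rw [val_eq_sum, ← Finset.sum_range_reflect]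
  push_cast
  rw [Finset.sum_div]
  refine Finset.sum_congr rfl fun i hi => ?_
  rw [Finset.mem_range] at hi
  rw [show t - 1 - (t - 1 - i) = i by omega,
    div_eq_div_iff (pow_ne_zero _ two_ne_zero) (pow_ne_zero _ two_ne_zero), mul_assoc, ← pow_add,
    show i + (2 + (t - 1 - i)) = t + 1 by omega]

/-- Stage `t` of the Fourier transform, acting on functions of bit strings. -/
noncomputable def stageOp (s : Bool) (t : ℕ) (Ψ : (ℕ → Fin 2) → ℂ) (y : ℕ → Fin 2) : ℂ :=
  ∑ b : Fin 2, (√2 : ℂ)⁻¹ * expi s ((y t : ℕ) * ((b : ℕ) * 2 ^ t + val t y) / 2 ^ (t + 1)) *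
    Ψ (Function.update y t b)

theorem stage_run (s : Bool) {L t : ℕ} (ht : t < L) (Ψ : (ℕ → Fin 2) → ℂ) (y : ℕ → Fin 2) :
    runCircuit (stage s L t) Ψ y = if y (L + t) = 1 then stageOp s t Ψ y else Ψ y := by
  rw [stage, runCircuit_cons, phases_run s le_rfl (by omega), ch_apply]
  simp only [sum_phases]
  by_cases h : y (L + t) = 1
  · simp only [h, if_true, true_and, stageOp, Fin.sum_univ_two]
    rcases fin_two_cases (y t) with h' | h'
    · simp [h', expi_zero]; ring
    -- The half turn in the exponent is the sign in the Hadamard gate.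
    · have e1 : (1 : ℂ) * (1 * 2 ^ t + (val t y : ℂ)) / 2 ^ (t + 1) =
          1 / 2 + val t y / 2 ^ (t + 1) := by
        rw [pow_succ]; field_simp
      simp only [h', if_true, Fin.val_one, Nat.cast_one, Fin.val_zero, Nat.cast_zero, e1,
        expi_add, expi_half]
      rw [show (1 : ℂ) * (0 * 2 ^ t + (val t y : ℂ)) / 2 ^ (t + 1) = val t y / 2 ^ (t + 1) by ring]
      ring
  · simp [h]

/-- Stages `k - 1, …, 0` of the Fourier transform. -/
def stages (s : Bool) (L : ℕ) : ℕ → List (Gate ℕ)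
  | 0 => []
  | k + 1 => stage s L k ++ stages s L k

/-- Fourier transform of the `j` lowest bits, with the result in reversed order. -/
noncomputable def qftSum (s : Bool) (j : ℕ) (Ψ : (ℕ → Fin 2) → ℂ) (y : ℕ → Fin 2) : ℂ :=
  ((√2 : ℂ)⁻¹) ^ j * ∑ x ∈ Finset.range (2 ^ j),
    expi s ((x : ℂ) * rval j y / 2 ^ j) * Ψ (setLow j x y)

theorem setLow_apply_of_le {j i : ℕ} (h : j ≤ i) (x : ℕ) (y : ℕ → Fin 2) :
    setLow j x y i = y i := by
  rw [setLow, if_neg (by omega)]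

/-- Write the summation index as `b 2^j + x` and the output as `2 r + y_j`. The exponent is then `x
r / 2^j`, plus the exponent of stage `j`, plus the integer `b r`. -/
theorem qftSum_succ (s : Bool) (j : ℕ) (Ψ : (ℕ → Fin 2) → ℂ) (y : ℕ → Fin 2) :
    qftSum s (j + 1) Ψ y = qftSum s j (stageOp s j Ψ) y := by
  unfold qftSum stageOp
  rw [show 2 ^ (j + 1) = 2 ^ j + 2 ^ j by rw [pow_succ]; ring, Finset.sum_range_add,
    ← Finset.sum_add_distrib, pow_succ, mul_assoc]
  congr 1
  rw [Finset.mul_sum]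
  refine Finset.sum_congr rfl fun x hx => ?_
  rw [Finset.mem_range] at hx
  rw [Fin.sum_univ_two, setLow_succ_of_lt hx, setLow_succ_add hx, setLow_apply_of_le le_rfl,
    val_setLow hx]
  have e0 : expi s ((x : ℂ) * rval (j + 1) y / 2 ^ (j + 1)) = expi s ((x : ℂ) * rval j y / 2 ^ j) *
      expi s ((y j : ℕ) * (((0 : Fin 2) : ℕ) * 2 ^ j + x) / 2 ^ (j + 1)) := by
    rw [← expi_add, rval, pow_succ]
    congr 1
    push_cast
    field_simp
    simp
    ring
  -- Here `b = 1`, and the integer `b r = rval j y` is brought in as a factor `1`.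
  have e1 : expi s (((2 ^ j + x : ℕ) : ℂ) * rval (j + 1) y / 2 ^ (j + 1)) =
      expi s ((x : ℂ) * rval j y / 2 ^ j) *
      expi s ((y j : ℕ) * (((1 : Fin 2) : ℕ) * 2 ^ j + x) / 2 ^ (j + 1)) := by
    rw [← expi_add, ← one_mul (expi s (_ + _)), ← expi_natCast s (rval j y), ← expi_add, rval,
      pow_succ]
    congr 1
    push_cast
    field_simp
    simp
    ring
  rw [e0, e1]
  ring

theorem qftSum_congr (s : Bool) (j : ℕ) {Ψ Φ : (ℕ → Fin 2) → ℂ} {y : ℕ → Fin 2}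
    (h : ∀ x, Ψ (setLow j x y) = Φ (setLow j x y)) : qftSum s j Ψ y = qftSum s j Φ y := by
  simp only [qftSum, h]

/-! ### Retaining decoding of bit strings -/

theorem val_compl (n : ℕ) (y : ℕ → Fin 2) : val n (fun i => y i + 1) + val n y + 1 = 2 ^ n := by
  induction n with
  | zero => simp [val]
  | succ n ih =>
      simp only [val, pow_succ]
      rcases fin_two_cases (y n) with h | h <;> simp [h] <;> omega

/-- Retaining decoding of the `j` lowest bits; `b` is the parity of the index of the block. -/
def decBits (j : ℕ) (b : Fin 2) (y : ℕ → Fin 2) : ℕ → Fin 2 := fun i =>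
  if i + 1 < j then y (i + 1) + y 0 else if i + 1 = j then y 0 + b else y i

/-- In two's complement `-(i + 1) / 2`, for odd `i`, is the bitwise complement of `⌊i / 2⌋`. So `d`
shifts right by one place and complements if bit `0` is set; modulo `2^j` the bit shifted into the
top place is the parity of `m`. -/
theorem retDecode_val {j m : ℕ} (hj : 1 ≤ j) {b : Fin 2} (hb : m % 2 = b) (y : ℕ → Fin 2) :
    retDecode (val j y) j m = val j (decBits j b y) := by
  obtain ⟨k, rfl⟩ := Nat.exists_eq_add_of_le' hj
  set v := val k (fun i => y (i + 1)) with hv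
  have h1 : val (k + 1) y = y 0 + 2 * v := by
    rw [add_comm k 1, val_add]
    simp [val, hv, add_comm]
  have hlt := val_lt k (fun i => y (i + 1))
  rw [← hv] at hlt
  have h2 : val (k + 1) (decBits (k + 1) b y) =
      val k (fun i => y (i + 1) + y 0) + ((y 0 + b : Fin 2) : ℕ) * 2 ^ k := by
    rw [val]
    congr 1
    · exact val_congr fun i hi => by simp [decBits, hi]
    · simp [decBits]
  have h3 := val_compl k (fun i => y (i + 1))
  -- The residue is identified by an explicit quotient: `m / 2` for even indices and `-(m / 2) - 1`
  -- for odd ones.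
  have key : ∀ (r : ℕ) (q : ℤ), r < 2 ^ (k + 1) →
      decode (m * 2 ^ (k + 1) + val (k + 1) y) = r + 2 ^ (k + 1) * q →
      retDecode (val (k + 1) y) (k + 1) m = r := by
    intro r q hr h
    rw [retDecode, h, Int.add_mul_emod_self_left, Int.emod_eq_of_lt (by positivity)
      (by exact_mod_cast hr), Int.toNat_natCast]
  rw [h2]
  have hm := Nat.div_add_mod m 2
  set m' := m / 2
  rw [← hv] at h3
  have hmz : (m : ℤ) = 2 * m' + (b : ℕ) := by omega
  rcases fin_two_cases (y 0) with h0 | h0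
  · have e : decode (m * 2 ^ (k + 1) + val (k + 1) y) = m * 2 ^ k + v := by
      rw [h1, h0, decode, if_pos]
      · push_cast
        rw [pow_succ, show (m : ℤ) * (2 ^ k * 2) + (((0 : Fin 2) : ℕ) + 2 * v) =
          2 * (m * 2 ^ k + v) by simp; ring, Int.mul_ediv_cancel_left _ (by norm_num)]
      · simp [pow_succ, parity_simps]
    refine key _ m' ?_ ?_
    · rcases fin_two_cases b with h | h <;> simp only [h, h0, pow_succ, add_zero, zero_add, ← hv]
        <;>
        simp <;> omega
    · rw [e, hmz]
      simp only [h0, add_zero, zero_add, ← hv]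
      push_cast
      rw [pow_succ]; ring
  · have e : decode (m * 2 ^ (k + 1) + val (k + 1) y) = -(m * 2 ^ k + v + 1) := by
      rw [h1, h0, decode, if_neg]
      · push_cast
        rw [pow_succ, show (m : ℤ) * (2 ^ k * 2) + (((1 : Fin 2) : ℕ) + 2 * v) + 1 =
          2 * (m * 2 ^ k + v + 1) by simp; ring, Int.mul_ediv_cancel_left _ (by norm_num)]
      · simp [pow_succ, parity_simps]
    have h3' : (val k (fun i => y (i + 1) + 1) : ℤ) = 2 ^ k - 1 - v := by
      have : ((val k (fun i => y (i + 1) + 1) + v + 1 : ℕ) : ℤ) = ((2 ^ k : ℕ) : ℤ) := by rw [h3]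
      push_cast at this
      linarith
    refine key _ (-m' - 1) ?_ ?_
    · rcases fin_two_cases b with h | h <;> simp only [h, h0, pow_succ] <;> simp <;> omega
    · rw [e, hmz]
      simp only [h0]
      push_cast
      rw [h3', pow_succ]
      rcases fin_two_cases b with h | h <;> simp [h] <;> ring

/-- Bits `i < n` negated if bit `n` is set. -/
def fanBits (n : ℕ) (y : ℕ → Fin 2) : ℕ → Fin 2 := fun i => if i < n then y i + y n else y i

/-- Encoding of the `j` lowest bits, the inverse of the retaining decoding with parity `b`. -/
def encBits (j : ℕ) (b : Fin 2) (y : ℕ → Fin 2) : ℕ → Fin 2 :=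
  revBits j (revBits (j - 1) (fanBits (j - 1) (Function.update y (j - 1) (y (j - 1) + b))))

theorem fin_two_add_add (a b : Fin 2) : a + b + b = a := by
  revert a b; decide

theorem decBits_encBits {j : ℕ} (hj : 1 ≤ j) (b : Fin 2) (y : ℕ → Fin 2) :
    decBits j b (encBits j b y) = y := by
  funext i
  have h0 : encBits j b y 0 = y (j - 1) + b := by
    simp only [encBits, revBits, fanBits, show 0 < j by omega, if_true, Nat.sub_zero,
      Function.update_self]
    simp
  unfold decBits
  split_ifs with h1 h2
  · rw [h0]
    have : encBits j b y (i + 1) = y i + (y (j - 1) + b) := by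
      simp only [encBits, revBits, fanBits, h1, if_true, show j - 1 - (i + 1) < j - 1 by omega,
        show j - 1 - 1 - (j - 1 - (i + 1)) = i by omega, show i < j - 1 by omega,
        Function.update_self, Function.update_of_ne (show i ≠ j - 1 by omega)]
    rw [this, fin_two_add_add]
  · rw [h0, fin_two_add_add]
    congr 1; omega
  · simp only [encBits, revBits, fanBits, show ¬ i < j by omega, show ¬ i < j - 1 by omega,
      if_false,
      Function.update_of_ne (show i ≠ j - 1 by omega)]

/-- Reversing `j` bits and then `j - 1` bits moves each bit down one place and bit `0` to the top,
where it controls the complement. -/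
theorem decBits_zero_eq {j : ℕ} (hj : 1 ≤ j) (y : ℕ → Fin 2) :
    decBits j 0 y = fanBits (j - 1) (revBits (j - 1) (revBits j y)) := by
  funext i
  have h0 : revBits (j - 1) (revBits j y) (j - 1) = y 0 := by
    simp [revBits, show 0 < j by omega]
  unfold fanBits
  rw [h0]
  unfold decBits
  by_cases h1 : i + 1 < j
  · rw [if_pos h1, if_pos (by omega)]
    simp only [revBits, show i < j - 1 by omega, show j - 1 - 1 - i < j by omega, if_true]
    rw [show j - 1 - (j - 1 - 1 - i) = i + 1 by omega]
  · rw [if_neg h1, if_neg (show ¬ i < j - 1 by omega)]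
    split_ifs with h2
    · rw [show i = j - 1 by omega, h0, add_zero]
    · simp [revBits, show ¬ i < j - 1 by omega, show ¬ i < j by omega]

theorem encBits_of_le {j i : ℕ} (b : Fin 2) (hj : 1 ≤ j) (h : j ≤ i) (y : ℕ → Fin 2) :
    encBits j b y i = y i := by
  simp only [encBits, revBits, fanBits, show ¬ i < j by omega, show ¬ i < j - 1 by omega, if_false,
      Function.update_of_ne (show i ≠ j - 1 by omega)]

/-! ### Circuits controlled on the helper bits -/

section Helper
variable {T : PacketTree} {L : ℕ}

/-- Level of the leaf that belongs to the number written in the `L` lowest bits. -/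
def bitLevel (T : PacketTree) (L : ℕ) (y : ℕ → Fin 2) : ℕ := T.level L (val L y)

/-- The ancilla qubits `L, …, n - 1` hold the bits `h_1, …, h_L, 0, …, 0`. -/
def HelperBits (T : PacketTree) (L n : ℕ) (y : ℕ → Fin 2) : Prop :=
  ∀ i, L ≤ i → i < n → y i = if i < 2 * L ∧ i + 1 ≤ L + bitLevel T L y then 1 else 0

open Classical in
/-- The function `ψ` restricted to a set of basis states. -/
noncomputable def restrict (S : (ℕ → Fin 2) → Prop) (ψ : (ℕ → Fin 2) → ℂ) :
    (ℕ → Fin 2) → ℂ :=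
  fun y => if S y then ψ y else 0

theorem restrict_congr {S : (ℕ → Fin 2) → Prop} {ψ φ : (ℕ → Fin 2) → ℂ}
    (h : ∀ y, S y → ψ y = φ y) : restrict S ψ = restrict S φ := by
  funext y
  unfold restrict
  split_ifs with hy
  · exact h y hy
  · rfl

theorem bitLevel_le (y : ℕ → Fin 2) : bitLevel T L y ≤ L := PacketTree.level_le _ _ _

theorem bitLevel_pos (hL : 1 ≤ L) (hT : T.Admissible L) (y : ℕ → Fin 2) : 1 ≤ bitLevel T L y :=
  PacketTree.level_pos hL hT (val_lt _ _)

/-- It is enough that one of the two strings is on a level `≥ j`; `controlled_op` needs the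
statement from both sides. -/
theorem bitLevel_congr (hL : 1 ≤ L) (hT : T.Admissible L) {j : ℕ} {y z : ℕ → Fin 2}
    (h : ∀ i, j ≤ i → i < L → y i = z i) (hj : j ≤ bitLevel T L y ∨ j ≤ bitLevel T L z) :
    bitLevel T L z = bitLevel T L y := by
  have key : ∀ {u v : ℕ → Fin 2}, (∀ i, j ≤ i → i < L → u i = v i) → j ≤ bitLevel T L u →
      bitLevel T L v = bitLevel T L u := fun {u v} huv hu =>
    PacketTree.level_congr hL hT (val_lt _ _) hu
      (val_div_congr (hu.trans (bitLevel_le u)) huv)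
  rcases hj with hj | hj
  · exact key h hj
  · exact (key (fun i h1 h2 => (h i h1 h2).symm) hj).symm

theorem helperBits_congr {n : ℕ} {y z : ℕ → Fin 2} (h : ∀ i, L ≤ i → z i = y i)
    (hl : bitLevel T L z = bitLevel T L y) : HelperBits T L n z ↔ HelperBits T L n y := by
  unfold HelperBits
  rw [hl]
  refine forall_congr' fun i => ?_
  constructor <;> intro h1 h2 <;> have := h1 h2
  · rwa [h i h2] at this
  · rwa [h i h2]

/-- An operation on the data qubits, controlled on ancilla qubits in such a way that it is active
on some levels only, preserves the helper bits. -/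
theorem controlled_op {n : ℕ} {κ : Type} [Fintype κ] {O : ((ℕ → Fin 2) → ℂ) → ((ℕ → Fin 2) → ℂ)}
    {active : (ℕ → Fin 2) → Prop} [DecidablePred active] {act : ℕ → Prop} [DecidablePred act]
    {A : κ → (ℕ → Fin 2) → ℂ} {f : κ → (ℕ → Fin 2) → (ℕ → Fin 2)}
    (hO : ∀ Ψ y, O Ψ y = if active y then ∑ k, A k y * Ψ (f k y) else Ψ y)
    (hanc : ∀ k y i, L ≤ i → f k y i = y i)
    (hact : ∀ y, HelperBits T L n y → (active y ↔ act (bitLevel T L y)))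
    (hcong : ∀ y z, (∀ i, L ≤ i → z i = y i) → active y → active z)
    (hlev : ∀ k y, act (bitLevel T L y) ∨ act (bitLevel T L (f k y)) →
      bitLevel T L (f k y) = bitLevel T L y) (ψ : (ℕ → Fin 2) → ℂ) :
    O (restrict (HelperBits T L n) ψ) = restrict (HelperBits T L n)
      fun y => if act (bitLevel T L y) then ∑ k, A k y * ψ (f k y) else ψ y := by
  funext y
  rw [hO]
  by_cases hy : HelperBits T L n y
  · simp only [restrict, hact y hy, hy, if_true]
    split_ifs with ha
    · refine Finset.sum_congr rfl fun k _ => ?_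
      rw [if_pos ((helperBits_congr (hanc k y) (hlev k y (Or.inl ha))).2 hy)]
    · rfl
  -- If the helper bits of `y` are wrong, so are those of each `f k y`. Otherwise activity would be
  -- decided by the level of `f k y`, hence `y` would have the same level and the same ancillas, and
  -- its helper bits would be right.
  · simp only [restrict, hy, if_false]
    split_ifs with ha
    · refine Finset.sum_eq_zero fun k _ => ?_
      rw [if_neg, mul_zero]
      intro hf
      have h1 := (hact _ hf).1 (hcong y _ (hanc k y) ha)
      exact hy ((helperBits_congr (hanc k y) (hlev k y (Or.inr h1))).1 hf)
    · rfl

theorem controlled_pulls {n : ℕ} {c : List (Gate ℕ)}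
    {active : (ℕ → Fin 2) → Prop} [DecidablePred active] {act : ℕ → Prop} [DecidablePred act]
    {f : (ℕ → Fin 2) → (ℕ → Fin 2)}
    (hc : Pulls c fun y => if active y then f y else y)
    (hanc : ∀ y i, L ≤ i → f y i = y i)
    (hact : ∀ y, HelperBits T L n y → (active y ↔ act (bitLevel T L y)))
    (hcong : ∀ y z, (∀ i, L ≤ i → z i = y i) → active y → active z)
    (hlev : ∀ y, act (bitLevel T L y) ∨ act (bitLevel T L (f y)) →
      bitLevel T L (f y) = bitLevel T L y) (ψ : (ℕ → Fin 2) → ℂ) :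
    runCircuit c (restrict (HelperBits T L n) ψ) = restrict (HelperBits T L n)
      fun y => if act (bitLevel T L y) then ψ (f y) else ψ y := by
  have := controlled_op (κ := Unit) (A := fun _ _ => 1) (f := fun _ => f) (O := runCircuit c)
    (T := T) (L := L) (n := n) (active := active) (act := act)
    (fun Ψ y => by
      rw [hc]
      simp only [Finset.univ_unique, Finset.sum_singleton, one_mul]
      split_ifs <;> rfl)
    (fun _ => hanc) hact hcong (fun _ => hlev) ψ
  simpa using this

theorem helperBits_apply {n : ℕ} {y : ℕ → Fin 2} (hy : HelperBits T L n y) {i : ℕ} (hi : i < L)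
    (hn : L + i < n) : y (L + i) = if i + 1 ≤ bitLevel T L y then 1 else 0 := by
  rw [hy _ (by omega) hn]
  congr 1
  rw [eq_iff_iff]; omega

/-- Stage `t` changes only bit `t`, which does not leave a leaf on a level `≥ t + 1`. -/
theorem stage_restrict (hL : 1 ≤ L) (hT : T.Admissible L) (s : Bool) {n t : ℕ} (hn : 2 * L ≤ n)
    (ht : t < L) (ψ : (ℕ → Fin 2) → ℂ) :
    runCircuit (stage s L t) (restrict (HelperBits T L n) ψ) = restrict (HelperBits T L n)
      fun y => if t + 1 ≤ bitLevel T L y then stageOp s t ψ y else ψ y := by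
  refine controlled_op (act := fun l => t + 1 ≤ l) (active := fun y => y (L + t) = 1)
    (stage_run s ht) ?_ ?_ ?_ ?_ ψ
  · intro b y i hi
    exact Function.update_of_ne (by omega) _ _
  · intro y hy
    rw [helperBits_apply hy ht (by omega)]
    split_ifs with h <;> simp [h]
  · intro y z h ha
    rw [h _ (by omega)]; exact ha
  · intro b y h
    exact bitLevel_congr hL hT (j := t + 1)
      (fun i h1 h2 => (Function.update_of_ne (by omega) _ _).symm) h

theorem bitLevel_setLow (hL : 1 ≤ L) (hT : T.Admissible L) {j : ℕ} {y : ℕ → Fin 2}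
    (hj : j ≤ bitLevel T L y) (x : ℕ) : bitLevel T L (setLow j x y) = bitLevel T L y :=
  bitLevel_congr hL hT (j := j) (fun _ h _ => (setLow_apply_of_le h x y).symm) (Or.inl hj)

/-- All levels share the same stages: on a leaf of level `l` the stages `t ≥ l` are switched off and
the remaining ones make up the transform of `l` qubits. This saves a factor `L` over separate
transforms for each level. -/
theorem stages_restrict (hL : 1 ≤ L) (hT : T.Admissible L) (s : Bool) {n k : ℕ} (hn : 2 * L ≤ n)
    (hk : k ≤ L) (ψ : (ℕ → Fin 2) → ℂ) :
    runCircuit (stages s L k) (restrict (HelperBits T L n) ψ) = restrict (HelperBits T L n)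
      fun y => qftSum s (min k (bitLevel T L y)) ψ y := by
  induction k generalizing ψ with
  | zero =>
      refine restrict_congr fun y _ => ?_
      have : setLow 0 0 y = y := funext fun i => by simp [setLow]
      simp [qftSum, this, expi_zero, rval]
  | succ k ih =>
      rw [stages, runCircuit_append, stage_restrict hL hT s hn (by omega), ih (by omega)]
      refine restrict_congr fun y _ => ?_
      rcases Nat.lt_or_ge k (bitLevel T L y) with h | h
      · rw [min_eq_left h.le, min_eq_left (show k + 1 ≤ _ from h), qftSum_succ]
        refine qftSum_congr s k fun x => ?_
        rw [bitLevel_setLow hL hT h.le, if_pos (Nat.succ_le_of_lt h)]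
      · rw [min_eq_right h, min_eq_right (by omega)]
        refine qftSum_congr s _ fun x => ?_
        rw [bitLevel_setLow hL hT le_rfl, if_neg (by omega)]

/-! ### Operations on single levels -/

theorem pulls_ctrl_append {c d : List (Gate ℕ)} {f g : (ℕ → Fin 2) → (ℕ → Fin 2)} {e : ℕ}
    (hc : Pulls c fun y => if y e = 1 then f y else y)
    (hd : Pulls d fun y => if y e = 1 then g y else y) (he : ∀ y, g y e = y e) :
    Pulls (c ++ d) fun y => if y e = 1 then f (g y) else y := by
  refine (hc.append hd).congr fun y => ?_
  by_cases h : y e = 1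
  · simp [h, he]
  · simp [h]

/-- The circuit `c` surrounded by controlled negations of `e`. -/
def sandwich (e : ℕ) (c : List (Gate ℕ)) : List (Gate ℕ) := cx (e + 1) e :: (c ++ [cx (e + 1) e])

/-- The control qubit temporarily holds the sum of two consecutive helper bits, which turns "level
at least `j`" into "level equal to `j`". Restoring it requires that `f` neither reads nor changes
it. -/
theorem pulls_sandwich {c : List (Gate ℕ)} {f : (ℕ → Fin 2) → (ℕ → Fin 2)} {e : ℕ}
    (hc : Pulls c fun y => if y e = 1 then f y else y) (h0 : ∀ y, f y e = y e)
    (h1 : ∀ y, f y (e + 1) = y (e + 1))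
    (hf : ∀ y v, f (Function.update y e v) = Function.update (f y) e v) :
    Pulls (sandwich e c) fun y => if y e + y (e + 1) = 1 then f y else y := by
  refine ((pulls_cx (e + 1) e).append (hc.append (pulls_cx (e + 1) e))).congr fun y => ?_
  simp only [Function.update_self]
  by_cases h : y e + y (e + 1) = 1
  · simp only [h, if_true, hf, Function.update_self, Function.update_idem,
      Function.update_of_ne (show e + 1 ≠ e by omega), h1]
    have : (1 : Fin 2) + y (e + 1) = f y e := by rw [h0, ← h, fin_two_add_add]
    rw [this, Function.update_eq_self]
  · simp only [h, if_false, Function.update_self, Function.update_idem,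
      Function.update_of_ne (show e + 1 ≠ e by omega), fin_two_add_add, Function.update_eq_self]

/-- Circuits `c 0, …, c (k - 1)`, the circuit `c i` being controlled on the level `i + 1`. -/
def levelBlocks (c : ℕ → List (Gate ℕ)) (L k : ℕ) : List (Gate ℕ) :=
  (List.range k).flatMap fun i => sandwich (L + i) (c i)

/-- Because `2 * L < n`, the ancilla qubit `2 * L` is `0` and serves as `h_{L+1}` for the top level.
By `hloc` the data operations do not depend on ancillas. -/
theorem levelBlocks_restrict (hL : 1 ≤ L) (hT : T.Admissible L) {n k : ℕ} (hn : 2 * L < n)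
    (hk : k ≤ L) (c : ℕ → List (Gate ℕ)) (f : ℕ → (ℕ → Fin 2) → (ℕ → Fin 2))
    (hc : ∀ i < L, Pulls (c i) fun y => if y (L + i) = 1 then f (i + 1) y else y)
    (hf : ∀ j y i, 1 ≤ j → j ≤ i → f j y i = y i)
    (hloc : ∀ j y z, j ≤ L → (∀ i < L, y i = z i) → ∀ i < L, f j y i = f j z i)
    (ψ : (ℕ → Fin 2) → ℂ) :
    runCircuit (levelBlocks c L k) (restrict (HelperBits T L n) ψ) =
      restrict (HelperBits T L n)
        fun y => if bitLevel T L y ≤ k then ψ (f (bitLevel T L y) y) else ψ y := by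
  have hlev : ∀ j y, 1 ≤ j → bitLevel T L y = j ∨ bitLevel T L (f j y) = j →
      bitLevel T L (f j y) = bitLevel T L y := fun j y h1 h =>
    bitLevel_congr hL hT (j := j) (fun i hi _ => (hf j y i h1 hi).symm)
      (h.imp (fun h => h.ge) (fun h => h.ge))
  induction k with
  | zero =>
      rw [levelBlocks]
      refine restrict_congr fun y _ => ?_
      rw [if_neg]
      have := bitLevel_pos hL hT y
      omega
  | succ k ih =>
      have hf' : ∀ y i, k + 1 ≤ i → f (k + 1) y i = y i := fun y i => hf _ y i (by omega)
      rw [levelBlocks, flatMap_range_succ, runCircuit_append]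
      rw [levelBlocks] at ih
      rw [ih (by omega), controlled_pulls (f := f (k + 1)) (act := fun l => l = k + 1)
        (pulls_sandwich (hc k (by omega)) (fun y => hf' y _ (by omega))
            (fun y => hf' y _ (by omega))
          ?_) (fun y i hi => hf' y i (by omega)) ?_ ?_ (fun y => hlev _ y (by omega))]
      · refine restrict_congr fun y _ => ?_
        by_cases h : bitLevel T L y = k + 1
        · rw [if_pos h, if_pos h.le, hlev _ y (by omega) (Or.inl h), if_neg (by omega), h]
        · simp only [h, if_false, show bitLevel T L y ≤ k + 1 ↔ bitLevel T L y ≤ k by omega]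
      · intro y v
        funext i
        by_cases hi : i = L + k
        · subst hi; rw [hf' _ _ (by omega), Function.update_self, Function.update_self]
        · rw [Function.update_of_ne hi]
          by_cases hi' : i < L
          · refine hloc _ _ _ hk (fun i' h' => ?_) i hi'
            rw [Function.update_of_ne (show i' ≠ L + k by omega)]
          · rw [hf' _ _ (by omega), hf' _ _ (by omega), Function.update_of_ne hi]
      -- The bits `h_{k+1}` and `h_{k+2}` differ exactly on level `k + 1`.
      · intro y hy
        have hle := bitLevel_le (T := T) (L := L) y
        rw [hy (L + k) (by omega) (by omega), hy (L + k + 1) (by omega) (by omega)]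
        by_cases h1 : k + 1 ≤ bitLevel T L y
        · by_cases h2 : k + 2 ≤ bitLevel T L y
          · rw [if_pos (by omega), if_pos (by omega)]
            simp; omega
          · rw [if_pos (by omega), if_neg (by omega)]
            simp; omega
        · rw [if_neg (by omega), if_neg (by omega)]
          simp; omega
      · intro y z h ha
        rw [h _ (by omega), h _ (by omega)]; exact ha

/-- The controlled Fourier transforms. -/
def fourierCircuit (s : Bool) (L : ℕ) : List (Gate ℕ) :=
  stages s L L ++ levelBlocks (fun i => crev 2 (L + i) (i + 1)) L L

theorem revBits_of_le {j i : ℕ} (h : j ≤ i) (y : ℕ → Fin 2) : revBits j y i = y i := by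
  rw [revBits, if_neg (by omega)]

theorem setLow_revBits (j x : ℕ) (y : ℕ → Fin 2) : setLow j x (revBits j y) = setLow j x y := by
  funext i
  rcases Nat.lt_or_ge i j with h | h
  · simp [setLow, h]
  · rw [setLow_apply_of_le h, setLow_apply_of_le h, revBits_of_le h]

/-- The stages leave the output bits in reversed order; the levelwise reversals turn `rval` into
`val`. -/
theorem fourierCircuit_restrict (hL : 1 ≤ L) (hT : T.Admissible L) (s : Bool) {n : ℕ}
    (hn : 2 * L < n) (ψ : (ℕ → Fin 2) → ℂ) :
    runCircuit (fourierCircuit s L) (restrict (HelperBits T L n) ψ) = restrict (HelperBits T L n)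
      fun y => ((√2 : ℂ)⁻¹) ^ bitLevel T L y * ∑ x ∈ Finset.range (2 ^ bitLevel T L y),
        expi s ((x : ℂ) * val (bitLevel T L y) y / 2 ^ bitLevel T L y) *
          ψ (setLow (bitLevel T L y) x y) := by
  rw [fourierCircuit, runCircuit_append, stages_restrict hL hT s hn.le le_rfl,
    levelBlocks_restrict hL hT hn le_rfl _ (fun j => revBits j)
      (fun i hi => pulls_crev (by omega)) (fun j y i _ h => revBits_of_le h y)]
  · refine restrict_congr fun y _ => ?_
    have h : bitLevel T L (revBits (bitLevel T L y) y) = bitLevel T L y :=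
      bitLevel_congr hL hT (fun i hi _ => (revBits_of_le hi y).symm) (Or.inl le_rfl)
    rw [if_pos (bitLevel_le y), h, min_eq_right (bitLevel_le y), qftSum, rval_revBits]
    simp only [setLow_revBits]
  · intro j y z hj h i hi
    unfold revBits
    split_ifs
    · exact h _ (by omega)
    · exact h _ hi

/-- Retaining decoding of the `j` lowest qubits, controlled on qubit `e`. -/
def decodeLevel (L e j : ℕ) : List (Gate ℕ) :=
  crev 2 e j ++ (crev 2 e (j - 1) ++ (fan 2 e (j - 1) (j - 1) ++
    if j < L then ccx 2 e j (j - 1) else []))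

/-- The circuit decodes, so the inverse permutation recorded by `Pulls` encodes. The parity of the
block index is qubit `j`, except on level `L`: there the only block has index `0`, and qubit `L` is
already an ancilla. -/
theorem pulls_decodeLevel {e j : ℕ} (hj : 1 ≤ j) (hjL : j ≤ L) (he : L ≤ e) :
    Pulls (decodeLevel L e j)
      fun y => if y e = 1 then encBits j (if j < L then y j else 0) y else y := by
  have htop : Pulls (if j < L then ccx 2 e j (j - 1) else []) fun y => if y e = 1 then
      Function.update y (j - 1) (y (j - 1) + if j < L then y j else 0) else y := by
    split_ifs with h
    · refine (pulls_ccx (by omega) (by omega) (by omega)).congr fun y => ?_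
      rcases fin_two_cases (y e) with h' | h' <;> simp [h']
    · exact Pulls.nil.congr fun y => by simp
  have hfan : Pulls (fan 2 e (j - 1) (j - 1)) fun y => if y e = 1 then fanBits (j - 1) y else y :=
      by
    refine (pulls_fan (by omega) le_rfl (by omega)).congr fun y => ?_
    rcases fin_two_cases (y e) with h' | h' <;> simp [h']
    rfl
  refine pulls_ctrl_append (pulls_crev (by omega)) (pulls_ctrl_append (pulls_crev (by omega))
    (pulls_ctrl_append hfan htop ?_) ?_) ?_
  · intro y; exact Function.update_of_ne (by omega) _ _
  · intro y
    rw [fanBits, if_neg (by omega)]; exact Function.update_of_ne (by omega) _ _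
  · intro y
    rw [revBits_of_le (by omega), fanBits, if_neg (by omega)]
    exact Function.update_of_ne (by omega) _ _

/-- The controlled retaining decodings. -/
def decodeCircuit (L : ℕ) : List (Gate ℕ) :=
  levelBlocks (fun i => decodeLevel L (L + i) (i + 1)) L L

theorem decodeCircuit_restrict (hL : 1 ≤ L) (hT : T.Admissible L) {n : ℕ}
    (hn : 2 * L < n) (ψ : (ℕ → Fin 2) → ℂ) :
    runCircuit (decodeCircuit L) (restrict (HelperBits T L n) ψ) = restrict (HelperBits T L n)
      fun y => ψ (encBits (bitLevel T L y)
        (if bitLevel T L y < L then y (bitLevel T L y) else 0) y) := by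
  rw [decodeCircuit, levelBlocks_restrict hL hT hn le_rfl _
      (fun j y => encBits j (if j < L then y j else 0) y)
      (fun i hi => pulls_decodeLevel (by omega) (by omega) (by omega))
      (fun j y i h1 h => encBits_of_le _ h1 h y)]
  · refine restrict_congr fun y _ => ?_
    rw [if_pos (bitLevel_le y)]
  · intro j y z hj h i hi
    have hb : (if j < L then y j else 0) = if j < L then z j else 0 := by
      split_ifs with h'
      · exact h j h'
      · rfl
    simp only [hb, encBits, revBits, fanBits]
    split_ifs <;> simp only [Function.update_apply] <;> (try split_ifs) <;>
      simp only [h _ hi, h (j - 1) (by omega), h (j - 1 - i) (by omega),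
        h (j - 1 - 1 - i) (by omega), h (j - 1 - 1 - (j - 1 - i)) (by omega)]

/-- Frequency encoding of `L` qubits, if the helper bit `h_L` is set. -/
def encodeLevel (L : ℕ) : List (Gate ℕ) :=
  fan 2 (2 * L - 1) (L - 1) (L - 1) ++ (crev 2 (2 * L - 1) (L - 1) ++ crev 2 (2 * L - 1) L)

/-- In the one-leaf tree every index has level `L`, so the control `h_L`, held in qubit `2 * L - 1`,
is always set. Encoding basis states means pulling the amplitudes back along the decoding. -/
theorem encodeLevel_restrict (hL : 1 ≤ L) {n : ℕ} (hn : 2 * L < n) (ψ : (ℕ → Fin 2) → ℂ) :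
    runCircuit (encodeLevel L) (restrict (HelperBits .leaf L n) ψ) =
      restrict (HelperBits .leaf L n) fun y => ψ (decBits L 0 y) := by
  have hfan : Pulls (fan 2 (2 * L - 1) (L - 1) (L - 1))
      fun y => if y (2 * L - 1) = 1 then fanBits (L - 1) y else y := by
    refine (pulls_fan (by omega) le_rfl (by omega)).congr fun y => ?_
    rcases fin_two_cases (y (2 * L - 1)) with h' | h' <;> simp [h']
    rfl
  have hp : Pulls (encodeLevel L) fun y => if y (2 * L - 1) = 1 then decBits L 0 y else y := by
    refine (pulls_ctrl_append hfan (pulls_ctrl_append (pulls_crev (n := L - 1) (by omega))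
      (pulls_crev (n := L) (by omega)) ?_) ?_).congr fun y => ?_
    · intro y; exact revBits_of_le (by omega) y
    · intro y; rw [revBits_of_le (by omega), revBits_of_le (by omega)]
    · rw [decBits_zero_eq hL]
  have hlev : ∀ y, bitLevel .leaf L y = L := fun y => rfl
  rw [controlled_pulls (T := .leaf) (L := L) (act := fun _ => True) hp]
  · simp
  · intro y i hi
    rw [decBits, if_neg (by omega), if_neg (by omega)]
  · intro y hy
    rw [hy _ (by omega) (by omega), hlev, if_pos (by omega)]
    simp
  · intro y z h ha
    rw [h _ (by omega)]; exact ha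
  · intro y _; rw [hlev, hlev]

/-- Negation of the qubits `L, …, 2 L - 1`. -/
def flips (L : ℕ) : List (Gate ℕ) := (List.range L).flatMap fun i => [.single .X (L + i)]

theorem pulls_flips (L : ℕ) :
    Pulls (flips L) fun y i => if L ≤ i ∧ i < 2 * L then y i + 1 else y i := by
  have key : ∀ k, Pulls ((List.range k).flatMap fun i => [.single .X (L + i)])
      fun y i => if L ≤ i ∧ i < L + k then y i + 1 else y i := by
    intro k
    induction k with
    | zero => exact Pulls.nil.congr fun y => funext fun i => (if_neg (by omega)).symm
    | succ k ih =>
        rw [flatMap_range_succ]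
        refine (ih.append (pulls_x (L + k))).congr fun y => funext fun i => ?_
        by_cases h : i = L + k
        · subst h; simp
        · rw [Function.update_of_ne h]
          simp only [show (L ≤ i ∧ i < L + (k + 1)) ↔ (L ≤ i ∧ i < L + k) by omega]
  rw [flips]
  simpa only [two_mul] using key L

/-- The ancilla qubits `L, …, n - 1` are in the state `|0⟩`. -/
def ZeroBits (L n : ℕ) (y : ℕ → Fin 2) : Prop := ∀ i, L ≤ i → i < n → y i = 0

/-- Negated zeros are the correct helper bits of the one-leaf tree, so results on controlled
circuits apply to the whole register. -/
theorem flips_iff {n : ℕ} (y : ℕ → Fin 2) :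
    HelperBits .leaf L n (fun i => if L ≤ i ∧ i < 2 * L then y i + 1 else y i) ↔ ZeroBits L n y :=
      by
  have hlev : ∀ y, bitLevel .leaf L y = L := fun y => rfl
  unfold HelperBits ZeroBits
  refine forall_congr' fun i => forall_congr' fun h1 => forall_congr' fun h2 => ?_
  rw [hlev]
  beta_reduce
  by_cases h : i < 2 * L
  · rw [if_pos ⟨h1, h⟩, if_pos ⟨h, by omega⟩]
    rcases fin_two_cases (y i) with h | h <;> simp [h]
  · rw [if_neg (by omega), if_neg (by omega)]

/-- Inverse Fourier transform followed by the frequency encoding. -/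
def encodeCircuit (L : ℕ) : List (Gate ℕ) :=
  flips L ++ (fourierCircuit false L ++ (encodeLevel L ++ flips L))

end Helper

/-! ### Computation of the helper bits -/

/-- One step of the comparison with a number that has the binary digit `b`: the carry bit `w` is
computed from the bit `q` and the carry bit `c`. -/
def carryStep (k : ℕ) (b : Bool) (q c w : ℕ) : List (Gate ℕ) :=
  ccx k q c w ++ if b then [] else [cx q w, cx c w]

/-- The carry bit after a step of the comparison. -/
def carryBit (b : Bool) (p c : Fin 2) : Fin 2 := p * c + if b then 0 else p + c

/-- The new carry is "and" for the digit `1` and "or" for the digit `0`, the latter because `p c + p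
+ c` is "or" modulo 2. -/
theorem pulls_carryStep (b : Bool) {q c w : ℕ} (hqc : q ≠ c) (hqw : q ≠ w) (hcw : c ≠ w) :
    Pulls (carryStep 2 b q c w) fun y => Function.update y w (y w + carryBit b (y q) (y c)) := by
  unfold carryStep
  cases b
  · refine ((pulls_ccx hqc hqw hcw).append ((pulls_cx q w).append (pulls_cx c w))).congr fun y => ?_
    simp only [Function.update_self, Function.update_of_ne hqw, Function.update_of_ne hcw,
      Function.update_idem, carryBit]
    congr 1
    simp only [Bool.false_eq_true, if_false]
    abel
  · refine ((pulls_ccx hqc hqw hcw).append Pulls.nil).congr fun y => ?_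
    simp [carryBit]

/-- Step `i` of the comparison of the bits `j, j + 1, …` with a number with the digits `d`. -/
def compareStep (k : ℕ) (d : ℕ → Bool) (L j i : ℕ) : List (Gate ℕ) :=
  carryStep k (d i) (j + i) (2 * L + 1 + i) (2 * L + 2 + i)

/-- The carry bits after `n` steps of the comparison. -/
def carries (d : ℕ → Bool) (L j : ℕ) : ℕ → (ℕ → Fin 2) → (ℕ → Fin 2)
  | 0, y => y
  | n + 1, y =>
      Function.update (carries d L j n y) (2 * L + 2 + n) (carries d L j n y (2 * L + 2 + n) +
        carryBit (d n) (carries d L j n y (j + n)) (carries d L j n y (2 * L + 1 + n)))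

/-- Compute, use and uncompute: `s` is an involution that neither reads nor writes qubit `h`, so
only the change of `h` survives. -/
theorem pulls_conj {c v : List (Gate ℕ)} {s : (ℕ → Fin 2) → (ℕ → Fin 2)} {h : ℕ}
    {g : (ℕ → Fin 2) → Fin 2} (hc : Pulls c s)
    (hv : Pulls v fun y => Function.update y h (y h + g y)) (hh : ∀ y, s y h = y h)
    (hs : ∀ y, s (s y) = y) (hu : ∀ y a, s (Function.update y h a) = Function.update (s y) h a) :
    Pulls (c ++ (v ++ c)) fun y => Function.update y h (y h + g (s y)) := by
  refine (hc.append (hv.append hc)).congr fun y => ?_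
  rw [hu, hs, hh]

theorem flatMap_range_succ' {α : Type} (f : ℕ → List α) (n : ℕ) :
    (List.range (n + 1)).flatMap f = f 0 ++ (List.range n).flatMap fun i => f (i + 1) := by
  rw [List.range_succ_eq_map, List.flatMap_cons, List.flatMap_map]

/-- The induction absorbs the innermost pair of steps into the middle circuit, hence the
generalization over `v` and `g`. -/
theorem pulls_compareSteps (d : ℕ → Bool) {L j h : ℕ} (hh : L ≤ h) (hh' : h < 2 * L) {n : ℕ}
    (hn : j + n ≤ L) {v : List (Gate ℕ)} {g : (ℕ → Fin 2) → Fin 2}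
    (hv : Pulls v fun y => Function.update y h (y h + g y)) :
    Pulls ((List.range n).flatMap (compareStep 2 d L j) ++
      (v ++ (List.range n).flatMap fun i => compareStep 2 d L j (n - 1 - i)))
      fun y => Function.update y h (y h + g (carries d L j n y)) := by
  induction n generalizing v g with
  | zero => simpa [carries] using hv
  | succ n ih =>
      have hs := pulls_carryStep (d n) (q := j + n) (c := 2 * L + 1 + n) (w := 2 * L + 2 + n)
        (by omega) (by omega) (by omega)
      have := ih (by omega) (pulls_conj hs hv (fun y => Function.update_of_ne (by omega) _ _) ?_ ?_)
      · rw [flatMap_range_succ, flatMap_range_succ']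
        have e : ∀ i, n + 1 - 1 - (i + 1) = n - 1 - i := fun i => by omega
        simp only [e, List.append_assoc] at this ⊢
        exact this
      · intro y
        simp only [Function.update_self, Function.update_idem,
          Function.update_of_ne (show j + n ≠ 2 * L + 2 + n by omega),
          Function.update_of_ne (show 2 * L + 1 + n ≠ 2 * L + 2 + n by omega), fin_two_add_add,
          Function.update_eq_self]
      · intro y a
        simp only [Function.update_of_ne (show 2 * L + 2 + n ≠ h by omega),
          Function.update_of_ne (show j + n ≠ h by omega),
          Function.update_of_ne (show 2 * L + 1 + n ≠ h by omega)]
        rw [Function.update_comm (by omega)]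

/-- Negation of the helper bit `h_j` if the number in the bits `j, …, L - 1` is not less than the
number with the digits `d`. -/
def compareLevel (k : ℕ) (d : ℕ → Bool) (L j : ℕ) : List (Gate ℕ) :=
  .single .X (2 * L + 1) :: ((List.range (L - j)).flatMap (compareStep k d L j) ++
    ((if d (L - j) then [] else [cx (2 * L + 1 + (L - j)) (L + j - 1)]) ++
      ((List.range (L - j)).flatMap (fun i => compareStep k d L j (L - j - 1 - i)) ++
        [.single .X (2 * L + 1)])))

/-- Result of the comparison. -/
def compareBit (d : ℕ → Bool) (L j : ℕ) (y : ℕ → Fin 2) : Fin 2 :=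
  if d (L - j) then 0 else
    carries d L j (L - j) (Function.update y (2 * L + 1) (y (2 * L + 1) + 1)) (2 * L + 1 + (L - j))

theorem pulls_compareLevel (d : ℕ → Bool) {L j : ℕ} (hj : 1 ≤ j) (hjL : j ≤ L) :
    Pulls (compareLevel 2 d L j)
      fun y => Function.update y (L + j - 1) (y (L + j - 1) + compareBit d L j y) := by
  have h1 : Pulls (if d (L - j) then [] else [cx (2 * L + 1 + (L - j)) (L + j - 1)])
      fun y => Function.update y (L + j - 1)
        (y (L + j - 1) + if d (L - j) then 0 else y (2 * L + 1 + (L - j))) := by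
    split_ifs
    · exact Pulls.nil.congr fun y => by simp
    · exact pulls_cx _ _
  have h2 := pulls_compareSteps d (by omega) (by omega) (show j + (L - j) ≤ L by omega) h1
  have h3 := pulls_conj (pulls_x (2 * L + 1)) h2
    (fun y => Function.update_of_ne (by omega) _ _) ?_ ?_
  · simp only [List.append_assoc] at h3
    exact h3
  · intro y
    simp only [Function.update_self, Function.update_idem, fin_two_add_add, Function.update_eq_self]
  · intro y a
    simp only [Function.update_of_ne (show 2 * L + 1 ≠ L + j - 1 by omega)]
    rw [Function.update_comm (by omega)]

theorem mod_two_pow_succ (m n : ℕ) :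
    m % 2 ^ (n + 1) = m % 2 ^ n + 2 ^ n * (m.testBit n).toNat := by
  rw [Nat.toNat_testBit, pow_succ, Nat.mod_mul]

/-- The invariant is that carry `n` compares the `n` lowest digits with the `n` lowest bits. The
initial carry is `1` because equality counts as success, and carry qubits above `n` are still
untouched. -/
theorem carries_spec (m : ℕ) {L j n : ℕ} (hn : j + n ≤ L) {y : ℕ → Fin 2}
    (h0 : y (2 * L + 1) = 1) (h1 : ∀ i, 2 * L + 1 < i → i ≤ 2 * L + 1 + n → y i = 0) :
    (∀ i, (i ≤ 2 * L + 1 ∨ 2 * L + 1 + n < i) → carries m.testBit L j n y i = y i) ∧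
      carries m.testBit L j n y (2 * L + 1 + n) =
        if m % 2 ^ n ≤ val n (fun i => y (j + i)) then 1 else 0 := by
  induction n with
  | zero => simp [carries, h0, val, Nat.mod_one]
  | succ n ih =>
      obtain ⟨ih1, ih2⟩ := ih (by omega) fun i h h' => h1 i h (by omega)
      constructor
      · intro i hi
        rw [carries, Function.update_of_ne (by omega), ih1 i (by omega)]
      · rw [carries, show 2 * L + 1 + (n + 1) = 2 * L + 2 + n by omega, Function.update_self, ih2,
          ih1 _ (by omega), ih1 _ (by omega), h1 _ (by omega) (by omega), zero_add,
          mod_two_pow_succ, val]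
        have hv := val_lt n (fun i => y (j + i))
        have hm := Nat.mod_lt m (show 0 < 2 ^ n by positivity)
        set v := val n (fun i => y (j + i))
        unfold carryBit
        cases m.testBit n <;> rcases fin_two_cases (y (j + n)) with h | h <;> simp only [h] <;>
          by_cases hc : m % 2 ^ n ≤ v <;> simp [hc] <;> omega

/-- If digit `L - j` is set then `m = 2^(L - j)`, which exceeds every number of `L - j` bits.
Otherwise `m` fits into the compared digits. -/
theorem compareBit_spec {m L j : ℕ} (hm : m ≤ 2 ^ (L - j)) (hjL : j ≤ L) {y : ℕ → Fin 2}
    (hy : ∀ i, 2 * L < i → i ≤ 2 * L + 1 + (L - j) → y i = 0) :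
    compareBit m.testBit L j y = if m ≤ val L y / 2 ^ j then 1 else 0 := by
  have hv : val L y / 2 ^ j = val (L - j) (fun i => y (j + i)) := val_div hjL y
  have hlt := val_lt (L - j) (fun i => y (j + i))
  unfold compareBit
  rcases hm.eq_or_lt with h | h
  · have : m.testBit (L - j) = true := by rw [h, Nat.testBit_two_pow_self]
    rw [if_pos this, if_neg]
    omega
  · have : m.testBit (L - j) = false := Nat.testBit_lt_two_pow h
    rw [this]
    have h2 := (carries_spec m (show j + (L - j) ≤ L by omega)
      (y := Function.update y (2 * L + 1) (y (2 * L + 1) + 1)) ?_ ?_).2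
    · rw [if_neg (by simp), h2, Nat.mod_eq_of_lt h, hv]
      rw [val_congr (n := L - j) (z := fun i => y (j + i))]
      intro i hi
      exact Function.update_of_ne (by omega) _ _
    · simp [hy (2 * L + 1) (by omega) (by omega)]
    · intro i h1 h2
      rw [Function.update_of_ne (by omega), hy i (by omega) h2]

/-- Computation of the helper bits, `d j` being the digits of `m_j^*`. -/
def helperCircuit (d : ℕ → ℕ → Bool) (L : ℕ) : List (Gate ℕ) :=
  (List.range L).flatMap fun i => compareLevel 2 (d (i + 1)) L (i + 1)

/-- Each comparison reads data qubits and clean carry qubits only, so the bits already written do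
not disturb later comparisons. The work qubits `2 * L + 1, …, 3 * L` suffice because `j ≥ 1`. -/
theorem pulls_helperCircuit {T : PacketTree} {L : ℕ} (hL : 1 ≤ L) (hT : T.Admissible L)
    (hm : T.Monotonic L) : ∃ f, Pulls (helperCircuit (treeInput T L) L) f ∧
      (∀ y i, i < L ∨ 2 * L ≤ i → f y i = y i) ∧
      ∀ y, (∀ i, 2 * L < i → i < 3 * L + 1 → y i = 0) → ∀ i < L,
        f y (L + i) = y (L + i) + if i + 1 ≤ bitLevel T L y then 1 else 0 := by
  have key : ∀ k ≤ L, ∃ f, Pulls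
      ((List.range k).flatMap fun i => compareLevel 2 (treeInput T L (i + 1)) L (i + 1)) f ∧
      (∀ y i, i < L ∨ 2 * L ≤ i → f y i = y i) ∧
      ∀ y, (∀ i, 2 * L < i → i < 3 * L + 1 → y i = 0) → ∀ i < L,
        f y (L + i) = y (L + i) + if i < k ∧ i + 1 ≤ bitLevel T L y then 1 else 0 := by
    intro k
    induction k with
    | zero => exact fun _ => ⟨id, Pulls.nil, fun _ _ _ => rfl, fun y _ i _ => by simp⟩
    | succ k ih =>
        intro hk
        obtain ⟨f, h1, h2, h3⟩ := ih (by omega)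
        rw [flatMap_range_succ]
        refine ⟨_, h1.append (pulls_compareLevel _ (by omega) hk), ?_, ?_⟩
        · intro y i hi
          rw [h2 _ _ hi, Function.update_of_ne (by omega)]
        · intro y hy i hi
          have hb : bitLevel T L (Function.update y (L + (k + 1) - 1)
              (y (L + (k + 1) - 1) + compareBit (treeInput T L (k + 1)) L (k + 1) y)) =
              bitLevel T L y := by
            unfold bitLevel
            rw [val_congr (n := L) (z := y)]
            intro i hi
            exact Function.update_of_ne (by omega) _ _
          rw [h3 _ (fun i h h' => by rw [Function.update_of_ne (by omega), hy i h h']) i hi, hb]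
          have hc : compareBit (treeInput T L (k + 1)) L (k + 1) y =
              if k + 1 ≤ bitLevel T L y then 1 else 0 := by
            have := compareBit_spec (m := T.leftmost L (k + 1)) (L := L) (j := k + 1) (y := y)
              (PacketTree.leftmost_le hL hT hk) hk fun i h h' => hy i h (by omega)
            rw [show treeInput T L (k + 1) = (T.leftmost L (k + 1)).testBit from rfl, this]
            simp only [PacketTree.leftmost_le_iff hL hT hm (val_lt L y) hk]
            rfl
          rw [hc]
          by_cases h : i = k
          · subst h
            rw [show L + (i + 1) - 1 = L + i by omega, Function.update_self]
            simp
          · rw [Function.update_of_ne (by omega)]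
            simp only [show i < k + 1 ↔ i < k by omega]
  obtain ⟨f, h1, h2, h3⟩ := key L le_rfl
  refine ⟨f, h1, h2, fun y hy i hi => ?_⟩
  rw [h3 y hy i hi]
  simp [hi]

theorem fin_two_add_eq_zero (a b : Fin 2) : a + b = 0 ↔ a = b := by
  revert a b; decide

theorem fin_two_add_eq_right (a b : Fin 2) : a + b = b ↔ a = 0 := by
  revert a b; decide

theorem helperBits_iff_split {T : PacketTree} {L : ℕ} (y : ℕ → Fin 2) :
    HelperBits T L (3 * L + 1) y ↔ (∀ i, 2 * L ≤ i → i < 3 * L + 1 → y i = 0) ∧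
      ∀ i < L, y (L + i) = if i + 1 ≤ bitLevel T L y then 1 else 0 := by
  constructor
  · intro h
    exact ⟨fun i h1 h2 => by rw [h i (by omega) h2, if_neg (by omega)],
      fun i hi => helperBits_apply h hi (by omega)⟩
  · rintro ⟨h1, h2⟩ i hi hi'
    by_cases h : i < 2 * L
    · obtain ⟨k, rfl⟩ := Nat.exists_eq_add_of_le hi
      rw [h2 k (by omega)]
      congr 1
      rw [eq_iff_iff]; omega
    · rw [h1 i (by omega) hi', if_neg (by omega)]

theorem zeroBits_iff_split {L : ℕ} (y : ℕ → Fin 2) :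
    ZeroBits L (3 * L + 1) y ↔ (∀ i, 2 * L ≤ i → i < 3 * L + 1 → y i = 0) ∧
      ∀ i < L, y (L + i) = 0 := by
  constructor
  · intro h
    exact ⟨fun i h1 h2 => h i (by omega) h2, fun i hi => h _ (by omega) (by omega)⟩
  · rintro ⟨h1, h2⟩ i hi hi'
    by_cases h : i < 2 * L
    · obtain ⟨k, rfl⟩ := Nat.exists_eq_add_of_le hi
      exact h2 k (by omega)
    · exact h1 i (by omega) hi'

theorem restrict_apply_congr {S S' : (ℕ → Fin 2) → Prop} {ψ : (ℕ → Fin 2) → ℂ} {y z : ℕ → Fin 2}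
    (h : S y ↔ S' z) (e : ψ y = ψ z) : restrict S ψ y = restrict S' ψ z := by
  unfold restrict
  by_cases hz : S' z
  · rw [if_pos hz, if_pos (h.2 hz), e]
  · rw [if_neg hz, if_neg fun hy => hz (h.1 hy)]

/-- Adding the same data-dependent bits twice modulo 2 gives zero, so one circuit both computes and
uncomputes them. -/
theorem helperCircuit_restrict {T : PacketTree} {L : ℕ} (hL : 1 ≤ L) (hT : T.Admissible L)
    (hm : T.Monotonic L) {ψ : (ℕ → Fin 2) → ℂ} (hψ : ∀ y z, (∀ i < L, y i = z i) → ψ y = ψ z) :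
    runCircuit (helperCircuit (treeInput T L) L) (restrict (ZeroBits L (3 * L + 1)) ψ) =
        restrict (HelperBits T L (3 * L + 1)) ψ ∧
      runCircuit (helperCircuit (treeInput T L) L) (restrict (HelperBits T L (3 * L + 1)) ψ) =
        restrict (ZeroBits L (3 * L + 1)) ψ := by
  obtain ⟨f, h1, h2, h3⟩ := pulls_helperCircuit hL hT hm
  have hw : ∀ y, (∀ i, 2 * L ≤ i → i < 3 * L + 1 → f y i = 0) ↔
      ∀ i, 2 * L ≤ i → i < 3 * L + 1 → y i = 0 := by
    intro y
    refine forall_congr' fun i => forall_congr' fun h => ?_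
    rw [h2 y i (Or.inr h)]
  have hb : ∀ y, bitLevel T L (f y) = bitLevel T L y := by
    intro y
    unfold bitLevel
    rw [val_congr fun i hi => h2 y i (Or.inl hi)]
  have hp : ∀ y, ψ (f y) = ψ y := fun y => hψ _ _ fun i hi => h2 y i (Or.inl hi)
  rw [h1, h1]
  constructor
  · funext y
    have : ZeroBits L (3 * L + 1) (f y) ↔ HelperBits T L (3 * L + 1) y := by
      rw [helperBits_iff_split, zeroBits_iff_split, hw]
      refine and_congr_right fun h => forall_congr' fun i => forall_congr' fun hi => ?_
      rw [h3 y (fun i h' => h i h'.le) i hi, fin_two_add_eq_zero]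
    exact restrict_apply_congr this (hp y)
  · funext y
    have : HelperBits T L (3 * L + 1) (f y) ↔ ZeroBits L (3 * L + 1) y := by
      rw [helperBits_iff_split, zeroBits_iff_split, hw, hb]
      refine and_congr_right fun h => forall_congr' fun i => forall_congr' fun hi => ?_
      rw [h3 y (fun i h' => h i h'.le) i hi, fin_two_add_eq_right]
    exact restrict_apply_congr this (hp y)

/-! ### From natural numbers to finitely many qubits -/

/-- The gate acts on different qubits with labels less than `n`. -/
def Gate.Valid (n : ℕ) : Gate ℕ → Prop
  | .single _ q => q < n
  | .ctrl _ c t => c < n ∧ t < n ∧ c ≠ t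
  | .swap a b => a < n ∧ b < n ∧ a ≠ b

theorem gate1_map_id (u : Gate1) : u.map id = u := by cases u <;> rfl

theorem exists_fin_gate {n : ℕ} {g : Gate ℕ} (hg : g.Valid n) :
    ∃ g' : Gate (Fin n), g'.map Fin.val id = g ∧ g'.WellFormed := by
  cases g with
  | single u q => exact ⟨.single u ⟨q, hg⟩, by simp [Gate.map, gate1_map_id], trivial⟩
  | ctrl u c t =>
      exact ⟨.ctrl u ⟨c, hg.1⟩ ⟨t, hg.2.1⟩, by simp [Gate.map, gate1_map_id],
        fun h => hg.2.2 (congrArg Fin.val h)⟩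
  | swap a b =>
      exact ⟨.swap ⟨a, hg.1⟩ ⟨b, hg.2.1⟩, rfl, fun h => hg.2.2 (congrArg Fin.val h)⟩

theorem exists_fin_circuit {n : ℕ} (c : List (Gate ℕ)) (hc : ∀ g ∈ c, g.Valid n) :
    ∃ c' : List (Gate (Fin n)), c'.map (Gate.map Fin.val id) = c ∧ ∀ g ∈ c', g.WellFormed := by
  induction c with
  | nil => exact ⟨[], rfl, by simp⟩
  | cons g c ih =>
      obtain ⟨g', h1, h2⟩ := exists_fin_gate (hc g (by simp))
      obtain ⟨c', h3, h4⟩ := ih fun g hg => hc g (by simp [hg])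
      exact ⟨g' :: c', by simp [h1, h3], by simpa using ⟨h2, h4⟩⟩

/-- The first `n` bits. -/
def firstBits (n : ℕ) (y : ℕ → Fin 2) : Fin n → Fin 2 := fun i => y i

theorem firstBits_update {n : ℕ} (y : ℕ → Fin 2) (q : Fin n) (b : Fin 2) :
    firstBits n (Function.update y q b) = Function.update (firstBits n y) q b := by
  funext i
  simp [firstBits, Function.update_apply, Fin.ext_iff]

theorem apply_map_val {n : ℕ} (g : Gate (Fin n)) (ψ : (Fin n → Fin 2) → ℂ) :
    (g.map Fin.val id).apply (fun y => ψ (firstBits n y)) = fun y => g.apply ψ (firstBits n y) := by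
  funext y
  cases g with
  | single u q => simp only [Gate.map, Gate.apply, applyAt, gate1_map_id, firstBits_update]; rfl
  | ctrl u c t => simp only [Gate.map, Gate.apply, applyAt, gate1_map_id, firstBits_update]; rfl
  | swap a b =>
      simp only [Gate.map, Gate.apply]
      congr 1
      funext i
      simp only [firstBits, Function.comp, Equiv.swap_apply_def, Fin.ext_iff]
      split_ifs <;> rfl

theorem runCircuit_map_val {n : ℕ} (c : List (Gate (Fin n))) (ψ : (Fin n → Fin 2) → ℂ) :
    runCircuit (c.map (Gate.map Fin.val id)) (fun y => ψ (firstBits n y)) =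
      fun y => runCircuit c ψ (firstBits n y) := by
  induction c generalizing ψ with
  | nil => rfl
  | cons g c ih => rw [List.map_cons, runCircuit_cons, runCircuit_cons, apply_map_val, ih]

/-- The number written in the `L` lowest bits. -/
def num (L : ℕ) (y : ℕ → Fin 2) : Fin (2 ^ L) := ⟨val L y, val_lt L y⟩

theorem dataPart_firstBits {L a : ℕ} (y : ℕ → Fin 2) :
    dataPart (L := L) (a := a) (firstBits (L + a) y) = num L y := by
  apply Fin.ext
  rw [dataPart, finFunctionFinEquiv_apply]
  exact ((val_eq_sum L y).trans (Finset.sum_range _)).symm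

theorem withAncilla_zero {L a : ℕ} (ψ : Fin (2 ^ L) → ℂ) :
    (fun y => withAncilla (zeroAncilla L a) ψ (firstBits (L + a) y)) =
      restrict (ZeroBits L (L + a)) fun y => ψ (num L y) := by
  funext y
  have : ancillaPart (firstBits (L + a) y) = zeroAncilla L a (num L y) ↔ ZeroBits L (L + a) y := by
    rw [funext_iff]
    constructor
    · intro h i h1 h2
      have := h ⟨i - L, by omega⟩
      simpa [ancillaPart, firstBits, zeroAncilla, Nat.add_sub_cancel' h1] using this
    · intro h i
      exact h _ (by simp) (by simp)
  unfold withAncilla restrict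
  rw [dataPart_firstBits]
  split_ifs with h1 h2 h2
  · rfl
  · exact absurd (this.1 h1) h2
  · exact absurd (this.2 h2) h1
  · rfl

theorem withAncilla_helper {T : PacketTree} {L a : ℕ} (hL : 1 ≤ L) (hT : T.Admissible L)
    (ψ : Fin (2 ^ L) → ℂ) :
    (fun y => withAncilla (helperAncilla T L a) ψ (firstBits (L + a) y)) =
      restrict (HelperBits T L (L + a)) fun y => ψ (num L y) := by
  funext y
  have h0 : ∀ i : Fin a, helperAncilla T L a (num L y) i =
      if L + (i : ℕ) < 2 * L ∧ L + (i : ℕ) + 1 ≤ L + bitLevel T L y then 1 else 0 := by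
    intro i
    unfold helperAncilla
    have : T.helper L ((i : ℕ) + 1) (num L y) ↔ (i : ℕ) + 1 ≤ bitLevel T L y :=
      PacketTree.helper_iff hL hT (val_lt L y)
    simp only [this]
    congr 1
    rw [eq_iff_iff]; omega
  have : ancillaPart (firstBits (L + a) y) = helperAncilla T L a (num L y) ↔
      HelperBits T L (L + a) y := by
    rw [funext_iff]
    simp only [h0]
    constructor
    · intro h i h1 h2
      have := h ⟨i - L, by omega⟩
      simpa [ancillaPart, firstBits, Nat.add_sub_cancel' h1] using this
    · intro h i
      exact h _ (by simp) (by simp)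
  unfold withAncilla restrict
  rw [dataPart_firstBits]
  split_ifs with h1 h2 h2
  · rfl
  · exact absurd (this.1 h1) h2
  · exact absurd (this.2 h2) h1
  · rfl

theorem firstBits_surjective (n : ℕ) : Function.Surjective (firstBits n) := by
  intro x
  refine ⟨fun i => if h : i < n then x ⟨i, h⟩ else 0, funext fun i => ?_⟩
  simp [firstBits]

/-- Every state of `L + a` qubits is seen as a function of infinite bit strings that ignores the
later bits. As every finite string is an initial segment, equations between such functions descend.
-/
theorem realizes_of_nat {L a : ℕ} {c' : List (Gate (Fin (L + a)))} {c : List (Gate ℕ)}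
    (hc : c'.map (Gate.map Fin.val id) = c) {s s' : Fin (2 ^ L) → Fin a → Fin 2}
    {S S' : (ℕ → Fin 2) → Prop} {F : (Fin (2 ^ L) → ℂ) → (Fin (2 ^ L) → ℂ)}
    (hs : ∀ ψ, (fun y => withAncilla s ψ (firstBits (L + a) y)) = restrict S fun y => ψ (num L y))
    (hs' : ∀ ψ, (fun y => withAncilla s' ψ (firstBits (L + a) y)) =
      restrict S' fun y => ψ (num L y))
    (h : ∀ ψ, runCircuit c (restrict S fun y => ψ (num L y)) =
      restrict S' fun y => F ψ (num L y)) : Realizes c' s s' F := by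
  intro ψ
  funext x
  obtain ⟨y, rfl⟩ := firstBits_surjective _ x
  have := h ψ
  rw [← hs, ← hs', ← hc, runCircuit_map_val] at this
  exact congrFun this y

theorem Realizes.append {L a : ℕ} {c d : List (Gate (Fin (L + a)))}
    {s s' s'' : Fin (2 ^ L) → Fin a → Fin 2} {F G : (Fin (2 ^ L) → ℂ) → (Fin (2 ^ L) → ℂ)}
    (hc : Realizes c s s' F) (hd : Realizes d s' s'' G) :
    Realizes (c ++ d) s s'' fun ψ => G (F ψ) := by
  intro ψ
  rw [runCircuit_append, hc, hd]

/-! ### The five parts of the circuit -/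

theorem num_setLow {L j x : ℕ} (hj : j ≤ L) (hx : x < 2 ^ j) (y : ℕ → Fin 2) :
    num L (setLow j x y) = blockIdx L j (num L y) ⟨x, hx⟩ := by
  apply Fin.ext
  rw [blockIdx_val hj]
  show val L (setLow j x y) = val L y / 2 ^ j * 2 ^ j + x
  rw [← Nat.div_add_mod (val L (setLow j x y)) (2 ^ j), val_mod hj, val_setLow hx,
    val_div_congr hj (fun i hi _ => setLow_apply_of_le hi x y), mul_comm]

theorem inv_sqrt_two_pow (l : ℕ) :
    (√2 : ℂ)⁻¹ ^ l = (((√((2 ^ l : ℕ) : ℝ))⁻¹ : ℝ) : ℂ) := by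
  have : √((2 ^ l : ℕ) : ℝ) = √2 ^ l := by
    rw [Nat.cast_pow, Nat.cast_ofNat, Real.sqrt_eq_iff_mul_self_eq (by positivity) (by positivity),
      ← mul_pow, Real.mul_self_sqrt (by norm_num)]
  rw [this]
  push_cast
  rw [inv_pow]

theorem low_num {L j : ℕ} (hj : j ≤ L) (y : ℕ → Fin 2) : (low j (num L y) : ℕ) = val j y :=
  val_mod hj y

theorem qft_entry (l : ℕ) (k x : Fin (2 ^ l)) :
    qft (2 ^ l) k x = (√2 : ℂ)⁻¹ ^ l * expi true (((x : ℕ) : ℂ) * (k : ℕ) / 2 ^ l) := by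
  rw [inv_sqrt_two_pow, qft, Matrix.of_apply, expi]
  congr 2
  push_cast
  simp only [if_true]
  ring

theorem qft_conj_entry (l : ℕ) (k x : Fin (2 ^ l)) :
    star (qft (2 ^ l) k x) = (√2 : ℂ)⁻¹ ^ l * expi false (((x : ℕ) : ℂ) * (k : ℕ) / 2 ^ l) := by
  rw [qft_entry, star_mul', expi, expi, Complex.star_def, ← Complex.exp_conj]
  congr 1
  · simp
  · congr 1
    simp only [map_mul, map_ofNat, map_div₀, map_pow, Complex.conj_I, Complex.conj_ofReal,
      Complex.conj_natCast, if_true, Bool.false_eq_true, if_false]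
    ring

theorem qftSum_eq_blockApply {L l : ℕ} (hl : l ≤ L) (ψ : Fin (2 ^ L) → ℂ) (y : ℕ → Fin 2) :
    (√2 : ℂ)⁻¹ ^ l * ∑ x ∈ Finset.range (2 ^ l),
        expi true ((x : ℂ) * val l y / 2 ^ l) * ψ (num L (setLow l x y)) =
      blockApply l (fun _ => qft (2 ^ l)) ψ (num L y) := by
  rw [Finset.sum_range, blockApply, Finset.mul_sum]
  refine Finset.sum_congr rfl fun x _ => ?_
  rw [num_setLow hl x.2, qft_entry, low_num hl, mul_assoc]

theorem fourierCircuit_controlledQFTs {T : PacketTree} {L : ℕ} (hL : 1 ≤ L) (hT : T.Admissible L)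
    {n : ℕ} (hn : 2 * L < n) (ψ : Fin (2 ^ L) → ℂ) :
    runCircuit (fourierCircuit true L) (restrict (HelperBits T L n) fun y => ψ (num L y)) =
      restrict (HelperBits T L n) fun y => (controlledQFTs T L *ᵥ ψ) (num L y) := by
  rw [fourierCircuit_restrict hL hT true hn]
  refine restrict_congr fun y _ => ?_
  rw [controlledQFTs_eq hL hT, blockSum_mulVec hL hT]
  exact qftSum_eq_blockApply (bitLevel_le y) ψ y

theorem num_encBits {L j : ℕ} (hj : 1 ≤ j) (hjL : j ≤ L) (y : ℕ → Fin 2) (b : Fin 2) :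
    num L (encBits j b y) = blockIdx L j (num L y) ⟨val j (encBits j b y), val_lt _ _⟩ := by
  rw [← num_setLow hjL]
  apply Fin.ext
  show val L _ = val L _
  rw [← Nat.div_add_mod (val L (encBits j b y)) (2 ^ j),
    ← Nat.div_add_mod (val L (setLow _ _ y)) (2 ^ j), val_mod hjL, val_mod hjL,
    val_setLow (val_lt _ _),
    val_div_congr hjL (fun i hi _ => setLow_apply_of_le hi _ y),
    val_div_congr hjL (fun i hi _ => encBits_of_le b hj hi y)]

theorem val_injOn {n : ℕ} {y z : ℕ → Fin 2} (h : val n y = val n z) : ∀ i < n, y i = z i := by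
  induction n with
  | zero => intro i hi; omega
  | succ n ih =>
      simp only [val] at h
      have h1 := val_lt n y
      have h2 := val_lt n z
      have h3 : val n y = val n z ∧ y n = z n := by
        rcases fin_two_cases (y n) with hy | hy <;> rcases fin_two_cases (z n) with hz | hz <;>
          simp [hy, hz] at h ⊢ <;> omega
      intro i hi
      rcases Nat.lt_succ_iff_lt_or_eq.1 hi with h | rfl
      · exact ih h3.1 i h
      · exact h3.2

/-- A right inverse is already known, so it suffices that decoding is injective: bit `j - 1` of the
result determines bit `0`, and then all others follow. -/
theorem encBits_decBits {j : ℕ} (hj : 1 ≤ j) (b : Fin 2) (y : ℕ → Fin 2) :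
    encBits j b (decBits j b y) = y := by
  have inj : Function.Injective (decBits j b) := by
    intro u v h
    have h0 : u 0 = v 0 := by
      have := congrFun h (j - 1)
      simp only [decBits, show j - 1 + 1 = j by omega, lt_irrefl, if_false, if_true] at this
      exact add_right_cancel this
    funext i
    rcases Nat.lt_or_ge i j with hi | hi
    · cases i with
      | zero => exact h0
      | succ i =>
          have := congrFun h i
          simp only [decBits, hi, if_true, h0] at this
          exact add_right_cancel this
    · have := congrFun h i
      simpa only [decBits, show ¬ (i + 1 < j) by omega, show ¬ (i + 1 = j) by omega, if_false]
        using this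
  exact inj (decBits_encBits hj b _)

/-- Row `r` of the permutation matrix has its only nonzero entry at the column that decodes to `r`,
which is the encoding of `r`. -/
theorem decode_blockApply {L j : ℕ} (hj : 1 ≤ j) (hjL : j ≤ L) (ψ : Fin (2 ^ L) → ℂ)
    (y : ℕ → Fin 2) :
    blockApply j (fun m => retDecodeMatrix j m) ψ (num L y) =
      ψ (num L (encBits j (if j < L then y j else 0) y)) := by
  set b : Fin 2 := if j < L then y j else 0 with hb
  have hm : ((num L y : ℕ) / 2 ^ j) % 2 = b := by
    show (val L y / 2 ^ j) % 2 = b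
    rw [hb]
    split_ifs with h
    · have := val_mod (show 1 ≤ L - j by omega) fun i => y (j + i)
      rw [pow_one] at this
      rw [val_div hjL, this]
      simp [val]
    · rw [show j = L by omega, Nat.div_eq_of_lt (val_lt _ _)]
      rfl
  rw [num_encBits hj hjL, blockApply, Finset.sum_eq_single ⟨val j (encBits j b y), val_lt _ _⟩]
  · rw [retDecodeMatrix, Matrix.of_apply, low_num hjL, if_pos, one_mul]
    rw [retDecode_val hj hm, decBits_encBits hj]
  · intro c _ hc
    rw [retDecodeMatrix, Matrix.of_apply, low_num hjL, if_neg, zero_mul]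
    intro h
    apply hc
    have e : (c : ℕ) = val j (setLow j c y) := (val_setLow c.2 y).symm
    rw [e, retDecode_val hj hm] at h
    apply Fin.ext
    rw [e]
    show _ = val j (encBits j b y)
    refine val_congr fun i hi => ?_
    -- The equality of values determines the bits below `j`; above, nothing changes. Hence the whole
    -- strings agree and the encoding can be applied.
    have hy : y = decBits j b (setLow j c y) := by
      funext i
      rcases Nat.lt_or_ge i j with hi | hi
      · exact val_injOn h i hi
      · rw [decBits, if_neg (by omega), if_neg (by omega), setLow_apply_of_le hi]
    conv_rhs => rw [hy, encBits_decBits hj]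
  · simp

theorem decodeCircuit_controlledDecodings {T : PacketTree} {L : ℕ} (hL : 1 ≤ L)
    (hT : T.Admissible L) {n : ℕ} (hn : 2 * L < n) (ψ : Fin (2 ^ L) → ℂ) :
    runCircuit (decodeCircuit L) (restrict (HelperBits T L n) fun y => ψ (num L y)) =
      restrict (HelperBits T L n) fun y => (controlledDecodings T L *ᵥ ψ) (num L y) := by
  rw [decodeCircuit_restrict hL hT hn]
  refine restrict_congr fun y _ => ?_
  rw [controlledDecodings_eq hL hT, blockSum_mulVec hL hT]
  exact (decode_blockApply (bitLevel_pos hL hT y) (bitLevel_le y) ψ y).symm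

theorem flips_restrict {L n : ℕ} (ψ : Fin (2 ^ L) → ℂ) :
    runCircuit (flips L) (restrict (HelperBits .leaf L n) fun y => ψ (num L y)) =
        restrict (ZeroBits L n) (fun y => ψ (num L y)) ∧
      runCircuit (flips L) (restrict (ZeroBits L n) fun y => ψ (num L y)) =
        restrict (HelperBits .leaf L n) fun y => ψ (num L y) := by
  set f : (ℕ → Fin 2) → (ℕ → Fin 2) := fun y i => if L ≤ i ∧ i < 2 * L then y i + 1 else y i with hf
  have hψ : ∀ y, ψ (num L (f y)) = ψ (num L y) := by
    intro y
    congr 1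
    apply Fin.ext
    exact val_congr fun i hi => if_neg (by omega)
  have hff : ∀ y, f (f y) = y := by
    intro y
    funext i
    simp only [hf]
    split_ifs
    · exact fin_two_add_add _ _
    · rfl
  rw [pulls_flips, pulls_flips]
  constructor
  · funext y
    exact restrict_apply_congr (flips_iff y) (hψ y)
  · funext y
    refine restrict_apply_congr (y := f y) ?_ (hψ y)
    rw [← flips_iff]
    show HelperBits .leaf L n (f (f y)) ↔ _
    rw [hff]

theorem encodeCircuit_encodedFourier {L : ℕ} (hL : 1 ≤ L) {n : ℕ} (hn : 2 * L < n)
    (ψ : Fin (2 ^ L) → ℂ) :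
    runCircuit (encodeCircuit L) (restrict (ZeroBits L n) fun y => ψ (num L y)) =
      restrict (ZeroBits L n) fun y => encodedFourier L ψ (num L y) := by
  have hT : PacketTree.leaf.Admissible L := trivial
  have hlev : ∀ y, bitLevel .leaf L y = L := fun y => rfl
  rw [encodeCircuit, runCircuit_append, (flips_restrict ψ).2, runCircuit_append,
    fourierCircuit_restrict hL hT false hn, runCircuit_append]
  have : (restrict (HelperBits .leaf L n) fun y => (√2 : ℂ)⁻¹ ^ bitLevel .leaf L y *
      ∑ x ∈ Finset.range (2 ^ bitLevel .leaf L y),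
        expi false ((x : ℂ) * val (bitLevel .leaf L y) y / 2 ^ bitLevel .leaf L y) *
          ψ (num L (setLow (bitLevel .leaf L y) x y))) =
      restrict (HelperBits .leaf L n) fun y => ((qft (2 ^ L))ᴴ *ᵥ ψ) (num L y) := by
    refine restrict_congr fun y _ => ?_
    rw [hlev, Matrix.mulVec, dotProduct, Finset.sum_range, Finset.mul_sum]
    refine Finset.sum_congr rfl fun x _ => ?_
    have hx : num L (setLow L x y) = x := Fin.ext (val_setLow x.2 y)
    rw [hx, Matrix.conjTranspose_apply, qft_conj_entry, ← mul_assoc, mul_comm ((x : ℕ) : ℂ)]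
    rfl
  rw [this, encodeLevel_restrict hL hn]
  have h2 : (restrict (HelperBits .leaf L n) fun y => ((qft (2 ^ L))ᴴ *ᵥ ψ)
      (num L (decBits L 0 y))) =
      restrict (HelperBits .leaf L n) fun y => encodedFourier L ψ (num L y) := by
    refine restrict_congr fun y _ => ?_
    unfold encodedFourier fhat
    congr 1
    apply Fin.ext
    show val L (decBits L 0 y) = _
    -- On the whole register the frequency modulo `2^L` is the retaining decoding of the block with
    -- index `0`.
    rw [← retDecode_val (m := 0) hL rfl, lowInt, low]
    have h0 : (decode (num L y) % 2 ^ L).toNat = retDecode (val L y) L 0 := by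
      simp [retDecode, num]
    simp only [h0]
    exact (Nat.mod_eq_of_lt (retDecode_lt _ _ _)).symm
  rw [h2, (flips_restrict _).1]

/-! ### Reasoning about programs -/

namespace Prog

/-- Programs without loops. -/
def loopFree : Prog → Bool
  | .seq p q => p.loopFree && q.loopFree
  | .branch _ _ p q => p.loopFree && q.loopFree
  | .loop _ _ _ => false
  | _ => true

/-- A bound for the number of steps of a program without loops. -/
def cost : Prog → ℕ
  | .seq p q => p.cost + q.cost
  | .branch _ _ p q => p.cost + q.cost + 1
  | _ => 1

/-- Memory and output of a program without loops. -/
def eval (inp : ℕ → ℕ → Bool) : Prog → (ℕ → ℕ) → (ℕ → ℕ) × List (Gate ℕ)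
  | .const d v, m => (Function.update m d v, [])
  | .copy d s, m => (Function.update m d (m s), [])
  | .incr d, m => (Function.update m d (m d + 1), [])
  | .decr d, m => (Function.update m d (m d - 1), [])
  | .load d s, m => (Function.update m d (m (m s)), [])
  | .store d s, m => (Function.update m (m d) (m s), [])
  | .read d r c, m => (Function.update m d (inp (m r) (m c)).toNat, [])
  | .print g, m => (m, [g.map m m])
  | .seq p q, m => ((q.eval inp (p.eval inp m).1).1, (p.eval inp m).2 ++
      (q.eval inp (p.eval inp m).1).2)
  | .branch x y p q, m => if m x < m y then p.eval inp m else q.eval inp m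
  | .loop _ _ _, m => (m, [])

theorem exec_eval (inp : ℕ → ℕ → Bool) (p : Prog) (hp : p.loopFree = true) (m : ℕ → ℕ)
    (out : List (Gate ℕ)) :
    ∃ t ≤ p.cost, Exec inp p ⟨m, out⟩ ⟨(p.eval inp m).1, out ++ (p.eval inp m).2⟩ t := by
  induction p generalizing m out with
  | const d v => exact ⟨1, le_rfl, by simpa [eval] using Exec.const d v ⟨m, out⟩⟩
  | copy d s => exact ⟨1, le_rfl, by simpa [eval] using Exec.copy d s ⟨m, out⟩⟩
  | incr d => exact ⟨1, le_rfl, by simpa [eval] using Exec.incr d ⟨m, out⟩⟩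
  | decr d => exact ⟨1, le_rfl, by simpa [eval] using Exec.decr d ⟨m, out⟩⟩
  | load d s => exact ⟨1, le_rfl, by simpa [eval] using Exec.load d s ⟨m, out⟩⟩
  | store d s => exact ⟨1, le_rfl, by simpa [eval] using Exec.store d s ⟨m, out⟩⟩
  | read d r c => exact ⟨1, le_rfl, by simpa [eval] using Exec.read d r c ⟨m, out⟩⟩
  | print g => exact ⟨1, le_rfl, Exec.print g ⟨m, out⟩⟩
  | seq p q ihp ihq =>
      simp only [loopFree, Bool.and_eq_true] at hp
      obtain ⟨t1, h1, e1⟩ := ihp hp.1 m out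
      obtain ⟨t2, h2, e2⟩ := ihq hp.2 (p.eval inp m).1 (out ++ (p.eval inp m).2)
      rw [List.append_assoc] at e2
      exact ⟨t1 + t2, Nat.add_le_add h1 h2, e1.seq e2⟩
  | branch x y p q ihp ihq =>
      simp only [loopFree, Bool.and_eq_true] at hp
      by_cases h : m x < m y
      · obtain ⟨t, h1, e1⟩ := ihp hp.1 m out
        refine ⟨t + 1, by simp only [cost]; omega, ?_⟩
        simp only [eval, h, if_true]
        exact Exec.branch_true (σ := ⟨m, out⟩) h e1
      · obtain ⟨t, h1, e1⟩ := ihq hp.2 m out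
        refine ⟨t + 1, by simp only [cost]; omega, ?_⟩
        simp only [eval, h, if_false]
        exact Exec.branch_false (σ := ⟨m, out⟩) h e1
  | loop x y p _ => simp [loopFree] at hp

/-- Prints all gates of a list. -/
def printAll : List (Gate ℕ) → Prog
  | [] => .copy 0 0
  | g :: c => .seq (.print g) (printAll c)

theorem eval_printAll (inp : ℕ → ℕ → Bool) (c : List (Gate ℕ)) (m : ℕ → ℕ) :
    (printAll c).eval inp m = (m, c.map (Gate.map m m)) := by
  induction c with
  | nil => simp [printAll, eval]
  | cons g c ih => simp [printAll, eval, ih]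

/-- Executes the programs of a list one after the other. -/
def block : List Prog → Prog
  | [] => .copy 0 0
  | p :: l => .seq p (block l)

end Prog

/-- Started with a memory that satisfies `P`, the program prints `o` and stops after at most `t`
steps with a memory that satisfies `Q`. -/
def Prints (inp : ℕ → ℕ → Bool) (P : (ℕ → ℕ) → Prop) (p : Prog) (o : List (Gate ℕ)) (t : ℕ)
    (Q : (ℕ → ℕ) → Prop) : Prop :=
  ∀ m, P m → ∀ out, ∃ m' s, Exec inp p ⟨m, out⟩ ⟨m', out ++ o⟩ s ∧ s ≤ t ∧ Q m'

section Prints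
variable {inp : ℕ → ℕ → Bool} {P Q R : (ℕ → ℕ) → Prop} {p q : Prog} {o o' : List (Gate ℕ)}
  {t t' : ℕ}

theorem Prints.seq (hp : Prints inp P p o t R) (hq : Prints inp R q o' t' Q) :
    Prints inp P (.seq p q) (o ++ o') (t + t') Q := by
  intro m hm out
  obtain ⟨m1, s1, e1, h1, hm1⟩ := hp m hm out
  obtain ⟨m2, s2, e2, h2, hm2⟩ := hq m1 hm1 (out ++ o)
  rw [List.append_assoc] at e2
  exact ⟨m2, s1 + s2, e1.seq e2, Nat.add_le_add h1 h2, hm2⟩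

theorem Prints.mono (hp : Prints inp P p o t Q) (ht : t ≤ t') (ho : o = o') :
    Prints inp P p o' t' Q := by
  intro m hm out
  obtain ⟨m1, s1, e1, h1, hm1⟩ := hp m hm out
  exact ⟨m1, s1, ho ▸ e1, h1.trans ht, hm1⟩

theorem prints_eval (hp : p.loopFree = true) (ht : p.cost ≤ t)
    (h : ∀ m, P m → (p.eval inp m).2 = o ∧ Q (p.eval inp m).1) : Prints inp P p o t Q := by
  intro m hm out
  obtain ⟨s, hs, e⟩ := Prog.exec_eval inp p hp m out
  rw [(h m hm).1] at e
  exact ⟨_, s, e, hs.trans ht, (h m hm).2⟩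

/-- An empty block is the idle instruction `copy 0 0`, which accounts for the one step. -/
theorem prints_nil (h : ∀ m, P m → Q m) : Prints inp P (.block []) [] 1 Q :=
  prints_eval rfl le_rfl fun m hm => by
    simp only [Prog.block, Prog.eval, Function.update_eq_self, true_and]; exact h m hm

theorem prints_cons {l : List Prog} (hp : Prints inp P p o t R)
    (hq : Prints inp R (.block l) o' t' Q) :
    Prints inp P (.block (p :: l)) (o ++ o') (t + t') Q := hp.seq hq

/-- The invariant is indexed by the number of completed passes. Each pass costs one test, and the
final `+ 1` is the failing test. -/
theorem prints_loop {x y : ℕ} (I : ℕ → (ℕ → ℕ) → Prop) (o : ℕ → List (Gate ℕ)) (n t : ℕ)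
    (hI : ∀ i < n, Prints inp (I i) p (o i) t (I (i + 1)))
    (hlt : ∀ i < n, ∀ m, I i m → m x < m y) (hn : ∀ m, I n m → ¬ m x < m y) :
    Prints inp (I 0) (.loop x y p) ((List.range n).flatMap o) (n * (t + 1) + 1) (I n) := by
  induction n generalizing I o with
  | zero =>
      intro m hm out
      exact ⟨m, 1, by simpa using Exec.loop_false (σ := ⟨m, out⟩) (hn m hm), by omega, hm⟩
  | succ n ih =>
      intro m hm out
      obtain ⟨m1, s1, e1, h1, hm1⟩ := hI 0 (by omega) m hm out
      obtain ⟨m2, s2, e2, h2, hm2⟩ := ih (fun i => I (i + 1)) (fun i => o (i + 1))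
        (fun i hi => hI (i + 1) (by omega)) (fun i hi => hlt (i + 1) (by omega)) hn m1 hm1 (out ++
            o 0)
      refine ⟨m2, s1 + s2 + 1, ?_, by nlinarith, hm2⟩
      rw [flatMap_range_succ', ← List.append_assoc]
      exact Exec.loop_true (σ := ⟨m, out⟩) (hlt 0 (by omega) m hm) e1 e2

end Prints

/-- A step prints at most one gate, so any time bound also bounds the size of the circuit. -/
theorem Exec.length_le {inp : ℕ → ℕ → Bool} {p : Prog} {σ τ : Conf} {t : ℕ}
    (h : Exec inp p σ τ t) : τ.out.length ≤ σ.out.length + t := by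
  induction h <;> (try simp only [List.length_append, List.length_singleton] at *) <;> omega

/-- The cells `k, k + 1, …` hold the numbers of the list. -/
def RegsFrom : ℕ → List ℕ → (ℕ → ℕ) → Prop
  | _, [], _ => True
  | k, a :: l, m => m k = a ∧ RegsFrom (k + 1) l m

/-- The cells `0, 1, …` hold the numbers of the list. -/
abbrev Regs (l : List ℕ) (m : ℕ → ℕ) : Prop := RegsFrom 0 l m

/-- A gate list with memory addresses in place of labels serves as a template for printing. Its
phase parameter is also read from memory, which is why it is an argument of these circuits and why a
cell permanently holds `2`. -/
theorem map_ccx (f : ℕ → ℕ) (k a b t : ℕ) :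
    (ccx k a b t).map (Gate.map f f) = ccx (f k) (f a) (f b) (f t) := rfl

theorem map_cx (f : ℕ → ℕ) (a b : ℕ) : (cx a b).map f f = cx (f a) (f b) := rfl

theorem map_cswap (f : ℕ → ℕ) (k e a b : ℕ) :
    (cswap k e a b).map (Gate.map f f) = cswap (f k) (f e) (f a) (f b) := rfl

theorem map_ccphase (f : ℕ → ℕ) (s : Bool) (k a b t : ℕ) :
    (ccphase s k a b t).map (Gate.map f f) = ccphase s (f k) (f a) (f b) (f t) := by
  cases s <;> rfl

/-! ### Printing the circuit -/

open Prog

/-- Prints `crev 2 e n`, with `e` in cell `5` and `n` in cell `6`. -/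
def crevProg : Prog :=
  block [block [const 9 0, copy 10 6, decr 10],
    loop 9 10 (block [printAll (cswap 1 5 9 10), incr 9, decr 10])]

/-- The cells `0` to `4` hold constants used by all programs: `L`, the phase parameter `2`, zero, `2
* L` and `2 * L + 1`. The numbers `f` and `g` belong to the calling program and must survive. -/
theorem crevProg_prints (inp : ℕ → ℕ → Bool) {L e n f g : ℕ} (hn : n ≤ L) :
    Prints inp (Regs [L, 2, 0, 2 * L, 2 * L + 1, e, n, f, g]) crevProg (crev 2 e n) (20 * L + 10)
      (Regs [L, 2, 0, 2 * L, 2 * L + 1, e, n, f, g]) := by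
  refine Prints.mono (prints_cons (o := []) (t := 4)
    (R := Regs [L, 2, 0, 2 * L, 2 * L + 1, e, n, f, g, 0, n - 1]) ?_ (prints_cons (t :=
        n / 2 * 20 + 1)
      (prints_loop (fun i => Regs [L, 2, 0, 2 * L, 2 * L + 1, e, n, f, g, i, n - 1 - i])
        (fun i => cswap 2 e i (n - 1 - i)) (n / 2) 19 ?_ ?_ ?_) (prints_nil ?_))) ?_ ?_
  · refine prints_eval rfl (by decide) fun m hm => ?_
    simp [RegsFrom] at hm
    simp [RegsFrom, block, eval, hm]
  · intro i hi
    refine prints_eval rfl (by decide) fun m hm => ?_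
    simp [RegsFrom] at hm
    simp [RegsFrom, block, eval, hm, eval_printAll, map_cswap]
    omega
  · intro i hi m hm
    simp [RegsFrom] at hm
    simp [hm]
    omega
  · intro m hm
    simp [RegsFrom] at hm
    simp [hm]
    omega
  · intro m hm
    simp [RegsFrom] at hm
    simp [RegsFrom, hm]
  · omega
  · simp [crev]

/-- Prints `fan 2 e n n`, with `e` in cell `5` and `n` in cell `6`. -/
def fanProg : Prog :=
  block [const 9 0, loop 9 6 (block [printAll (ccx 1 5 6 9), incr 9])]

theorem fanProg_prints (inp : ℕ → ℕ → Bool) {L e n f g : ℕ} (hn : n ≤ L) :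
    Prints inp (Regs [L, 2, 0, 2 * L, 2 * L + 1, e, n, f, g]) fanProg (fan 2 e n n) (20 * L + 10)
      (Regs [L, 2, 0, 2 * L, 2 * L + 1, e, n, f, g]) := by
  refine Prints.mono (prints_cons (o := []) (t := 1)
    (R := Regs [L, 2, 0, 2 * L, 2 * L + 1, e, n, f, g, 0]) ?_ (prints_cons (t := n * 20 + 1)
      (prints_loop (fun i => Regs [L, 2, 0, 2 * L, 2 * L + 1, e, n, f, g, i])
        (fun i => ccx 2 e n i) n 19 ?_ ?_ ?_) (prints_nil ?_))) ?_ ?_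
  · refine prints_eval rfl (by decide) fun m hm => ?_
    simp [RegsFrom] at hm
    simp [RegsFrom, eval, hm]
  · intro i hi
    refine prints_eval rfl (by decide) fun m hm => ?_
    simp [RegsFrom] at hm
    simp [RegsFrom, block, eval, hm, eval_printAll, map_ccx]
  · intro i hi m hm
    simp [RegsFrom] at hm
    simp [hm, hi]
  · intro m hm
    simp [RegsFrom] at hm
    simp [hm]
  · intro m hm
    simp [RegsFrom] at hm
    simp [RegsFrom, hm]
  · omega
  · simp [fan]

/-- Prints the controlled reversals. -/
def reversalsProg : Prog :=
  block [block [copy 5 0, const 6 0, copy 7 0, incr 7, const 8 1],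
    loop 6 0 (block [block [print (cx 7 5), incr 6], crevProg,
      block [decr 6, print (cx 7 5), incr 5, incr 6, incr 7, incr 8]])]

theorem reversalsProg_prints (inp : ℕ → ℕ → Bool) {L : ℕ} :
    Prints inp (Regs [L, 2, 0, 2 * L, 2 * L + 1]) reversalsProg
      (levelBlocks (fun i => crev 2 (L + i) (i + 1)) L L) (20 * L ^ 2 + 40 * L + 20)
      (Regs [L, 2, 0, 2 * L, 2 * L + 1]) := by
  refine Prints.mono (prints_cons (o := []) (t := 6)
    -- The terms `+ 0` make this condition literally the loop invariant at index `0`.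
    (R := Regs [L, 2, 0, 2 * L, 2 * L + 1, L + 0, 0, L + 0 + 1, 0 + 1]) ?_
      (prints_cons (t := L * (20 * L + 10 + 20 + 1) + 1)
      (prints_loop (fun i => Regs [L, 2, 0, 2 * L, 2 * L + 1, L + i, i, L + i + 1, i + 1])
        (fun i => [cx (L + i + 1) (L + i)] ++ (crev 2 (L + i) (i + 1) ++ ([cx (L + i + 1) (L + i)]
            ++ [])))
        L (20 * L + 10 + 20) ?_ ?_ ?_) (prints_nil ?_))) ?_ ?_
  · refine prints_eval rfl (by decide) fun m hm => ?_
    simp [RegsFrom] at hm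
    simp [RegsFrom, block, eval, hm]
  · intro i hi
    refine Prints.mono (prints_cons (t := 3)
      (R := Regs [L, 2, 0, 2 * L, 2 * L + 1, L + i, i + 1, L + i + 1, i + 1]) ?_
      (prints_cons (crevProg_prints inp (by omega)) (prints_cons (t := 7)
          ?_ (prints_nil fun m hm => hm))))
      (by omega) rfl
    · refine prints_eval rfl (by decide) fun m hm => ?_
      simp [RegsFrom] at hm
      simp [RegsFrom, block, eval, hm, map_cx]
    · refine prints_eval rfl (by decide) fun m hm => ?_
      simp [RegsFrom] at hm
      simp [RegsFrom, block, eval, hm, map_cx]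
      omega
  · intro i hi m hm
    simp [RegsFrom] at hm
    simp [hm, hi]
  · intro m hm
    simp [RegsFrom] at hm
    simp [hm]
  · intro m hm
    simp [RegsFrom] at hm
    simp [RegsFrom, hm]
  · nlinarith
  · simp [levelBlocks, sandwich]

/-- Prints the controlled retaining decodings. -/
def decodeProg : Prog :=
  block [block [copy 5 0, const 6 0, copy 7 0, incr 7, const 8 1],
    loop 6 0 (block [block [print (cx 7 5), incr 6], crevProg, decr 6, crevProg, fanProg,
      block [branch 8 0 (printAll (ccx 1 5 8 6)) (block []),
        print (cx 7 5), incr 5, incr 6, incr 7, incr 8]])]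

theorem decodeProg_prints (inp : ℕ → ℕ → Bool) {L : ℕ} :
    Prints inp (Regs [L, 2, 0, 2 * L, 2 * L + 1]) decodeProg
      (decodeCircuit L) (60 * L ^ 2 + 80 * L + 20) (Regs [L, 2, 0, 2 * L, 2 * L + 1]) := by
  refine Prints.mono (prints_cons (o := []) (t := 6)
    (R := Regs [L, 2, 0, 2 * L, 2 * L + 1, L + 0, 0, L + 0 + 1, 0 + 1]) ?_
      (prints_cons (t := L * (60 * L + 60 + 1) + 1)
      (prints_loop (fun i => Regs [L, 2, 0, 2 * L, 2 * L + 1, L + i, i, L + i + 1, i + 1])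
        (fun i => [cx (L + i + 1) (L + i)] ++ (crev 2 (L + i) (i + 1) ++ ([] ++ (crev 2 (L + i) i ++
          (fan 2 (L + i) i i ++ (((if i + 1 < L then ccx 2 (L + i) (i + 1) i else []) ++
            [cx (L + i + 1) (L + i)]) ++ []))))))
        L (60 * L + 60) ?_ ?_ ?_) (prints_nil ?_))) ?_ ?_
  · refine prints_eval rfl (by decide) fun m hm => ?_
    simp [RegsFrom] at hm
    simp [RegsFrom, block, eval, hm]
  · intro i hi
    refine Prints.mono (prints_cons (t := 3)
      (R := Regs [L, 2, 0, 2 * L, 2 * L + 1, L + i, i + 1, L + i + 1, i + 1]) ?_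
      (prints_cons (crevProg_prints inp (by omega)) (prints_cons (t := 1)
        (R := Regs [L, 2, 0, 2 * L, 2 * L + 1, L + i, i, L + i + 1, i + 1]) ?_
        (prints_cons (crevProg_prints inp (by omega)) (prints_cons (fanProg_prints inp (by omega))
          (prints_cons (t := 20) ?_ (prints_nil fun m hm => hm)))))))
      (by omega) rfl
    · refine prints_eval rfl (by decide) fun m hm => ?_
      simp [RegsFrom] at hm
      simp [RegsFrom, block, eval, hm, map_cx]
    · refine prints_eval rfl (by decide) fun m hm => ?_
      simp [RegsFrom] at hm
      simp [RegsFrom, eval, hm]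
    · refine prints_eval rfl (by decide) fun m hm => ?_
      simp [RegsFrom] at hm
      by_cases h : i + 1 < L <;>
        simp [RegsFrom, block, eval, hm, map_cx, h, eval_printAll, map_ccx] <;> omega
  · intro i hi m hm
    simp [RegsFrom] at hm
    simp [hm, hi]
  · intro m hm
    simp [RegsFrom] at hm
    simp [hm]
  · intro m hm
    simp [RegsFrom] at hm
    simp [RegsFrom, hm]
  · nlinarith
  · simp [decodeCircuit, decodeLevel, levelBlocks, sandwich]

/-- Prints the stages of the Fourier transform. -/
def stagesProg (s : Bool) : Prog :=
  block [block [copy 5 3, copy 6 0],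
    loop 2 6 (block [block [decr 5, decr 6, print (.ctrl .H 5 6), copy 7 6, const 8 2],
      loop 2 7 (block [decr 7, incr 8, printAll (ccphase s 8 5 7 6)])])]

theorem stages_eq (s : Bool) (L k : ℕ) :
    stages s L k = (List.range k).flatMap fun i => stage s L (k - 1 - i) := by
  induction k with
  | zero => rfl
  | succ k ih =>
      have e : ∀ i, k + 1 - 1 - (i + 1) = k - 1 - i := fun i => by omega
      rw [stages, ih, flatMap_range_succ']
      simp only [e]
      rfl

theorem stagesProg_prints (inp : ℕ → ℕ → Bool) (s : Bool) {L : ℕ} :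
    Prints inp (Regs [L, 2, 0, 2 * L, 2 * L + 1]) (stagesProg s)
      (stages s L L) (20 * L ^ 2 + 40 * L + 20) (Regs [L, 2, 0, 2 * L, 2 * L + 1]) := by
  refine Prints.mono (prints_cons (o := []) (t := 3)
    (R := Regs [L, 2, 0, 2 * L, 2 * L + 1, 2 * L - 0, L - 0]) ?_
      (prints_cons (t := L * (20 * L + 20 + 1) + 1)
      (prints_loop (fun i => Regs [L, 2, 0, 2 * L, 2 * L + 1, 2 * L - i, L - i])
        (fun i => stage s L (L - 1 - i)) L (20 * L + 20) ?_ ?_ ?_) (prints_nil ?_))) ?_ ?_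
  · refine prints_eval rfl (by decide) fun m hm => ?_
    simp [RegsFrom] at hm
    simp [RegsFrom, block, eval, hm]
  · intro i hi
    -- Pass `i` prints stage `t = L - 1 - i`; substituting for `L` removes the truncated
    -- subtractions.
    obtain ⟨t, rfl⟩ : ∃ t, L = t + 1 + i := ⟨L - 1 - i, by omega⟩
    set L := t + 1 + i with hL
    rw [show L - 1 - i = t by omega, show 2 * L - i = L + t + 1 by omega, show L - i = t +
        1 by omega,
      show 2 * L - (i + 1) = L + t by omega, show L - (i + 1) = t by omega]
    refine Prints.mono (prints_cons (t := 6) (o := [.ctrl .H (L + t) t])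
      (R := Regs [L, 2, 0, 2 * L, 2 * L + 1, L + t, t, t - 0, 2 + 0]) ?_
      (prints_cons (t := t * 15 + 1)
        (prints_loop (fun i => Regs [L, 2, 0, 2 * L, 2 * L + 1, L + t, t, t - i, 2 + i])
          (fun i => ccphase s (3 + i) (L + t) (t - 1 - i) t) t 14 ?_ ?_ ?_) (prints_nil ?_)))
      (by omega) ?_
    · refine prints_eval rfl (by decide) fun m hm => ?_
      simp [RegsFrom] at hm
      simp [RegsFrom, block, eval, hm, Gate.map, Gate1.map]
    · intro k hk
      refine prints_eval rfl (by cases s <;> decide) fun m hm => ?_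
      simp [RegsFrom] at hm
      simp [RegsFrom, block, eval, hm, eval_printAll, map_ccphase]
      refine ⟨?_, by omega, by omega⟩
      congr 1 <;> omega
    · intro k hk m hm
      simp [RegsFrom] at hm
      simp [hm, hk]
    · intro m hm
      simp [RegsFrom] at hm
      simp [hm]
    · intro m hm
      simp [RegsFrom] at hm
      simp [RegsFrom, hm]
    · simp [stage]
  · intro i hi m hm
    simp [RegsFrom] at hm
    simp [hm, hi]
  · intro m hm
    simp [RegsFrom] at hm
    simp [hm]
  · intro m hm
    simp [RegsFrom] at hm
    simp [RegsFrom, hm]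
  · nlinarith
  · simp [stages_eq]

/-- Prints `flips L`. -/
def flipsProg : Prog :=
  block [copy 5 0, loop 5 3 (block [print (.single .X 5), incr 5])]

theorem flipsProg_prints (inp : ℕ → ℕ → Bool) {L : ℕ} :
    Prints inp (Regs [L, 2, 0, 2 * L, 2 * L + 1]) flipsProg
      (flips L) (5 * L + 10) (Regs [L, 2, 0, 2 * L, 2 * L + 1]) := by
  refine Prints.mono (prints_cons (o := []) (t := 1)
    (R := Regs [L, 2, 0, 2 * L, 2 * L + 1, L + 0]) ?_ (prints_cons (t := L * 4 + 1)
      (prints_loop (fun i => Regs [L, 2, 0, 2 * L, 2 * L + 1, L + i])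
        (fun i => [.single .X (L + i)]) L 3 ?_ ?_ ?_) (prints_nil ?_))) ?_ ?_
  · refine prints_eval rfl (by decide) fun m hm => ?_
    simp [RegsFrom] at hm
    simp [RegsFrom, eval, hm]
  · intro i hi
    refine prints_eval rfl (by decide) fun m hm => ?_
    simp [RegsFrom] at hm
    simp [RegsFrom, block, eval, hm, Gate.map, Gate1.map]
    omega
  · intro i hi m hm
    simp [RegsFrom] at hm
    simp [hm]
    omega
  · intro m hm
    simp [RegsFrom] at hm
    simp [hm]
    omega
  · intro m hm
    simp [RegsFrom] at hm
    simp [RegsFrom, hm]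
  · omega
  · simp [flips]

/-- Prints `encodeLevel L`. -/
def encodeLevelProg : Prog :=
  block [block [copy 5 3, decr 5, copy 6 0, decr 6, const 7 0, const 8 0], fanProg, crevProg,
    incr 6,
    crevProg]

theorem encodeLevelProg_prints (inp : ℕ → ℕ → Bool) {L : ℕ} (hL : 1 ≤ L) :
    Prints inp (Regs [L, 2, 0, 2 * L, 2 * L + 1]) encodeLevelProg
      (encodeLevel L) (60 * L + 50) (Regs [L, 2, 0, 2 * L, 2 * L + 1]) := by
  refine Prints.mono (prints_cons (o := []) (t := 7)
    (R := Regs [L, 2, 0, 2 * L, 2 * L + 1, 2 * L - 1, L - 1, 0, 0]) ?_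
      (prints_cons (fanProg_prints inp (by omega)) (prints_cons (crevProg_prints inp (by omega))
        (prints_cons (o := []) (t := 1) (R := Regs [L, 2, 0, 2 * L, 2 * L + 1, 2 * L - 1, L, 0, 0])
            ?_
          (prints_cons (crevProg_prints inp le_rfl) (prints_nil ?_)))))) ?_ ?_
  · refine prints_eval rfl (by decide) fun m hm => ?_
    simp [RegsFrom] at hm
    simp [RegsFrom, block, eval, hm]
  · refine prints_eval rfl (by decide) fun m hm => ?_
    simp [RegsFrom] at hm
    simp [RegsFrom, eval, hm]
    omega
  · intro m hm
    simp [RegsFrom] at hm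
    simp [RegsFrom, hm]
  · omega
  · simp [encodeLevel]

/-- Prints a carry step, with the qubits in the cells `9`, `10`, `11` and the digit in row `6` and
the column in cell `12`. -/
def carryStepProg : Prog :=
  block [read 13 6 12, printAll (ccx 1 9 10 11),
    branch 2 13 (block []) (printAll [cx 9 11, cx 10 11])]

/-- Prints `compareLevel 2 (d j) L j`, with `L + j - 1` in cell `5` and `j` in cell `6`. -/
def compareLevelProg : Prog :=
  block [block [print (.single .X 4), copy 9 6, copy 10 4, copy 11 4, incr 11, const 12 0],
    loop 9 0 (block [carryStepProg, incr 9, incr 10, incr 11, incr 12]),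
    block [read 13 6 12, branch 2 13 (block []) (print (cx 10 5))],
    loop 6 9 (block [decr 9, decr 10, decr 11, decr 12, carryStepProg]),
    print (.single .X 4)]

/-- The printed circuit depends on the digits of `m_j^*`, which are read while printing. The
backward pass reads them again instead of storing them. -/
theorem compareLevelProg_prints (inp : ℕ → ℕ → Bool) {L j f g : ℕ} (hj : 1 ≤ j) (hjL : j ≤ L) :
    Prints inp (Regs [L, 2, 0, 2 * L, 2 * L + 1, L + j - 1, j, f, g]) compareLevelProg
      (compareLevel 2 (inp j) L j) (60 * L + 50)
      (Regs [L, 2, 0, 2 * L, 2 * L + 1, L + j - 1, j, f, g]) := by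
  have hbit : ∀ b : Bool, 0 < b.toNat ↔ b = true := by decide
  refine Prints.mono (prints_cons (o := [.single .X (2 * L + 1)]) (t := 7)
    (R := Regs [L, 2, 0, 2 * L, 2 * L + 1, L + j - 1, j, f, g, j + 0, 2 * L + 1 + 0, 2 * L + 2 + 0,
        0])
    ?_ (prints_cons (t := (L - j) * 26 + 1)
      (prints_loop (fun i => Regs [L, 2, 0, 2 * L, 2 * L + 1, L + j - 1, j, f, g, j + i,
          2 * L + 1 + i, 2 * L + 2 + i, i])
        (fun i => compareStep 2 (inp j) L j i) (L - j) 25 ?_ ?_ ?_)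
    (prints_cons (t := 6)
      (o := if inp j (L - j) then [] else [cx (2 * L + 1 + (L - j)) (L + j - 1)])
      (R := Regs [L, 2, 0, 2 * L, 2 * L + 1, L + j - 1, j, f, g, j + (L - j - 0),
          2 * L + 1 + (L - j - 0), 2 * L + 2 + (L - j - 0), L - j - 0]) ?_
    (prints_cons (t := (L - j) * 26 + 1)
      (prints_loop (fun i => Regs [L, 2, 0, 2 * L, 2 * L + 1, L + j - 1, j, f, g, j + (L - j - i),
          2 * L + 1 + (L - j - i), 2 * L + 2 + (L - j - i), L - j - i])
        (fun i => compareStep 2 (inp j) L j (L - j - 1 - i)) (L - j) 25 ?_ ?_ ?_)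
    (prints_cons (t := 1) (o := [.single .X (2 * L + 1)]) ?_ (prints_nil fun m hm => hm)))))) ?_ ?_
  · refine prints_eval rfl (by decide) fun m hm => ?_
    simp [RegsFrom] at hm
    simp [RegsFrom, block, eval, hm, Gate.map, Gate1.map]
  · intro i hi
    refine prints_eval rfl (by decide) fun m hm => ?_
    simp [RegsFrom] at hm
    cases h : inp j i <;>
    simp [RegsFrom, block, eval, hm, carryStepProg, eval_printAll, map_ccx, map_cx, compareStep,
      carryStep, h] <;> omega
  · intro i hi m hm
    simp [RegsFrom] at hm
    simp [hm]
    omega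
  · intro m hm
    simp [RegsFrom] at hm
    simp [hm]
    omega
  · refine prints_eval rfl (by decide) fun m hm => ?_
    simp [RegsFrom] at hm
    cases h : inp j (L - j) <;>
    simp [RegsFrom, block, eval, hm, map_cx, h]
  · intro i hi
    refine prints_eval rfl (by decide) fun m hm => ?_
    -- The pass first decrements its counters to `k`, which is the step it then prints; positivity
    -- makes the decrement exact.
    obtain ⟨k, hk⟩ : ∃ k, L - j - i = k + 1 := ⟨L - j - i - 1, by omega⟩
    have hk1 : L - j - (i + 1) = k := by omega
    have hk2 : L - j - 1 - i = k := by omega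
    rw [hk] at hm
    rw [hk1, hk2]
    simp [RegsFrom] at hm
    cases h : inp j k <;>
    simp [RegsFrom, block, eval, hm, carryStepProg, eval_printAll, map_ccx, map_cx, compareStep,
      carryStep, h]
  · intro i hi m hm
    simp [RegsFrom] at hm
    simp [hm]
    omega
  · intro m hm
    simp [RegsFrom] at hm
    simp [hm]
  · refine prints_eval rfl (by decide) fun m hm => ?_
    simp [RegsFrom] at hm
    simp [RegsFrom, eval, hm, Gate.map, Gate1.map]
  · omega
  · simp [compareLevel]

/-- Prints the computation of the helper bits. -/
def helperProg : Prog :=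
  block [block [copy 5 0, const 6 1, const 7 0, const 8 0],
    loop 5 3 (block [compareLevelProg, block [incr 5, incr 6]])]

theorem helperProg_prints (inp : ℕ → ℕ → Bool) {L : ℕ} :
    Prints inp (Regs [L, 2, 0, 2 * L, 2 * L + 1]) helperProg
      (helperCircuit inp L) (60 * L ^ 2 + 60 * L + 20) (Regs [L, 2, 0, 2 * L, 2 * L + 1]) := by
  refine Prints.mono (prints_cons (o := []) (t := 5)
    (R := Regs [L, 2, 0, 2 * L, 2 * L + 1, L + 0, 0 + 1, 0, 0]) ?_
      (prints_cons (t := L * (60 * L + 54 + 1) + 1)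
      (prints_loop (fun i => Regs [L, 2, 0, 2 * L, 2 * L + 1, L + i, i + 1, 0, 0])
        (fun i => compareLevel 2 (inp (i + 1)) L (i + 1)) L (60 * L + 54) ?_ ?_ ?_)
            (prints_nil ?_)))
      ?_ ?_
  · refine prints_eval rfl (by decide) fun m hm => ?_
    simp [RegsFrom] at hm
    simp [RegsFrom, block, eval, hm]
  · intro i hi
    have := compareLevelProg_prints inp (L := L) (j := i + 1) (f := 0) (g := 0) (by omega)
        (by omega)
    rw [show L + (i + 1) - 1 = L + i by omega] at this
    refine Prints.mono (prints_cons this (prints_cons (t := 3) (o := [])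
        ?_ (prints_nil fun m hm => hm)))
      (by omega) (by simp)
    refine prints_eval rfl (by decide) fun m hm => ?_
    simp [RegsFrom] at hm
    simp [RegsFrom, block, eval, hm]
    omega
  · intro i hi m hm
    simp [RegsFrom] at hm
    simp [hm]
    omega
  · intro m hm
    simp [RegsFrom] at hm
    simp [hm]
    omega
  · intro m hm
    simp [RegsFrom] at hm
    simp [RegsFrom, hm]
  · nlinarith
  · simp [helperCircuit]

/-- Initialization of the memory. -/
def initProg : Prog :=
  block [block [const 1 2, copy 3 0],
    loop 5 0 (block [incr 3, incr 5]),
    block [copy 4 3, incr 4]]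

/-- The machine has no addition, so `2 * L` is obtained by counting `L` increments from `L`. -/
theorem initProg_prints (inp : ℕ → ℕ → Bool) {L : ℕ} :
    Prints inp (Regs [L, 0, 0, 0, 0, 0]) initProg [] (4 * L + 20)
      (Regs [L, 2, 0, 2 * L, 2 * L + 1]) := by
  refine Prints.mono (prints_cons (o := []) (t := 3)
    (R := Regs [L, 2, 0, L + 0, 0, 0]) ?_ (prints_cons (t := L * 4 + 1)
      (prints_loop (fun i => Regs [L, 2, 0, L + i, 0, i]) (fun _ => []) L 3 ?_ ?_ ?_)
      (prints_cons (o := []) (t := 3) ?_ (prints_nil fun m hm => hm)))) ?_ ?_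
  · refine prints_eval rfl (by decide) fun m hm => ?_
    simp [RegsFrom] at hm
    simp [RegsFrom, block, eval, hm]
  · intro i hi
    refine prints_eval rfl (by decide) fun m hm => ?_
    simp [RegsFrom] at hm
    simp [RegsFrom, block, eval, hm]
    omega
  · intro i hi m hm
    simp [RegsFrom] at hm
    simp [hm, hi]
  · intro m hm
    simp [RegsFrom] at hm
    simp [hm]
  · refine prints_eval rfl (by decide) fun m hm => ?_
    simp [RegsFrom] at hm
    simp [RegsFrom, block, eval, hm]
    omega
  · omega
  · simp

/-- Prints the circuit. -/
def circuitProg : Prog :=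
  block [initProg, flipsProg, stagesProg false, reversalsProg, encodeLevelProg, flipsProg,
    helperProg, decodeProg, stagesProg true, reversalsProg, helperProg]

theorem circuitProg_prints (inp : ℕ → ℕ → Bool) {L : ℕ} (hL : 1 ≤ L) :
    Prints inp (Regs [L, 0, 0, 0, 0, 0]) circuitProg
      (encodeCircuit L ++ helperCircuit inp L ++ decodeCircuit L ++ fourierCircuit true L ++
        helperCircuit inp L) (1000 * L ^ 2) fun _ => True := by
  refine Prints.mono (prints_cons (initProg_prints inp) (prints_cons (flipsProg_prints inp)
    (prints_cons (stagesProg_prints inp false) (prints_cons (reversalsProg_prints inp)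
    (prints_cons (encodeLevelProg_prints inp hL) (prints_cons (flipsProg_prints inp)
    (prints_cons (helperProg_prints inp) (prints_cons (decodeProg_prints inp)
    (prints_cons (stagesProg_prints inp true) (prints_cons (reversalsProg_prints inp)
    (prints_cons (helperProg_prints inp) (prints_nil fun _ _ => trivial)))))))))))) ?_ ?_
  -- For `L ≥ 1` the bounds of the parts add up to at most `925 L^2`.
  · nlinarith
  · simp [encodeCircuit, fourierCircuit]

/-! ### Labels of the qubits -/

/-- All gates of the circuit act on different qubits with labels less than `n`. -/
def ValidCircuit (n : ℕ) (c : List (Gate ℕ)) : Prop := ∀ g ∈ c, g.Valid n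

theorem validCircuit_append {n : ℕ} {c d : List (Gate ℕ)} :
    ValidCircuit n (c ++ d) ↔ ValidCircuit n c ∧ ValidCircuit n d := by
  simp only [ValidCircuit, List.mem_append, or_imp, forall_and]

theorem validCircuit_cons {n : ℕ} {g : Gate ℕ} {c : List (Gate ℕ)} :
    ValidCircuit n (g :: c) ↔ g.Valid n ∧ ValidCircuit n c := by
  simp only [ValidCircuit, List.mem_cons, or_imp, forall_and, forall_eq]

theorem validCircuit_nil {n : ℕ} : ValidCircuit n [] := by simp [ValidCircuit]

theorem ValidCircuit.flatMap {n k : ℕ} {f : ℕ → List (Gate ℕ)}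
    (h : ∀ i < k, ValidCircuit n (f i)) : ValidCircuit n ((List.range k).flatMap f) := by
  intro g hg
  obtain ⟨i, hi, hg⟩ := List.mem_flatMap.1 hg
  exact h i (List.mem_range.1 hi) g hg

section Valid
variable {n k : ℕ} {L a b e t : ℕ}

theorem valid_cx (ha : a < n) (hb : b < n) (hab : a ≠ b) : (cx a b).Valid n := ⟨ha, hb, hab⟩

theorem valid_ccphase (s : Bool) (ha : a < n) (hb : b < n) (ht : t < n) (hab : a ≠ b)
    (hat : a ≠ t) (hbt : b ≠ t) : ValidCircuit n (ccphase s k a b t) := by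
  simp [ccphase, validCircuit_cons, validCircuit_nil, Gate.Valid, cx, *]

theorem valid_ccx (ha : a < n) (hb : b < n) (ht : t < n) (hab : a ≠ b)
    (hat : a ≠ t) (hbt : b ≠ t) : ValidCircuit n (ccx k a b t) := by
  simp only [ccx, validCircuit_cons, validCircuit_append]
  exact ⟨ht, valid_ccphase true ha hb ht hab hat hbt, ht, validCircuit_nil⟩

theorem valid_cswap (he : e < n) (ha : a < n) (hb : b < n) (hab : a ≠ b)
    (hea : e ≠ a) (heb : e ≠ b) : ValidCircuit n (cswap k e a b) := by
  simp only [cswap, validCircuit_cons, validCircuit_append]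
  exact ⟨valid_cx hb ha hab.symm, valid_ccx he ha hb hea heb hab, valid_cx hb ha hab.symm,
    validCircuit_nil⟩

theorem valid_crev {j : ℕ} (he : e < n) (hj : j ≤ e) : ValidCircuit n (crev k e j) :=
  .flatMap fun i hi => valid_cswap he (by omega) (by omega) (by omega) (by omega) (by omega)

theorem valid_fan {c j : ℕ} (he : e < n) (hc : c < e) (hj : j ≤ c) : ValidCircuit n (fan k e c j) :=
  .flatMap fun i hi => valid_ccx he (by omega) (by omega) (by omega) (by omega) (by omega)

theorem valid_levelBlocks {c : ℕ → List (Gate ℕ)} (hn : 2 * L < n)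
    (hc : ∀ i < L, ValidCircuit n (c i)) : ValidCircuit n (levelBlocks c L L) := by
  refine .flatMap fun i hi => ?_
  simp only [sandwich, validCircuit_cons, validCircuit_append]
  exact ⟨valid_cx (by omega) (by omega) (by omega), hc i hi,
    valid_cx (by omega) (by omega) (by omega), validCircuit_nil⟩

theorem valid_fourierCircuit (s : Bool) (hn : 2 * L < n) : ValidCircuit n (fourierCircuit s L) := by
  rw [fourierCircuit, validCircuit_append, stages_eq]
  refine ⟨.flatMap fun i hi => ?_, valid_levelBlocks hn fun i hi => valid_crev (by omega)
      (by omega)⟩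
  rw [stage, validCircuit_cons]
  refine ⟨⟨by omega, by omega, by omega⟩, .flatMap fun i' hi' => ?_⟩
  exact valid_ccphase s (by omega) (by omega) (by omega) (by omega) (by omega) (by omega)

theorem valid_decodeCircuit (hn : 2 * L < n) : ValidCircuit n (decodeCircuit L) := by
  refine valid_levelBlocks hn fun i hi => ?_
  simp only [decodeLevel, validCircuit_append]
  refine ⟨valid_crev (by omega) (by omega), valid_crev (by omega) (by omega),
    valid_fan (by omega) (by omega) le_rfl, ?_⟩
  split_ifs
  · exact valid_ccx (by omega) (by omega) (by omega) (by omega) (by omega) (by omega)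
  · exact validCircuit_nil

theorem valid_flips (hn : 2 * L < n) : ValidCircuit n (flips L) :=
  .flatMap fun i hi => validCircuit_cons.2 ⟨show L + i < n by omega, validCircuit_nil⟩

theorem valid_encodeCircuit (hL : 1 ≤ L) (hn : 2 * L < n) : ValidCircuit n (encodeCircuit L) := by
  simp only [encodeCircuit, encodeLevel, validCircuit_append]
  exact ⟨valid_flips hn, valid_fourierCircuit false hn, ⟨valid_fan (by omega) (by omega) le_rfl,
    valid_crev (by omega) (by omega), valid_crev (by omega) (by omega)⟩, valid_flips hn⟩

theorem valid_helperCircuit (d : ℕ → ℕ → Bool) (hn : 3 * L < n) :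
    ValidCircuit n (helperCircuit d L) := by
  refine .flatMap fun i hi => ?_
  have hs : ∀ r < L - (i + 1), ValidCircuit n (compareStep 2 (d (i + 1)) L (i + 1) r) := by
    intro r hr
    rw [compareStep, carryStep, validCircuit_append]
    refine ⟨valid_ccx (by omega) (by omega) (by omega) (by omega) (by omega) (by omega), ?_⟩
    split_ifs
    · exact validCircuit_nil
    · simp only [validCircuit_cons]
      exact ⟨valid_cx (by omega) (by omega) (by omega), valid_cx (by omega) (by omega) (by omega),
        validCircuit_nil⟩
  have hx : (Gate.single Gate1.X (2 * L + 1)).Valid n := show 2 * L + 1 < n by omega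
  simp only [compareLevel, validCircuit_append, validCircuit_cons]
  refine ⟨hx, .flatMap hs, ?_, .flatMap fun r hr => hs _ (by omega), hx, validCircuit_nil⟩
  split_ifs
  · exact validCircuit_nil
  · exact validCircuit_cons.2 ⟨valid_cx (by omega) (by omega) (by omega), validCircuit_nil⟩

end Valid

end ShannonPacket

/-! ### Assembly of the theorem. -/

open ShannonPacket
theorem theorem1 :
    ∃ (P : Prog) (K : ℕ), ∀ (L : ℕ) (T : PacketTree),
      1 ≤ L → T.Admissible L → T.Monotonic L →
      -- the index blocks of the leaves partition the index set, and the matrix is block-diagonal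
      (∀ p : Fin (2 ^ L), ∃! w : ℕ × ℕ, w ∈ T.leaves L ∧ (p : ℕ) / 2 ^ w.1 = w.2) ∧
      shannonMatrix T L = blockSum T L (fun j m => qft (2 ^ j) * retDecodeMatrix j m) ∧
      -- it is a product of controlled Fourier transforms and controlled retaining decodings
      shannonMatrix T L = controlledQFTs T L * controlledDecodings T L ∧
      ∃ (a : ℕ) (enc comp dec fou unc : List (Gate (Fin (L + a)))),
        L ≤ a ∧
        -- the circuit consists of `O(L^2)` one- and two-qubit gates
        (∀ g ∈ enc ++ comp ++ dec ++ fou ++ unc, g.WellFormed) ∧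
        (enc ++ comp ++ dec ++ fou ++ unc).length ≤ K * L ^ 2 ∧
        -- it implements the transform, the ancilla qubits being returned to zero
        Realizes (enc ++ comp ++ dec ++ fou ++ unc) (zeroAncilla L a) (zeroAncilla L a)
          (shannonTransform T L) ∧
        -- its consecutive parts
        Realizes enc (zeroAncilla L a) (zeroAncilla L a) (encodedFourier L) ∧
        Realizes comp (zeroAncilla L a) (helperAncilla T L a) id ∧
        Realizes dec (helperAncilla T L a) (helperAncilla T L a)
          (fun ψ => controlledDecodings T L *ᵥ ψ) ∧
        Realizes fou (helperAncilla T L a) (helperAncilla T L a)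
          (fun ψ => controlledQFTs T L *ᵥ ψ) ∧
        Realizes unc (helperAncilla T L a) (zeroAncilla L a) id ∧
        -- the circuit is printed in `O(L^2)` steps from the indices of the leftmost leaves
        ∃ (τ : Conf) (t : ℕ),
          Exec (treeInput T L) P (initConf L) τ t ∧ t ≤ K * L ^ 2 ∧
          τ.out = (enc ++ comp ++ dec ++ fou ++ unc).map (Gate.map Fin.val id) := by
  -- The `2 * L + 1` ancillas are `L` helper bits, one qubit that stays `0` in place of `h_{L+1}`,
  -- and `L` carry qubits.
  refine ⟨circuitProg, 1000, fun L T hL hT hm => ⟨fun p => PacketTree.existsUnique_leaf hL hT p.2,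
    shannonMatrix_eq hL hT, shannonMatrix_eq_mul hL hT, 2 * L + 1, ?_⟩⟩
  have hn : L + (2 * L + 1) = 3 * L + 1 := by ring
  have hn' : 2 * L < L + (2 * L + 1) := by omega
  obtain ⟨enc, enc_map, enc_wf⟩ := exists_fin_circuit _ (valid_encodeCircuit hL hn')
  obtain ⟨comp, comp_map, comp_wf⟩ := exists_fin_circuit _
    (valid_helperCircuit (treeInput T L) (show 3 * L < L + (2 * L + 1) by omega))
  obtain ⟨dec, dec_map, dec_wf⟩ := exists_fin_circuit _ (valid_decodeCircuit hn')
  obtain ⟨fou, fou_map, fou_wf⟩ := exists_fin_circuit _ (valid_fourierCircuit true hn')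
  have hz := withAncilla_zero (L := L) (a := 2 * L + 1)
  have hh := withAncilla_helper (a := 2 * L + 1) hL hT
  have hψ : ∀ (ψ : Fin (2 ^ L) → ℂ) (y z : ℕ → Fin 2), (∀ i < L, y i = z i) →
      ψ (num L y) = ψ (num L z) := fun ψ y z h => congrArg ψ (Fin.ext (val_congr h))
  have r_enc : Realizes enc _ _ (encodedFourier L) :=
    realizes_of_nat enc_map hz hz (encodeCircuit_encodedFourier hL hn')
  have r_comp : Realizes comp (zeroAncilla L _) (helperAncilla T L _) id :=
    realizes_of_nat comp_map hz hh fun ψ => by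
      rw [hn]; exact (helperCircuit_restrict hL hT hm (hψ ψ)).1
  have r_unc : Realizes comp (helperAncilla T L _) (zeroAncilla L _) id :=
    realizes_of_nat comp_map hh hz fun ψ => by
      rw [hn]; exact (helperCircuit_restrict hL hT hm (hψ ψ)).2
  have r_dec : Realizes dec _ _ (fun ψ => controlledDecodings T L *ᵥ ψ) :=
    realizes_of_nat dec_map hh hh (decodeCircuit_controlledDecodings hL hT hn')
  have r_fou : Realizes fou _ _ (fun ψ => controlledQFTs T L *ᵥ ψ) :=
    realizes_of_nat fou_map hh hh (fourierCircuit_controlledQFTs hL hT hn')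
  have hmap : (enc ++ comp ++ dec ++ fou ++ comp).map (Gate.map Fin.val id) =
      encodeCircuit L ++ helperCircuit (treeInput T L) L ++ decodeCircuit L ++
        fourierCircuit true L ++ helperCircuit (treeInput T L) L := by
    simp only [List.map_append, enc_map, comp_map, dec_map, fou_map]
  obtain ⟨m', t, hexec, ht, -⟩ := circuitProg_prints (treeInput T L) hL (initConf L).mem
    (by simp [RegsFrom, initConf]) []
  rw [List.nil_append, ← hmap] at hexec
  refine ⟨enc, comp, dec, fou, comp, by omega, ?_, ?_, ?_, r_enc, r_comp, r_dec, r_fou, r_unc,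
    _, t, hexec, ht, rfl⟩
  · intro g hg
    simp only [List.mem_append] at hg
    rcases hg with (((hg | hg) | hg) | hg) | hg
    exacts [enc_wf g hg, comp_wf g hg, dec_wf g hg, fou_wf g hg, comp_wf g hg]
  -- The circuit is the output of the program, so its length is bounded by the running time.
  · have := hexec.length_le
    simp only [List.length_map, List.length_nil, zero_add] at this
    exact this.trans ht
  · have := (((r_enc.append r_comp).append r_dec).append r_fou).append r_unc
    convert this using 2 with ψ
    simp only [shannonTransform, shannonMatrix_eq_mul hL hT, id, Matrix.mulVec_mulVec]
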